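/- **Setting.** A restitution coefficient with exponent $\gamma\ge 0$ is a function $e:[0,\infty)\to(0,1]$ that is absolutely continuous and non-increasing, such that $r\mapsto r\,e(r)$ is strictly increasing and, for some $\alpha>0$, $e(r)=1-\alpha r^{\gamma}+o(r^{\gamma})$ as $r\to0^+$. For $\lambda>0$ put $e_\lambda(r)=e(\lambda r)$. For such a coefficient, or for $e\equiv1$, the gain operator $\mathcal Q_e^+$ of the (hard-sphere) inelastic Boltzmann equation in $\mathbb R^3$ is defined in weak form: $\mathcal Q^+_e(f,g)$ is the (a.e. unique) locally integrable function with $$\int_{\mathbb R^3}\mathcal Q_e^+(f,g)\,\psi\,dv=\int_{\mathbb R^3}\int_{\mathbb R^3}\int_{\mathbb S^2} f(v)\,g(v_*)\,\psi(v')\,\frac{|u|}{4\pi}\,d\sigma\,dv_*\,dv\qquad\text{for all }\psi\in C_c(\mathbb R^3),$$ where $u=v-v_*$, $\hat u=u/|u|$ and $$v'=v-\beta\,\frac{u-|u|\sigma}{2},\qquad \beta=\tfrac12\Big(1+e\Big(|u|\sqrt{\tfrac{1-\hat u\cdot\sigma}{2}}\Big)\Big).$$ For $a\ge0$ let $m_a(v)=\exp(a|v|)$,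 $\langle v\rangle=\sqrt{1+|v|^2}$, and $$\|f\|_{L^1_\eta(m_a)}=\int_{\mathbb R^3}|f(v)|\,\langle v\rangle^{\eta}\,m_a(v)\,dv,\qquad \|g\|_{W^{1,1}_\eta(m_a)}=\|g\|_{L^1_\eta(m_a)}+\sum_{i=1}^3\|\partial_i g\|_{L^1_\eta(m_a)}$$ (weak derivatives), with $L^1(m_a)=L^1_0(m_a)$. **Theorem 3.11.** Let $\gamma\ge0$. There are constants $C(\gamma,a)>0$, $a>0$, depending only on $\gamma$ and $a$, such that for every restitution coefficient $e$ with exponent $\gamma$ there is $\lambda_0\in(0,1)$ (independent of $a$) for which the following holds for all $a>0$ and all $\lambda\in(0,\lambda_0)$. If $f\in L^1_1(m_a)$ and $g\in W^{1,1}_1(m_a)$, then $\mathcal Q^+_{e_\lambda}(f,g)$ and $\mathcal Q^+_1(f,g)$ exist, their difference is in $L^1(m_a)$, and $$\|\mathcal Q^+_{e_\lambda}(f,g)-\mathcal Q^+_1(f,g)\|_{L^1(m_a)}\le C(\gamma,a)\,\lambda^{\frac{\gamma}{8+3\gamma}}\,\|f\|_{L^1_1(m_a)}\,\|g\|_{W^{1,1}_1(m_a)}.$$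 If instead $f\in W^{1,1}_1(m_a)$ and $g\in L^1_1(m_a)$, then likewise $$\|\mathcal Q^+_{e_\lambda}(f,g)-\mathcal Q^+_1(f,g)\|_{L^1(m_a)}\le C(\gamma,a)\,\lambda^{\frac{\gamma}{8+3\gamma}}\,\|g\|_{L^1_1(m_a)}\,\|f\|_{W^{1,1}_1(m_a)}.$$ Moreover (Corollary 3.12), with heavier polynomial weights the rate improves to $\lambda^\gamma$: put $k=\gamma+\frac{10}{3}$. For every restitution coefficient $e$ with exponent $\gamma$ there is $\lambda_0\in(0,1)$ such that for every $a\ge0$ there is $C>0$, depending only on $e$ (hence on $\gamma$) and $a$, for which, for all $\lambda\in(0,\lambda_0)$, if $f\in L^1_k(m_a)$ and $g\in W^{1,1}_k(m_a)$, then both gain terms exist, their difference is in $L^1(m_a)$, and $$\|\mathcal Q^+_{e_\lambda}(f,g)-\mathcal Q^+_1(f,g)\|_{L^1(m_a)}\le C\,\lambda^{\gamma}\,\|f\|_{L^1_k(m_a)}\,\|g\|_{W^{1,1}_k(m_a)},$$ and the same holds with the roles of $f$ and $g$ exchanged in the hypotheses and on the right-hand side. -/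

import Mathlib

open MeasureTheory Set Filter Topology Asymptotics
open scoped ContDiff

namespace Granular

noncomputable section

/-- The velocity space `ℝ³` with its Euclidean norm and Lebesgue measure. -/
abbrev V : Type := EuclideanSpace ℝ (Fin 3)

/-- The unit sphere `𝕊²`. -/
abbrev S2 : Type := Metric.sphere (0 : V) 1

/-- The surface measure `dσ` of the unit sphere (total mass `4π`). -/
def surface : Measure S2 := (volume : Measure V).toSphere

instance : IsFiniteMeasure surface := by
  unfold surface; infer_instance

/-! ### Restitution coefficients -/

/-- The standing assumptions on a restitution coefficient `e`, a function on `[0, ∞)` (the values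
of `e` at negative arguments are never used): `e` takes values in `(0, 1]`, is absolutely continuous
and non-increasing, `r ↦ r e(r)` is strictly increasing, and `e(r) = 1 - α r ^ γ + o(r ^ γ)` as
`r → 0⁺`, with `α > 0` and `γ ≥ 0`.
(For a bounded monotone function, absolute continuity on `[0, ∞)` is the same as absolute
continuity on every `[0, R]`.) -/
structure IsRestitution (e : ℝ → ℝ) (α γ : ℝ) : Prop where
  alpha_pos : 0 < α
  gamma_nonneg : 0 ≤ γ
  pos : ∀ r, 0 ≤ r → 0 < e r
  le_one : ∀ r, 0 ≤ r → e r ≤ 1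
  absolutelyContinuous : ∀ R, 0 ≤ R → AbsolutelyContinuousOnInterval e 0 R
  antitone : AntitoneOn e (Ici 0)
  strictMono : StrictMonoOn (fun r => r * e r) (Ici 0)
  asymptotics : (fun r => e r - (1 - α * r ^ γ)) =o[𝓝[>] 0] (fun r => r ^ γ)

/-- The rescaled coefficient `e_l(r) = e(l r)`. -/
def rescale (e : ℝ → ℝ) (l : ℝ) : ℝ → ℝ := fun r => e (l * r)

/-- The coefficient `e ≡ 1` of elastic collisions. -/
def elastic : ℝ → ℝ := fun _ => 1

/-! ### Collisions and the gain operator -/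

/-- The impact velocity `|u| √((1 - û·σ) / 2)`, where `û = u / |u|`. -/
def impactVelocity (u : V) (σ : S2) : ℝ :=
  ‖u‖ * √((1 - inner ℝ (‖u‖⁻¹ • u) (σ : V)) / 2)

/-- The post-collisional velocity `v' = v - β (u - |u| σ) / 2`, where `u = v - w` and
`β = (1 + e) / 2` is taken at the impact velocity. -/
def postVelocity (e : ℝ → ℝ) (v w : V) (σ : S2) : V :=
  v - (((1 + e (impactVelocity (v - w) σ)) / 2) / 2) • ((v - w) - ‖v - w‖ • (σ : V))

/-- `q` is the gain part `𝒬⁺_e(f, g)` of the bilinear collision operator for hard spheres, with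
collision kernel `|u| / (4π)`, in weak form: `q` is a locally integrable function such that
`∫ q ψ dv = ∫∫∫ f(v) g(w) ψ(v') |v - w| / (4π) dσ dw dv` for all test functions `ψ`. -/
def IsGain (e : ℝ → ℝ) (f g q : V → ℝ) : Prop :=
  LocallyIntegrable q ∧
    ∀ ψ : V → ℝ, Continuous ψ → HasCompactSupport ψ →
      ∫ v, q v * ψ v =
        ∫ p : V × V × S2,
          f p.1 * g p.2.1 * ψ (postVelocity e p.1 p.2.1 p.2.2) * (‖p.1 - p.2.1‖ / (4 * Real.pi))
          ∂((volume : Measure V).prod ((volume : Measure V).prod surface))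

/-- The gain term `𝒬⁺_e(f, g)`: the function characterised, up to null sets, by `IsGain`
(see `IsGain.ae_eq`). -/
def gain (e : ℝ → ℝ) (f g : V → ℝ) : V → ℝ := Classical.epsilon (IsGain e f g)

theorem IsGain.ae_eq {e : ℝ → ℝ} {f g q q' : V → ℝ} (h : IsGain e f g q) (h' : IsGain e f g q') :
    q =ᵐ[volume] q' := by
  refine ae_eq_of_integral_contDiff_smul_eq h.1 h'.1 fun φ hφ hc => ?_
  have h1 := h.2 φ hφ.continuous hc
  have h2 := h'.2 φ hφ.continuous hc
  simp only [smul_eq_mul, mul_comm (φ _)]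
  exact h1.trans h2.symm

theorem isGain_gain {e : ℝ → ℝ} {f g : V → ℝ} (h : ∃ q, IsGain e f g q) :
    IsGain e f g (gain e f g) := Classical.epsilon_spec h

/-! ### Weighted Lebesgue and Sobolev spaces -/

/-- The weight `⟨v⟩ ^ η m_a(v)`, where `⟨v⟩ = √(1 + |v|²)` and `m_a(v) = exp (a |v|)`. -/
def weight (η a : ℝ) (v : V) : ℝ := √(1 + ‖v‖ ^ 2) ^ η * Real.exp (a * ‖v‖)

/-- Membership in `L¹_η(m_a)`. -/
def MemL1 (η a : ℝ) (f : V → ℝ) : Prop := Integrable fun v => f v * weight η a v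

/-- The norm of `L¹_η(m_a)`. -/
def normL1 (η a : ℝ) (f : V → ℝ) : ℝ := ∫ v, |f v| * weight η a v

/-- `h` is the weak (distributional) partial derivative `∂_i g`. -/
def IsWeakPartial (i : Fin 3) (g h : V → ℝ) : Prop :=
  LocallyIntegrable h ∧
    ∀ φ : V → ℝ, ContDiff ℝ ∞ φ → HasCompactSupport φ →
      ∫ v, g v * fderiv ℝ φ v (EuclideanSpace.single i 1) = -∫ v, h v * φ v

/-- The weak partial derivative `∂_i g`, characterised up to null sets by `IsWeakPartial`
(see `IsWeakPartial.ae_eq`). -/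
def weakPartial (i : Fin 3) (g : V → ℝ) : V → ℝ := Classical.epsilon (IsWeakPartial i g)

theorem IsWeakPartial.ae_eq {i : Fin 3} {g h h' : V → ℝ} (hh : IsWeakPartial i g h)
    (hh' : IsWeakPartial i g h') : h =ᵐ[volume] h' := by
  refine ae_eq_of_integral_contDiff_smul_eq hh.1 hh'.1 fun φ hφ hc => ?_
  have h1 := hh.2 φ hφ hc
  have h2 := hh'.2 φ hφ hc
  simp only [smul_eq_mul, mul_comm (φ _)]
  exact neg_injective (h1.symm.trans h2)

theorem isWeakPartial_weakPartial {i : Fin 3} {g : V → ℝ} (h : ∃ h, IsWeakPartial i g h) :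
    IsWeakPartial i g (weakPartial i g) := Classical.epsilon_spec h

/-- Membership in the Sobolev space `W^{1,1}_η(m_a)`: the function and its three weak first-order
partial derivatives belong to `L¹_η(m_a)`. -/
def MemW11 (η a : ℝ) (g : V → ℝ) : Prop :=
  MemL1 η a g ∧ ∀ i, ∃ h, IsWeakPartial i g h ∧ MemL1 η a h

/-- The norm of `W^{1,1}_η(m_a)`. -/
def normW11 (η a : ℝ) (g : V → ℝ) : ℝ := normL1 η a g + ∑ i, normL1 η a (weakPartial i g)

/-- Both gain terms `𝒬⁺_{e_l}(f, g)` and `𝒬⁺_1(f, g)` exist, their difference belongs to `L¹(m_a)`,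
and its norm there is at most `b`. -/
def GainDifferenceBound (e : ℝ → ℝ) (l a : ℝ) (f g : V → ℝ) (b : ℝ) : Prop :=
  IsGain (rescale e l) f g (gain (rescale e l) f g) ∧
  IsGain elastic f g (gain elastic f g) ∧
  MemL1 0 a (gain (rescale e l) f g - gain elastic f g) ∧
  normL1 0 a (gain (rescale e l) f g - gain elastic f g) ≤ b

end

end Granular

open MeasureTheory Set Filter Topology Asymptotics
open scoped ContDiff Pointwise

namespace Granular

noncomputable section

/-! By duality it suffices to test the difference of the gain terms against continuous `ψ` with `|ψ
z| ≤ exp (a |z|)`. Such a `ψ` has no derivative to spare, so the small displacement between the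
inelastic and the elastic outgoing velocity must be paid for by the Sobolev factor. Suppose this is
`g`. Fix `v`, write `w = v - u`, and put `F u = g (v - u)`, `X z = ψ (v - z)`; the quantity to
control is the integral over `u` and `σ` of `F u * (X q - X q₁)`, where `q` and `q₁` are the
inelastic and elastic transferred velocities.

Both families are equivariant under isometries, so `F u * X q` may be replaced by its average over
the orthogonal group, `pairAverage F X u q`, which depends only on the lengths of `u` and `q` and on
the angle between them. Elastic transfers fill the Thales sphere `|q|² = q·u`. The passage from `q`
to `q₁` is split in two.

Angle: `q` is turned to the point of the Thales sphere with the same length. Since only the Gram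
matrix matters, `u` may be turned instead, and the derivative falls on `F`
(`abs_pairAverage_sub_le`). The angle is at most a multiple of `1 - e |u|` times an integrable
function of `σ`.

Length: on the Thales sphere the average is a function of the length alone. By Archimedes' theorem
`y = 1 - û·σ` is uniform on `[0, 2]`, so a change of length is a substitution `y ↦ φ y` in an
integral over an interval. Because `e` decreases and `r e(r)` increases, `φ` and `y - φ y` are both
monotone, and the substitution costs only a supremum times `2 - φ 2`, with no regularity of `ψ`
(`abs_integral_comp_sub_le`). If `f` is the Sobolev factor, the same scheme runs with `w` fixed and
`u - q` in place of `q`.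

The resulting bound carries the factor `|u| (1 - e_l |u|) (|u| |∇F| + |F|)`, used for `|u| ≤ R`. For
`|u| > R` there is no cancellation, but the angular average of `exp (a |v'|)` is smaller than `exp
(a |v|) exp (a |w|)` by a factor of order `1 / (a |u|)` (`integral_exp_postVelocity_le`), so this
region contributes `O(1 / (a R))`. With `R = l ^ (-θ)`, `θ = γ / (8 + 3 γ)`, the near part is at
most a constant times `l ^ θ` once `l` is small: the constant of `e` is absorbed by a surplus power
of `l`, which is why `C` does not depend on `e` and the threshold does not depend on `a`. With
weights of degree `γ + 2` or more, `1 - e_l r ≤ A l ^ γ r ^ γ` is used directly and the rate is `l ^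
γ`. -/

/-! ### Coefficients and collisions -/

/-- The properties of a restitution coefficient used at fixed scale; they hold also for `e ≡ 1`. -/
structure IsCoeff (e : ℝ → ℝ) : Prop where
  continuousOn : ContinuousOn e (Ici 0)
  nonneg : ∀ r, 0 ≤ r → 0 ≤ e r
  le_one : ∀ r, 0 ≤ r → e r ≤ 1
  antitone : AntitoneOn e (Ici 0)
  monotone : MonotoneOn (fun r => r * e r) (Ici 0)

theorem isCoeff_elastic : IsCoeff elastic where
  continuousOn := continuousOn_const
  nonneg := fun _ _ => zero_le_one
  le_one := fun _ _ => le_rfl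
  antitone := fun _ _ _ _ _ => le_rfl
  monotone := fun x _ y _ h => by simpa [elastic] using h

theorem IsRestitution.isCoeff {e : ℝ → ℝ} {α γ : ℝ} (h : IsRestitution e α γ) : IsCoeff e where
  continuousOn := by
    intro x hx
    have hx0 : (0 : ℝ) ≤ x := hx
    have h1 := (h.absolutelyContinuous (x + 1) (by linarith)).continuousOn
    rw [uIcc_of_le (by linarith)] at h1
    refine (h1 x ⟨hx0, by linarith⟩).mono_of_mem_nhdsWithin ?_
    exact mem_nhdsWithin.2 ⟨Iio (x + 1), isOpen_Iio, by simp, fun z hz => ⟨hz.2, hz.1.le⟩⟩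
  nonneg := fun r hr => (h.pos r hr).le
  le_one := h.le_one
  antitone := h.antitone
  monotone := h.strictMono.monotoneOn

theorem IsCoeff.rescale {e : ℝ → ℝ} (h : IsCoeff e) {l : ℝ} (hl : 0 < l) :
    IsCoeff (rescale e l) where
  continuousOn := h.continuousOn.comp (by fun_prop) fun x hx => mul_nonneg hl.le hx
  nonneg := fun r hr => h.nonneg _ (by positivity)
  le_one := fun r hr => h.le_one _ (by positivity)
  antitone := fun x hx y hy hxy => h.antitone (mul_nonneg hl.le hx) (mul_nonneg hl.le hy)
    (mul_le_mul_of_nonneg_left hxy hl.le)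
  monotone := fun x hx y hy hxy => by
    have := h.monotone (mul_nonneg hl.le hx) (mul_nonneg hl.le hy)
      (mul_le_mul_of_nonneg_left hxy hl.le)
    simp only [mul_assoc] at this
    exact le_of_mul_le_mul_left this hl

theorem norm_sphere (σ : S2) : ‖(σ : V)‖ = 1 := by simp

theorem norm_sub_smul_sq (u : V) (σ : S2) :
    ‖u - ‖u‖ • (σ : V)‖ ^ 2 = 2 * ‖u‖ ^ 2 - 2 * ‖u‖ * inner ℝ u (σ : V) := by
  rw [norm_sub_sq_real, norm_smul, norm_sphere, inner_smul_right]; simp; ring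

/-- Half the length of the chord from `|u| σ` to `u`. This form has no division by `|u|`, so
continuity at `u = 0` and invariance under isometries are visible. -/
theorem impactVelocity_eq (u : V) (σ : S2) : impactVelocity u σ = ‖u - ‖u‖ • (σ : V)‖ / 2 := by
  unfold impactVelocity
  rcases eq_or_ne u 0 with rfl | hu
  · simp
  have hn : 0 < ‖u‖ := norm_pos_iff.2 hu
  rw [eq_div_iff two_ne_zero, ← sq_eq_sq₀ (by positivity) (by positivity), norm_sub_smul_sq,
    mul_pow, mul_pow, Real.sq_sqrt, inner_smul_left]
  · simp; field_simp
  · have := real_inner_le_norm (‖u‖⁻¹ • u) (σ : V)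
    rw [norm_smul, norm_sphere] at this
    simp [hn.ne'] at this
    simp; linarith

theorem impactVelocity_nonneg (u : V) (σ : S2) : 0 ≤ impactVelocity u σ := by
  rw [impactVelocity_eq]; positivity

theorem impactVelocity_le (u : V) (σ : S2) : impactVelocity u σ ≤ ‖u‖ := by
  rw [impactVelocity_eq]
  have := norm_sub_le u (‖u‖ • (σ : V))
  rw [norm_smul, norm_sphere] at this
  simp at this; linarith

/-- The velocity transferred in a collision of relative velocity `u`. -/
def shift (e : ℝ → ℝ) (u : V) (σ : S2) : V :=
  (((1 + e (impactVelocity u σ)) / 2) / 2) • (u - ‖u‖ • (σ : V))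

theorem postVelocity_eq (e : ℝ → ℝ) (v w : V) (σ : S2) :
    postVelocity e v w σ = v - shift e (v - w) σ := rfl

theorem IsCoeff.continuous_shift {e : ℝ → ℝ} (h : IsCoeff e) :
    Continuous fun p : V × S2 => shift e p.1 p.2 := by
  have h1 : Continuous fun p : V × S2 => impactVelocity p.1 p.2 := by
    simp only [impactVelocity_eq]; fun_prop
  have h2 : Continuous fun p : V × S2 => e (impactVelocity p.1 p.2) :=
    h.continuousOn.comp_continuous h1 fun p => impactVelocity_nonneg _ _
  unfold shift
  exact (((continuous_const.add h2).div_const 2).div_const 2).smul (by fun_prop)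

/-- Thales: the transferred velocity lies in the ball of diameter `[0, u]`. -/
theorem IsCoeff.norm_shift_sq_le {e : ℝ → ℝ} (h : IsCoeff e) (u : V) (σ : S2) :
    ‖shift e u σ‖ ^ 2 ≤ inner ℝ (shift e u σ) u := by
  have h1 := h.nonneg _ (impactVelocity_nonneg u σ)
  have h2 := h.le_one _ (impactVelocity_nonneg u σ)
  unfold shift
  set b := (1 + e (impactVelocity u σ)) / 2 with hb
  have h3 : inner ℝ (u - ‖u‖ • (σ : V)) u = ‖u - ‖u‖ • (σ : V)‖ ^ 2 / 2 := by
    rw [norm_sub_smul_sq, inner_sub_left, inner_smul_left, real_inner_self_eq_norm_sq,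
      real_inner_comm]
    simp; ring
  rw [norm_smul, mul_pow, Real.norm_eq_abs, sq_abs, inner_smul_left, h3]
  have : b ≤ 1 := by rw [hb]; linarith
  have : 0 ≤ b := by rw [hb]; linarith
  simp only [conj_trivial]
  have : b / 2 * (‖u - ‖u‖ • (σ : V)‖ ^ 2 / 2) - (b / 2) ^ 2 * ‖u - ‖u‖ • (σ : V)‖ ^ 2
    = b * (1 - b) / 4 * ‖u - ‖u‖ • (σ : V)‖ ^ 2 := by ring
  have : 0 ≤ b * (1 - b) / 4 * ‖u - ‖u‖ • (σ : V)‖ ^ 2 := by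
    have : 0 ≤ 1 - b := by linarith
    positivity
  linarith

/-- Energy is not created: if `q` lies in the ball of diameter `[0, u]`, then
`|v - q|² ≤ |v|² + |v - u|²`. -/
theorem norm_sub_le_of_inner {v u q : V} (h : ‖q‖ ^ 2 ≤ inner ℝ q u) :
    ‖v - q‖ ≤ ‖v‖ + ‖v - u‖ := by
  -- The vector `(v - u) + q` is the outgoing velocity of the other particle.
  have h1 : ‖v - q‖ ^ 2 + ‖(v - u) + q‖ ^ 2 ≤ ‖v‖ ^ 2 + ‖v - u‖ ^ 2 := by
    rw [norm_sub_sq_real, norm_add_sq_real (v - u) q, inner_sub_left, real_inner_comm q u]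
    linarith
  have : ‖v - q‖ ^ 2 ≤ (‖v‖ + ‖v - u‖) ^ 2 := by
    nlinarith [norm_nonneg v, norm_nonneg (v - u), sq_nonneg ‖(v - u) + q‖]
  exact abs_le_of_sq_le_sq' this (by positivity) |>.2

theorem norm_add_le_of_inner {w u q : V} (h : ‖q‖ ^ 2 ≤ inner ℝ q u) :
    ‖w + q‖ ≤ ‖w‖ + ‖w + u‖ := by
  have := norm_sub_le_of_inner (v := -w) (u := u) (q := q) h
  rwa [← norm_neg, neg_sub, sub_neg_eq_add, norm_neg, ← norm_neg (-w - u), neg_sub, sub_neg_eq_add,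
    add_comm, add_comm u] at this

theorem IsCoeff.norm_postVelocity_le {e : ℝ → ℝ} (h : IsCoeff e) (v w : V) (σ : S2) :
    ‖postVelocity e v w σ‖ ≤ ‖v‖ + ‖w‖ := by
  have := norm_sub_le_of_inner (v := v) (h.norm_shift_sq_le (v - w) σ)
  simpa [postVelocity_eq] using this

theorem IsCoeff.continuous_postVelocity {e : ℝ → ℝ} (h : IsCoeff e) :
    Continuous fun p : V × V × S2 => postVelocity e p.1 p.2.1 p.2.2 := by
  simp only [postVelocity_eq]
  have : Continuous fun p : V × V × S2 => shift e (p.1 - p.2.1) p.2.2 :=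
    h.continuous_shift.comp (f := fun p : V × V × S2 => (p.1 - p.2.1, p.2.2)) (by fun_prop)
  fun_prop

/-! ### Weights -/

theorem one_le_bracket (v : V) : 1 ≤ √(1 + ‖v‖ ^ 2) := by
  rw [Real.one_le_sqrt]; nlinarith [sq_nonneg ‖v‖]

theorem norm_le_bracket (v : V) : ‖v‖ ≤ √(1 + ‖v‖ ^ 2) :=
  Real.le_sqrt_of_sq_le (by linarith)

theorem weight_pos (η a : ℝ) (v : V) : 0 < weight η a v := by
  have := one_le_bracket v
  unfold weight; positivity

theorem continuous_weight (η a : ℝ) : Continuous (weight η a) := by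
  unfold weight
  refine Continuous.mul (Continuous.rpow_const (by fun_prop) fun v => Or.inl ?_) (by fun_prop)
  exact (zero_lt_one.trans_le (one_le_bracket v)).ne'

theorem weight_zero (a : ℝ) (v : V) : weight 0 a v = Real.exp (a * ‖v‖) := by simp [weight]

theorem weight_mono {η η' : ℝ} (h : η ≤ η') (a : ℝ) (v : V) : weight η a v ≤ weight η' a v :=
  mul_le_mul_of_nonneg_right (Real.rpow_le_rpow_of_exponent_le (one_le_bracket v) h)
    (Real.exp_pos _).le

theorem exp_le_weight {η : ℝ} (h : 0 ≤ η) (a : ℝ) (v : V) :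
    Real.exp (a * ‖v‖) ≤ weight η a v := weight_zero a v ▸ weight_mono h a v

theorem one_le_weight {η a : ℝ} (h : 0 ≤ η) (ha : 0 ≤ a) (v : V) : 1 ≤ weight η a v :=
  (Real.one_le_exp (by positivity)).trans (exp_le_weight h a v)

/-- Polynomial growth in the relative velocity is absorbed by the polynomial weights. -/
theorem norm_sub_rpow_mul_exp_le {p η : ℝ} (hp : 0 ≤ p) (h : p ≤ η) (a : ℝ) (v w : V) :
    ‖v - w‖ ^ p * (Real.exp (a * ‖v‖) * Real.exp (a * ‖w‖)) ≤
      2 ^ p * (weight η a v * weight η a w) := by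
  have h1 : ‖v - w‖ ≤ 2 * (√(1 + ‖v‖ ^ 2) * √(1 + ‖w‖ ^ 2)) := by
    have := norm_sub_le v w
    nlinarith [norm_le_bracket v, norm_le_bracket w, one_le_bracket v, one_le_bracket w]
  have h2 : ‖v - w‖ ^ p ≤ 2 ^ p * (√(1 + ‖v‖ ^ 2) ^ p * √(1 + ‖w‖ ^ 2) ^ p) := by
    rw [← Real.mul_rpow (by positivity) (by positivity),
      ← Real.mul_rpow (by positivity) (by positivity)]
    exact Real.rpow_le_rpow (norm_nonneg _) h1 hp
  calc _ ≤ (2 ^ p * (√(1 + ‖v‖ ^ 2) ^ p * √(1 + ‖w‖ ^ 2) ^ p)) *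
        (Real.exp (a * ‖v‖) * Real.exp (a * ‖w‖)) := by gcongr
    _ = 2 ^ p * (weight p a v * weight p a w) := by unfold weight; ring
    _ ≤ _ := by
      have := (weight_pos p a w).le
      have := (weight_pos η a v).le
      gcongr
      · exact weight_mono h a v
      · exact weight_mono h a w

theorem MemL1.aestronglyMeasurable {η a : ℝ} {f : V → ℝ} (h : MemL1 η a f) :
    AEStronglyMeasurable f := by
  have h1 := h.1.mul ((continuous_weight η a).inv₀ fun v =>
     (weight_pos η a v).ne').aestronglyMeasurable (μ := volume)
  refine h1.congr (ae_of_all _ fun v => ?_)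
  simp [(weight_pos η a v).ne']

theorem MemL1.mono {η η' a : ℝ} {f : V → ℝ} (h : MemL1 η' a f) (hη : η ≤ η') : MemL1 η a f := by
  refine Integrable.mono h (h.aestronglyMeasurable.mul
    (continuous_weight η a).aestronglyMeasurable) (ae_of_all _ fun v => ?_)
  rw [norm_mul, norm_mul, Real.norm_of_nonneg (weight_pos η a v).le,
    Real.norm_of_nonneg (weight_pos η' a v).le]
  gcongr
  exact weight_mono hη a v

theorem MemL1.integrable {η a : ℝ} {f : V → ℝ} (h : MemL1 η a f) (hη : 0 ≤ η) (ha : 0 ≤ a) :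
    Integrable f := by
  refine Integrable.mono h h.aestronglyMeasurable (ae_of_all _ fun v => ?_)
  rw [norm_mul, Real.norm_of_nonneg (weight_pos η a v).le]
  exact le_mul_of_one_le_right (norm_nonneg _) (one_le_weight hη ha v)

theorem MemL1.integrable_abs {η a : ℝ} {f : V → ℝ} (h : MemL1 η a f) :
    Integrable fun v => |f v| * weight η a v := by
  refine h.norm.congr (ae_of_all _ fun v => ?_)
  simp [abs_of_pos (weight_pos η a v)]

theorem normL1_nonneg (η a : ℝ) (f : V → ℝ) : 0 ≤ normL1 η a f :=
  integral_nonneg fun _ => mul_nonneg (abs_nonneg _) (weight_pos _ _ _).le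

/-! ### Integrals against the collision measure -/

/-- The measure `dv dw dσ`. -/
abbrev collisionMeasure : Measure (V × V × S2) :=
  (volume : Measure V).prod ((volume : Measure V).prod surface)

theorem integrable_mul_kernel {η a C : ℝ} {f g : V → ℝ} (hf : MemL1 η a f) (hg : MemL1 η a g)
    {H : V × V × S2 → ℝ} (hH : AEStronglyMeasurable H collisionMeasure)
    (hb : ∀ v w σ, |H (v, w, σ)| ≤ C * (weight η a v * weight η a w)) :
    Integrable (fun p : V × V × S2 => f p.1 * g p.2.1 * H p) collisionMeasure := by
  have h1 : Integrable (fun q : V × S2 => g q.1 * weight η a q.1 * 1)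
      ((volume : Measure V).prod surface) := Integrable.mul_prod hg (integrable_const (1 : ℝ))
  have h2 := (Integrable.mul_prod hf h1).const_mul C
  refine h2.mono ?_ (ae_of_all _ fun ⟨v, w, σ⟩ => ?_)
  · exact (hf.aestronglyMeasurable.comp_fst.mul hg.aestronglyMeasurable.comp_fst.comp_snd).mul hH
  · have := hb v w σ
    have hv := weight_pos η a v
    have hw := weight_pos η a w
    simp only [norm_mul, Real.norm_eq_abs, mul_one, abs_of_pos hv, abs_of_pos hw]
    calc |f v| * |g w| * |H (v, w, σ)| ≤ |f v| * |g w| * (C * (weight η a v * weight η a w)) := by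
          gcongr
      _ ≤ |f v| * |g w| * (|C| * (weight η a v * weight η a w)) := by
          gcongr; exact le_abs_self C
      _ = _ := by ring

/-- Only the integral of the kernel over the sphere is bounded, not its values; this lets the decay
produced by angular averaging be used later. -/
theorem abs_integral_mul_kernel_le {η a C : ℝ} {f g : V → ℝ} (hf : MemL1 η a f)
    (hg : MemL1 η a g) {H : V × V × S2 → ℝ}
    (hI : Integrable (fun p : V × V × S2 => f p.1 * g p.2.1 * H p) collisionMeasure)
    (hb : ∀ v w, ∫ σ, |H (v, w, σ)| ∂surface ≤ C * (weight η a v * weight η a w)) :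
    |∫ p, f p.1 * g p.2.1 * H p ∂collisionMeasure| ≤ C * normL1 η a f * normL1 η a g := by
  have hI' := hI.norm
  calc |∫ p, f p.1 * g p.2.1 * H p ∂collisionMeasure|
      ≤ ∫ p, ‖f p.1 * g p.2.1 * H p‖ ∂collisionMeasure := by
        rw [← Real.norm_eq_abs]; exact norm_integral_le_integral_norm _
    _ = ∫ v, ∫ q, ‖f v * g q.1 * H (v, q)‖ ∂((volume : Measure V).prod surface) :=
        integral_prod _ hI'
    _ ≤ ∫ v, C * normL1 η a g * (|f v| * weight η a v) := by
        refine integral_mono_ae hI'.integral_prod_left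
          (hf.integrable_abs.const_mul _) ?_
        filter_upwards [hI'.prod_right_ae] with v hv
        rw [integral_prod _ hv]
        calc ∫ w, ∫ σ, ‖f v * g w * H (v, w, σ)‖ ∂surface
            ≤ ∫ w, C * (|f v| * weight η a v) * (|g w| * weight η a w) := by
              refine integral_mono hv.integral_prod_left (hg.integrable_abs.const_mul _) fun w => ?_
              simp only [norm_mul, Real.norm_eq_abs]
              rw [integral_const_mul]
              calc _ ≤ |f v| * |g w| * (C * (weight η a v * weight η a w)) := by
                    gcongr; exact hb v w
                _ = _ := by ring
          _ = _ := by rw [integral_const_mul, normL1]; ring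
    _ = _ := by rw [integral_const_mul, normL1, normL1]; ring

/-! ### Existence of the gain term -/

theorem measurePreserving_fiberwise {α β : Type*} [MeasurableSpace α] [MeasurableSpace β]
    (μ : Measure α) (ν : Measure β) [SFinite μ] [SFinite ν] {T : α → β → β}
    (hT : Measurable (Function.uncurry T)) (h : ∀ x, MeasurePreserving (T x) ν ν) :
    MeasurePreserving (fun p : α × β => (p.1, T p.1 p.2)) (μ.prod ν) (μ.prod ν) :=
  (MeasurePreserving.id μ).skew_product hT (ae_of_all _ fun x => (h x).map_eq)

/-- For fixed `(u, σ)` the outgoing velocity is a translate of `v`. Hence the map from `(v', u, σ)`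
to `(v, w, σ)` is a composition of a translation and a reflection in the fibres, whatever `e` is,
and no Jacobian of the collision in `σ` is needed. -/
theorem measurePreserving_collision {e : ℝ → ℝ} (he : IsCoeff e) :
    MeasurePreserving (fun p : V × V × S2 =>
      (p.1 + shift e p.2.1 p.2.2, p.1 + shift e p.2.1 p.2.2 - p.2.1, p.2.2))
      collisionMeasure collisionMeasure := by
  have hsh := he.continuous_shift.measurable
  have h1 := measurePreserving_fiberwise ((volume : Measure V).prod surface) (volume : Measure V)
    (T := fun q z => z + shift e q.1 q.2) (measurable_snd.add (hsh.comp measurable_fst))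
    (fun q => measurePreserving_add_right volume (shift e q.1 q.2))
  have h2 := measurePreserving_fiberwise (volume : Measure V) ((volume : Measure V).prod surface)
    (T := fun v q => (v - q.1, q.2))
    ((measurable_fst.sub (measurable_fst.comp measurable_snd)).prodMk
      (measurable_snd.comp measurable_snd))
    (fun v => (Measure.measurePreserving_sub_left volume v).prod (MeasurePreserving.id surface))
  exact h2.comp ((Measure.measurePreserving_swap.comp h1).comp Measure.measurePreserving_swap)

theorem abs_kernel_le (a : ℝ) (v w : V) {x : ℝ} (hx : |x| ≤ Real.exp (a * ‖v‖) * Real.exp (a * ‖w‖)) :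
    |x * (‖v - w‖ / (4 * Real.pi))| ≤
      2 / (4 * Real.pi) * (weight 1 a v * weight 1 a w) := by
  have h := norm_sub_rpow_mul_exp_le zero_le_one le_rfl a v w
  rw [Real.rpow_one, Real.rpow_one] at h
  rw [abs_mul, abs_of_nonneg (by positivity : 0 ≤ ‖v - w‖ / (4 * Real.pi))]
  calc _ ≤ (Real.exp (a * ‖v‖) * Real.exp (a * ‖w‖)) * (‖v - w‖ / (4 * Real.pi)) := by gcongr
    _ = ‖v - w‖ * (Real.exp (a * ‖v‖) * Real.exp (a * ‖w‖)) / (4 * Real.pi) := by ring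
    _ ≤ 2 * (weight 1 a v * weight 1 a w) / (4 * Real.pi) := by gcongr
    _ = _ := by ring

theorem exp_postVelocity_le {e : ℝ → ℝ} (he : IsCoeff e) {a : ℝ} (ha : 0 ≤ a) (v w : V) (σ : S2) :
    Real.exp (a * ‖postVelocity e v w σ‖) ≤ Real.exp (a * ‖v‖) * Real.exp (a * ‖w‖) := by
  rw [← Real.exp_add, ← mul_add]
  exact Real.exp_le_exp.2 (mul_le_mul_of_nonneg_left (he.norm_postVelocity_le v w σ) ha)

theorem integrable_collision {e : ℝ → ℝ} (he : IsCoeff e) {a : ℝ} (ha : 0 ≤ a) {f g : V → ℝ}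
    (hf : MemL1 1 a f) (hg : MemL1 1 a g) {ψ : V → ℝ} (hψ : Continuous ψ)
    (hb : ∀ z, |ψ z| ≤ Real.exp (a * ‖z‖)) :
    Integrable (fun p : V × V × S2 => f p.1 * g p.2.1 *
      (ψ (postVelocity e p.1 p.2.1 p.2.2) * (‖p.1 - p.2.1‖ / (4 * Real.pi)))) collisionMeasure := by
  have hp := he.continuous_postVelocity
  refine integrable_mul_kernel hf hg (C := 2 / (4 * Real.pi)) ?_ fun v w σ => ?_
  · exact Continuous.aestronglyMeasurable (by fun_prop)
  · exact abs_kernel_le a v w ((hb _).trans (exp_postVelocity_le he ha v w σ))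

/-- In the coordinates `(v', u, σ)` the test function depends on the first variable only, so the
gain term is the integral of the kernel over `(u, σ)`. -/
theorem exists_isGain {e : ℝ → ℝ} (he : IsCoeff e) {a : ℝ} (ha : 0 ≤ a) {f g : V → ℝ}
    (hf : MemL1 1 a f) (hg : MemL1 1 a g) : ∃ q, IsGain e f g q ∧ MemL1 0 a q := by
  have hΘ := measurePreserving_collision he
  set Θ : V × V × S2 → V × V × S2 := fun p =>
    (p.1 + shift e p.2.1 p.2.2, p.1 + shift e p.2.1 p.2.2 - p.2.1, p.2.2) with hΘd
  have hpost : ∀ p, postVelocity e (Θ p).1 (Θ p).2.1 (Θ p).2.2 = p.1 := fun p => by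
    simp [hΘd, postVelocity_eq]
  set K : V × V × S2 → ℝ := fun p => f p.1 * g p.2.1 * (‖p.1 - p.2.1‖ / (4 * Real.pi)) with hK
  have key : ∀ ψ : V → ℝ, Continuous ψ → (∀ z, |ψ z| ≤ Real.exp (a * ‖z‖)) →
      Integrable (fun p => K (Θ p) * ψ p.1) collisionMeasure := fun ψ hψ hb => by
    have := hΘ.integrable_comp_of_integrable (integrable_collision he ha hf hg hψ hb)
    refine this.congr (ae_of_all _ fun p => ?_)
    simp only [Function.comp, hpost, hK]; ring
  set q : V → ℝ := fun z => ∫ r, K (Θ (z, r)) ∂((volume : Measure V).prod surface) with hq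
  have hqψ : ∀ ψ : V → ℝ, (fun z => q z * ψ z) =
      fun z => ∫ r, K (Θ (z, r)) * ψ z ∂((volume : Measure V).prod surface) := fun ψ => by
    ext z; rw [integral_mul_const]
  have hint : ∀ ψ : V → ℝ, Continuous ψ → (∀ z, |ψ z| ≤ Real.exp (a * ‖z‖)) →
      Integrable fun z => q z * ψ z := fun ψ hψ hb => by
    rw [hqψ]; exact (key ψ hψ hb).integral_prod_left
  have hq1 : Integrable q := by
    simpa using hint (fun _ => 1) continuous_const fun z => by
      simpa using mul_nonneg ha (norm_nonneg z)
  refine ⟨q, ⟨hq1.locallyIntegrable, fun ψ hψ hc => ?_⟩, ?_⟩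
  · obtain ⟨M, hM⟩ := hc.exists_bound_of_continuous hψ
    -- Dividing by `|M| + 1` puts the test function below the exponential weight, as `key` requires.
    have hM0 : 0 < |M| + 1 := by positivity
    have hψ' : Continuous fun z => (|M| + 1)⁻¹ * ψ z := by fun_prop
    have hb' : ∀ z, |(|M| + 1)⁻¹ * ψ z| ≤ Real.exp (a * ‖z‖) := fun z => by
      rw [abs_mul, abs_of_pos (inv_pos.2 hM0), inv_mul_le_iff₀ hM0]
      have h1 := hM z
      rw [Real.norm_eq_abs] at h1
      have : 1 ≤ Real.exp (a * ‖z‖) := Real.one_le_exp (by positivity)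
      nlinarith [le_abs_self M]
    have h2 := (key _ hψ' hb').const_mul (|M| + 1)
    have h3 : Integrable (fun p => K (Θ p) * ψ p.1) collisionMeasure := by
      refine h2.congr (ae_of_all _ fun p => ?_)
      simp only; field_simp
    have h4 : Integrable (fun p => f p.1 * g p.2.1 * ψ (postVelocity e p.1 p.2.1 p.2.2) *
        (‖p.1 - p.2.1‖ / (4 * Real.pi))) collisionMeasure := by
      refine ((integrable_collision he ha hf hg hψ' hb').const_mul (|M| + 1)).congr
        (ae_of_all _ fun p => ?_)
      simp only; field_simp
    rw [hqψ, ← integral_prod _ h3]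
    have h5 := integral_map hΘ.aemeasurable (hΘ.map_eq.symm ▸ h4.1)
    rw [hΘ.map_eq] at h5
    refine Eq.trans ?_ h5.symm
    refine integral_congr_ae (ae_of_all _ fun p => ?_)
    simp only
    rw [hpost]; simp only [hK]; ring
  · have := hint (weight 0 a) (continuous_weight 0 a) fun z => by
      rw [weight_zero, abs_of_pos (Real.exp_pos _)]
    exact this

/-! ### Duality -/

/-- The `L¹` norm is the supremum of the pairings with continuous compactly supported functions
bounded by `1`. -/
theorem integral_abs_le_of_pairing {Q : V → ℝ} (hQ : Integrable Q) {B : ℝ}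
    (h : ∀ ψ : V → ℝ, Continuous ψ → HasCompactSupport ψ → (∀ z, |ψ z| ≤ 1) →
      ∫ z, Q z * ψ z ≤ B) : ∫ z, |Q z| ≤ B := by
  refine le_of_forall_pos_le_add fun ε hε => ?_
  obtain ⟨c, hc, hcε, hcc, hci⟩ :=
    hQ.exists_hasCompactSupport_integral_sub_le (ε := ε / 3) (by positivity)
  set m := (volume : Measure V).real (tsupport c) with hm
  have hm0 : 0 ≤ m := measureReal_nonneg
  set η := ε / 3 / (m + 1) with hη
  have hη0 : 0 < η := by positivity
  have hden : ∀ z, 0 < |c z| + η := fun z => by positivity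
  -- A continuous regularisation of the sign of `c`, where `c` approximates `Q` in `L¹`. It loses at
  -- most `η` at each point of the support of `c`, and `η` was chosen so that the total loss is at
  -- most `ε / 3`.
  set ψ : V → ℝ := fun z => c z / (|c z| + η) with hψ
  have hψc : Continuous ψ := hcc.div (by fun_prop) fun z => (hden z).ne'
  have hψs : HasCompactSupport ψ := by
    refine hc.mono fun z hz => ?_
    simp only [hψ, Function.mem_support] at hz ⊢
    intro h0; simp [h0] at hz
  have hψ1 : ∀ z, |ψ z| ≤ 1 := fun z => by
    simp only [hψ]
    rw [abs_div, abs_of_pos (hden z), div_le_one (hden z)]; linarith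
  have hQψ : Integrable fun z => Q z * ψ z :=
    hQ.mul_bdd (c := 1) hψc.aestronglyMeasurable (ae_of_all _ hψ1)
  have hind : Integrable ((tsupport c).indicator fun _ => η) :=
    (integrable_indicator_iff (isClosed_tsupport c).measurableSet).2
      (integrableOn_const hc.measure_ne_top)
  have hpt : ∀ z, |Q z| ≤ Q z * ψ z + (2 * ‖Q z - c z‖ + (tsupport c).indicator (fun _ => η) z) := by
    intro z
    have h1 : |c z| ≤ c z * ψ z + (tsupport c).indicator (fun _ => η) z := by
      by_cases hz : z ∈ tsupport c
      · rw [indicator_of_mem hz]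
        have : c z * ψ z = |c z| - η + η ^ 2 / (|c z| + η) := by
          simp only [hψ]
          have := (hden z).ne'
          field_simp
          have h2 : c z ^ 2 = |c z| ^ 2 := (sq_abs _).symm
          rw [h2]; ring
        have h3 : 0 ≤ η ^ 2 / (|c z| + η) := div_nonneg (sq_nonneg _) (hden z).le
        linarith
      · rw [indicator_of_notMem hz, image_eq_zero_of_notMem_tsupport hz]; simp
    have h2 : |Q z| ≤ |c z| + ‖Q z - c z‖ := by
      rw [Real.norm_eq_abs]; have := abs_sub_abs_le_abs_sub (Q z) (c z); linarith
    have h3 : c z * ψ z ≤ Q z * ψ z + ‖Q z - c z‖ := by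
      have : |(c z - Q z) * ψ z| ≤ ‖Q z - c z‖ := by
        rw [abs_mul, abs_sub_comm, Real.norm_eq_abs]
        exact mul_le_of_le_one_right (abs_nonneg _) (hψ1 z)
      have := le_abs_self ((c z - Q z) * ψ z)
      linarith
    linarith
  have hd : Integrable fun z => ‖Q z - c z‖ := (hQ.sub hci).norm
  calc ∫ z, |Q z| ≤ ∫ z, (Q z * ψ z + (2 * ‖Q z - c z‖ + (tsupport c).indicator (fun _ => η) z)) :=
        integral_mono hQ.abs (hQψ.add ((hd.const_mul 2).add hind)) hpt
    _ = (∫ z, Q z * ψ z) + (2 * (∫ z, ‖Q z - c z‖) + m * η) := by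
        have h2 : Integrable fun z => 2 * ‖Q z - c z‖ + (tsupport c).indicator (fun _ => η) z :=
          (hd.const_mul 2).add hind
        rw [integral_add hQψ h2, integral_add (hd.const_mul 2) hind,
          integral_const_mul, integral_indicator_const _ (isClosed_tsupport c).measurableSet]
        simp [hm]
    _ ≤ B + (2 * (ε / 3) + ε / 3) := by
        have h1 := h ψ hψc hψs hψ1
        have h2 : m * η ≤ ε / 3 := by
          rw [hη, ← mul_div_assoc, div_le_iff₀ (by positivity)]
          nlinarith
        linarith
    _ = B + ε := by ring

theorem normL1_le_of_pairing {a : ℝ} {Q : V → ℝ} (hQ : MemL1 0 a Q) {B : ℝ}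
    (h : ∀ ψ : V → ℝ, Continuous ψ → HasCompactSupport ψ → (∀ z, |ψ z| ≤ Real.exp (a * ‖z‖)) →
      ∫ z, Q z * ψ z ≤ B) : normL1 0 a Q ≤ B := by
  have h1 : normL1 0 a Q = ∫ z, |Q z * weight 0 a z| := by
    simp only [normL1, abs_mul, abs_of_pos (weight_pos 0 a _)]
  rw [h1]
  refine integral_abs_le_of_pairing hQ fun ψ hψ hc hb => ?_
  have := h (fun z => weight 0 a z * ψ z) ((continuous_weight 0 a).mul hψ) hc.mul_left fun z => by
    rw [abs_mul, abs_of_pos (weight_pos 0 a z), ← weight_zero]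
    exact mul_le_of_le_one_right (weight_pos 0 a z).le (hb z)
  simpa only [mul_assoc] using this

/-- To bound the difference of two gain terms it suffices to bound the difference of their weak
forms. -/
theorem gainDifferenceBound_of_pairing {e : ℝ → ℝ} {l a b : ℝ} (he : IsCoeff (rescale e l))
    (ha : 0 ≤ a) {f g : V → ℝ} (hf : MemL1 1 a f) (hg : MemL1 1 a g)
    (h : ∀ ψ : V → ℝ, Continuous ψ → (∃ M, ∀ z, |ψ z| ≤ M) → (∀ z, |ψ z| ≤ Real.exp (a * ‖z‖)) →
      |∫ p, f p.1 * g p.2.1 * ((ψ (postVelocity (rescale e l) p.1 p.2.1 p.2.2) -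
        ψ (postVelocity elastic p.1 p.2.1 p.2.2)) * (‖p.1 - p.2.1‖ / (4 * Real.pi)))
        ∂collisionMeasure| ≤ b) :
    GainDifferenceBound e l a f g b := by
  obtain ⟨q, hq, hqm⟩ := exists_isGain he ha hf hg
  obtain ⟨q', hq', hqm'⟩ := exists_isGain isCoeff_elastic ha hf hg
  have h1 := isGain_gain ⟨q, hq⟩
  have h2 := isGain_gain ⟨q', hq'⟩
  have hm : MemL1 0 a (gain (rescale e l) f g) := hqm.congr (by
    filter_upwards [hq.ae_eq h1] with z hz; rw [hz])
  have hm' : MemL1 0 a (gain elastic f g) := hqm'.congr (by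
    filter_upwards [hq'.ae_eq h2] with z hz; rw [hz])
  have hd : MemL1 0 a (gain (rescale e l) f g - gain elastic f g) :=
    (hm.sub hm').congr (ae_of_all _ fun z => by simp [sub_mul])
  refine ⟨h1, h2, hd, normL1_le_of_pairing hd fun ψ hψ hc hb => ?_⟩
  obtain ⟨M, hM⟩ := hc.exists_bound_of_continuous hψ
  have hi := integrable_collision he ha hf hg hψ hb
  have hi' := integrable_collision isCoeff_elastic ha hf hg hψ hb
  have hgi : ∀ {q : V → ℝ}, MemL1 0 a q → Integrable fun z => q z * ψ z := fun hq =>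
    (hq.integrable le_rfl ha).mul_bdd (c := M) hψ.aestronglyMeasurable (ae_of_all _ hM)
  have h3 : ∫ z, (gain (rescale e l) f g - gain elastic f g) z * ψ z =
      ∫ p, f p.1 * g p.2.1 * ((ψ (postVelocity (rescale e l) p.1 p.2.1 p.2.2) -
        ψ (postVelocity elastic p.1 p.2.1 p.2.2)) * (‖p.1 - p.2.1‖ / (4 * Real.pi)))
        ∂collisionMeasure := by
    simp only [Pi.sub_apply, sub_mul, mul_sub]
    rw [integral_sub (hgi hm) (hgi hm'), integral_sub hi hi', h1.2 ψ hψ hc, h2.2 ψ hψ hc]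
    simp only [mul_assoc]
  rw [h3]
  exact (le_abs_self _).trans (h ψ hψ ⟨M, hM⟩ hb)

/-! ### Averages over the orthogonal group -/

theorem continuousStar_clm (E : Type*) [NormedAddCommGroup E] [InnerProductSpace ℝ E]
    [CompleteSpace E] : ContinuousStar (E →L[ℝ] E) := inferInstance

instance : ContinuousStar (V →L[ℝ] V) := continuousStar_clm V

/-- The orthogonal group of the velocity space. -/
abbrev Iso : Type := unitary (V →L[ℝ] V)

instance : MeasurableSpace Iso := borel _
instance : BorelSpace Iso := ⟨rfl⟩

instance : CompactSpace Iso := by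
  refine isCompact_iff_compactSpace.1 (?_ : IsCompact (unitary (V →L[ℝ] V) : Set (V →L[ℝ] V)))
  refine (isCompact_closedBall (0 : V →L[ℝ] V) 1).of_isClosed_subset isClosed_unitary fun A hA => ?_
  rw [mem_closedBall_zero_iff]
  exact A.opNorm_le_bound zero_le_one fun x => by
    rw [ContinuousLinearMap.norm_map_of_mem_unitary hA, one_mul]

/-- The normalised Haar measure of the orthogonal group. -/
def isoMeasure : Measure Iso := Measure.haarMeasure ⊤

instance : Measure.IsHaarMeasure isoMeasure := by unfold isoMeasure; infer_instance

instance : IsProbabilityMeasure isoMeasure :=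
  ⟨by simpa [isoMeasure] using Measure.haarMeasure_self (K₀ := (⊤ : TopologicalSpace.PositiveCompacts Iso))⟩

/-- Compact groups are unimodular: a right translate of Haar measure is left invariant, hence a
multiple of Haar measure, and the total mass forces the multiple to be `1`. -/
theorem measurePreserving_mul_right_iso (B : Iso) :
    MeasurePreserving (fun A : Iso => A * B) isoMeasure isoMeasure := by
  have hm : Measurable fun A : Iso => A * B := (continuous_mul_const B).measurable
  refine ⟨hm, ?_⟩
  have : (Measure.map (fun A : Iso => A * B) isoMeasure).IsMulLeftInvariant :=
    isMulLeftInvariant_map_mul_right B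
  have hp : IsProbabilityMeasure (Measure.map (fun A : Iso => A * B) isoMeasure) :=
    Measure.isProbabilityMeasure_map hm.aemeasurable
  have h := Measure.isMulInvariant_eq_smul_of_compactSpace
    (Measure.map (fun A : Iso => A * B) isoMeasure) isoMeasure
  have hu := congrArg (fun μ => μ univ) h
  simp only [measure_univ, Measure.smul_apply] at hu
  rw [h]
  have hc : Measure.haarScalarFactor (Measure.map (fun A : Iso => A * B) isoMeasure) isoMeasure = 1 := by
    rw [ENNReal.smul_def, smul_eq_mul, mul_one] at hu
    exact_mod_cast hu.symm
  rw [hc, one_smul]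

theorem continuous_iso_apply : Continuous fun p : Iso × V => (p.1 : V →L[ℝ] V) p.2 :=
  (continuous_subtype_val.comp continuous_fst).clm_apply continuous_snd

theorem norm_iso_apply (A : Iso) (u : V) : ‖(A : V →L[ℝ] V) u‖ = ‖u‖ :=
  ContinuousLinearMap.norm_map_of_mem_unitary A.2 u

theorem inner_iso_apply (A : Iso) (u v : V) :
    inner ℝ ((A : V →L[ℝ] V) u) ((A : V →L[ℝ] V) v) = inner ℝ u v :=
  ContinuousLinearMap.inner_map_map_of_mem_unitary A.2 u v

theorem measurePreserving_iso_apply (A : Iso) :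
    MeasurePreserving (fun u => (A : V →L[ℝ] V) u) volume volume :=
  (Unitary.linearIsometryEquiv A).measurePreserving

/-- Pairs of vectors with the same Gram matrix are congruent. -/
theorem exists_iso_apply_eq {p q p' q' : V} (hp : ‖p‖ = ‖p'‖) (hq : ‖q‖ = ‖q'‖)
    (hpq : inner ℝ p q = inner ℝ p' q') :
    ∃ B : Iso, (B : V →L[ℝ] V) p = p' ∧ (B : V →L[ℝ] V) q = q' := by
  set R₁ := (ℝ ∙ (p - p'))ᗮ.reflection with hR₁
  have h1 : R₁ p = p' := Submodule.reflection_sub hp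
  set q'' := R₁ q with hq''
  set R₂ := (ℝ ∙ (q'' - q'))ᗮ.reflection with hR₂
  have hn : ‖q''‖ = ‖q'‖ := by rw [hq'', LinearIsometryEquiv.norm_map, hq]
  have h2 : R₂ q'' = q' := Submodule.reflection_sub hn
  -- The two pairs have equal inner products, so `q'' - q'` is orthogonal to `p'` and the second
  -- reflection leaves `p'` in place.
  have h3 : R₂ p' = p' := by
    refine Submodule.reflection_mem_subspace_eq_self ?_
    rw [Submodule.mem_orthogonal_singleton_iff_inner_right, inner_sub_left, ← h1, hq'',
      LinearIsometryEquiv.inner_map_map, h1, real_inner_comm, hpq, real_inner_comm, sub_self]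
  refine ⟨Unitary.linearIsometryEquiv.symm (R₁.trans R₂), ?_, ?_⟩
  · have : (Unitary.linearIsometryEquiv (Unitary.linearIsometryEquiv.symm (R₁.trans R₂))) p = p' := by
      rw [MulEquiv.apply_symm_apply]; simp [h1, h3]
    exact this
  · have : (Unitary.linearIsometryEquiv (Unitary.linearIsometryEquiv.symm (R₁.trans R₂))) q = q' := by
      rw [MulEquiv.apply_symm_apply]; simp [← hq'', h2]
    exact this

/-- An isometry carrying one pair to the other is absorbed by right invariance. So group averages of
functions of two vectors see only the Gram matrix, the fact on which the whole displacement argument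
rests. -/
theorem integral_iso_pair_eq {p q p' q' : V} (hp : ‖p‖ = ‖p'‖) (hq : ‖q‖ = ‖q'‖)
    (hpq : inner ℝ p q = inner ℝ p' q') (H : V → V → ℝ) :
    ∫ A : Iso, H ((A : V →L[ℝ] V) p) ((A : V →L[ℝ] V) q) ∂isoMeasure =
      ∫ A : Iso, H ((A : V →L[ℝ] V) p') ((A : V →L[ℝ] V) q') ∂isoMeasure := by
  obtain ⟨B, hB, hB'⟩ := exists_iso_apply_eq hp hq hpq
  have he : MeasurableEmbedding (fun A : Iso => A * B) :=
    (Homeomorph.mulRight B).measurableEmbedding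
  rw [← (measurePreserving_mul_right_iso B).integral_comp he
    (fun A : Iso => H ((A : V →L[ℝ] V) p) ((A : V →L[ℝ] V) q))]
  simp [hB, hB']

theorem integral_iso_norm_eq {p p' : V} (hp : ‖p‖ = ‖p'‖) (H : V → ℝ) :
    ∫ A : Iso, H ((A : V →L[ℝ] V) p) ∂isoMeasure = ∫ A : Iso, H ((A : V →L[ℝ] V) p') ∂isoMeasure :=
  integral_iso_pair_eq (q := 0) (q' := 0) hp rfl (by simp) fun x _ => H x

theorem Continuous.integrable_iso {H : Iso → ℝ} (h : Continuous H) : Integrable H isoMeasure :=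
  h.integrable_of_hasCompactSupport (HasCompactSupport.of_compactSpace H)

/-- The action of an isometry on the sphere. -/
def isoSphere (A : Iso) (σ : S2) : S2 :=
  ⟨(A : V →L[ℝ] V) σ, by rw [mem_sphere_zero_iff_norm, norm_iso_apply]; simp⟩

theorem continuous_isoSphere : Continuous fun p : Iso × S2 => isoSphere p.1 p.2 :=
  Continuous.subtype_mk (continuous_iso_apply.comp
    (f := fun p : Iso × S2 => (p.1, (p.2 : V))) (by fun_prop)) _

/-- The surface measure of a set is three times the volume of the cone over it, and isometries carry
cones to cones of the same volume. -/
theorem measurePreserving_isoSphere (A : Iso) : MeasurePreserving (isoSphere A) surface surface := by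
  have hc : Continuous (isoSphere A) :=
    continuous_isoSphere.comp (f := fun σ : S2 => (A, σ)) (by fun_prop)
  refine ⟨hc.measurable, Measure.ext fun s hs => ?_⟩
  rw [Measure.map_apply hc.measurable hs, surface, Measure.toSphere_apply' _ hs,
    Measure.toSphere_apply' _ (hc.measurable hs)]
  congr 1
  have hpre : Ioo (0 : ℝ) 1 • ((↑) '' (isoSphere A ⁻¹' s) : Set V) =
      (fun u => (A : V →L[ℝ] V) u) ⁻¹' (Ioo (0 : ℝ) 1 • ((↑) '' s : Set V)) := by
    ext u
    simp only [Set.mem_smul, mem_image, mem_preimage]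
    constructor
    · rintro ⟨r, hr, _, ⟨σ, hσ, rfl⟩, rfl⟩
      exact ⟨r, hr, _, ⟨_, hσ, rfl⟩, by simp [isoSphere]⟩
    · rintro ⟨r, hr, _, ⟨σ, hσ, rfl⟩, hu⟩
      have hinj : Function.Injective fun u => (A : V →L[ℝ] V) u :=
        (Unitary.linearIsometryEquiv A).injective
      have hA : isoSphere A (isoSphere A⁻¹ σ) = σ := by
        ext1
        change ((A * A⁻¹ : Iso) : V →L[ℝ] V) (σ : V) = σ
        simp
      refine ⟨r, hr, _, ⟨isoSphere A⁻¹ σ, by rwa [hA], rfl⟩, hinj ?_⟩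
      have h2 := congrArg Subtype.val hA
      simp only [isoSphere] at h2
      simp only [map_smul, ← hu, isoSphere]
      rw [h2]
  rw [hpre]
  exact (measurePreserving_iso_apply A).measure_preimage_emb
    (Unitary.linearIsometryEquiv A).toHomeomorph.measurableEmbedding _

theorem shift_iso (e : ℝ → ℝ) (A : Iso) (u : V) (σ : S2) :
    shift e ((A : V →L[ℝ] V) u) (isoSphere A σ) = (A : V →L[ℝ] V) (shift e u σ) := by
  have : ‖(A : V →L[ℝ] V) u - ‖u‖ • (A : V →L[ℝ] V) (σ : V)‖ = ‖u - ‖u‖ • (σ : V)‖ := by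
    rw [← map_smul, ← map_sub, norm_iso_apply]
  simp only [shift, impactVelocity_eq, isoSphere, norm_iso_apply, this, map_smul, map_sub]

/-! ### Archimedes' theorem: the projection of the sphere to a diameter is uniform -/

/-- The annulus `a ≤ |y|² < b` has area `π (b - a)` when `0 ≤ a`, so the squared radius has constant
density. -/
theorem map_normSq_plane :
    Measure.map (fun y : Fin 2 → ℝ => y 0 ^ 2 + y 1 ^ 2) volume =
      ENNReal.ofReal Real.pi • volume.restrict (Ici (0 : ℝ)) := by
  have hm : Measurable fun y : Fin 2 → ℝ => y 0 ^ 2 + y 1 ^ 2 := by fun_prop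
  have key : ∀ a b : ℝ, a < b →
      Measure.map (fun y : Fin 2 → ℝ => y 0 ^ 2 + y 1 ^ 2) volume (Ico a b) =
      (ENNReal.ofReal Real.pi • volume.restrict (Ici (0 : ℝ))) (Ico a b) := by
    intro a b hab
    have hpre : WithLp.ofLp (p := 2) ⁻¹' ((fun y : Fin 2 → ℝ => y 0 ^ 2 + y 1 ^ 2) ⁻¹' Ico a b) =
        Metric.ball (0 : EuclideanSpace ℝ (Fin 2)) √b \ Metric.ball 0 √a := by
      ext x
      have hx : x 0 ^ 2 + x 1 ^ 2 = ‖x‖ ^ 2 := by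
        rw [EuclideanSpace.real_norm_sq_eq, Fin.sum_univ_two]
      simp only [mem_preimage, mem_Ico, Set.mem_sdiff, mem_ball_zero_iff, hx, not_lt]
      rw [Real.lt_sqrt (norm_nonneg _), Real.sqrt_le_left (norm_nonneg _)]
      tauto
    rw [Measure.map_apply hm measurableSet_Ico,
      ← (PiLp.volume_preserving_ofLp (Fin 2)).measure_preimage (hm measurableSet_Ico).nullMeasurableSet,
      hpre, measure_sdiff (Metric.ball_subset_ball (Real.sqrt_le_sqrt hab.le))
        measurableSet_ball.nullMeasurableSet measure_ball_lt_top.ne,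
      EuclideanSpace.volume_ball_fin_two, EuclideanSpace.volume_ball_fin_two, Measure.smul_apply,
      Measure.restrict_apply measurableSet_Ico, smul_eq_mul]
    have hI : Ico a b ∩ Ici 0 = Ico (max a 0) b := by
      ext x; simp only [mem_inter_iff, mem_Ico, mem_Ici, max_le_iff]; tauto
    have hs : ∀ c : ℝ, ENNReal.ofReal √c ^ 2 = ENNReal.ofReal (max c 0) := fun c => by
      rw [← ENNReal.ofReal_pow (Real.sqrt_nonneg _)]
      rcases le_total 0 c with h | h
      · rw [Real.sq_sqrt h, max_eq_left h]
      · rw [Real.sqrt_eq_zero_of_nonpos h, max_eq_right h]; simp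
    rw [hI, Real.volume_Ico, hs, hs, mul_comm, mul_comm (ENNReal.ofReal (max a 0)),
      ← ENNReal.mul_sub (by simp), ← ENNReal.ofReal_sub _ (le_max_right _ _)]
    congr 1
    rcases le_total 0 b with h | h
    · rw [max_eq_left h]
    · rw [max_eq_right h, max_eq_right (hab.le.trans h), ENNReal.ofReal_eq_zero.2 (by simp),
        ENNReal.ofReal_eq_zero.2 (by simpa using h)]
  refine Measure.ext_of_Ico' _ _ (fun a b hab => ?_) fun a b hab => key a b hab
  rw [key a b hab, Measure.smul_apply, smul_eq_mul]
  refine ENNReal.mul_ne_top ENNReal.ofReal_ne_top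
    (ne_top_of_le_ne_top ?_ (Measure.restrict_apply_le _ _))
  simp

/-- Slicing space orthogonally to the first axis and using the squared radius in each slice,
Lebesgue measure has constant density `π` in the coordinates `(v 0, |v|²)`, over the region `v 0 ² ≤
|v|²`. This constancy is the source of Archimedes' theorem. -/
theorem lintegral_coord_normSq {K : ℝ × ℝ → ENNReal} (hK : Measurable K) :
    ∫⁻ v : V, K (v 0, ‖v‖ ^ 2) =
      ENNReal.ofReal Real.pi * ∫⁻ z, ∫⁻ s, (Ici (z ^ 2)).indicator (fun s => K (z, s)) s := by
  have h1 : ∫⁻ v : V, K (v 0, ‖v‖ ^ 2) =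
      ∫⁻ x : Fin 3 → ℝ, K (x 0, x 0 ^ 2 + (x 1 ^ 2 + x 2 ^ 2)) := by
    rw [← (PiLp.volume_preserving_ofLp (Fin 3)).lintegral_comp (by fun_prop)]
    refine lintegral_congr fun v => ?_
    rw [EuclideanSpace.real_norm_sq_eq, Fin.sum_univ_three, add_assoc]
  have h2 : ∫⁻ x : Fin 3 → ℝ, K (x 0, x 0 ^ 2 + (x 1 ^ 2 + x 2 ^ 2)) =
      ∫⁻ p : ℝ × (Fin 2 → ℝ), K (p.1, p.1 ^ 2 + (p.2 0 ^ 2 + p.2 1 ^ 2)) := by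
    have hp := volume_preserving_piFinSuccAbove (fun _ : Fin 3 => ℝ) 0
    have := hp.lintegral_comp (f := fun p : ℝ × (Fin 2 → ℝ) =>
      K (p.1, p.1 ^ 2 + (p.2 0 ^ 2 + p.2 1 ^ 2))) (by fun_prop)
    rw [← this]
    rfl
  rw [h1, h2]
  have h3 : ∫⁻ p : ℝ × (Fin 2 → ℝ), K (p.1, p.1 ^ 2 + (p.2 0 ^ 2 + p.2 1 ^ 2)) =
      ∫⁻ z : ℝ, ∫⁻ y : Fin 2 → ℝ, K (z, z ^ 2 + (y 0 ^ 2 + y 1 ^ 2)) :=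
    lintegral_prod _ (by fun_prop)
  rw [h3, ← lintegral_const_mul']
  · refine lintegral_congr fun z => ?_
    have h4 : ∫⁻ y : Fin 2 → ℝ, K (z, z ^ 2 + (y 0 ^ 2 + y 1 ^ 2)) =
        ∫⁻ t, K (z, z ^ 2 + t) ∂(Measure.map (fun y : Fin 2 → ℝ => y 0 ^ 2 + y 1 ^ 2) volume) := by
      rw [lintegral_map (by fun_prop) (by fun_prop)]
    rw [h4, map_normSq_plane, lintegral_smul_measure, smul_eq_mul,
      ← lintegral_indicator measurableSet_Ici,
      ← lintegral_add_left_eq_self (μ := volume)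
        ((Ici (z ^ 2)).indicator fun s => K (z, s)) (z ^ 2)]
    congr 1
    refine lintegral_congr fun t => ?_
    simp only [indicator, mem_Ici, le_add_iff_nonneg_right]
  · exact ENNReal.ofReal_ne_top

/-- At squared norm `s` the admissible first coordinates form the set `S ∩ [-1, 1]` scaled by `√s`;
the constant is `π` times the integral `2 / 3` of `√s` over `(0, 1)`. -/
theorem volume_cone {S : Set ℝ} (hS : MeasurableSet S) :
    volume {v : V | ‖v‖ ^ 2 ∈ Ioo (0 : ℝ) 1 ∧ v 0 / √(‖v‖ ^ 2) ∈ S} =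
      ENNReal.ofReal (2 * Real.pi / 3) * volume (S ∩ Icc (-1) 1) := by
  set T : Set (ℝ × ℝ) := {p | p.2 ∈ Ioo (0 : ℝ) 1 ∧ p.1 / √p.2 ∈ S} with hT
  have hTmem : ∀ z s : ℝ, (z, s) ∈ T ↔ s ∈ Ioo (0 : ℝ) 1 ∧ z / √s ∈ S := fun _ _ => Iff.rfl
  have hTm : MeasurableSet T :=
    (measurable_snd measurableSet_Ioo).inter
      ((by fun_prop : Measurable fun p : ℝ × ℝ => p.1 / √p.2) hS)
  have hv : Measurable fun v : V => (v 0, ‖v‖ ^ 2) := by fun_prop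
  have h1 := lintegral_coord_normSq (K := T.indicator 1) (measurable_one.indicator hTm)
  have h2 : ∫⁻ v : V, T.indicator 1 (v 0, ‖v‖ ^ 2) =
      volume {v : V | ‖v‖ ^ 2 ∈ Ioo (0 : ℝ) 1 ∧ v 0 / √(‖v‖ ^ 2) ∈ S} := by
    refine Eq.trans ?_ (lintegral_indicator_one (hv hTm))
    rfl
  rw [← h2, h1, lintegral_lintegral_swap]
  · have h3 : ∀ s : ℝ, ∫⁻ z, (Ici (z ^ 2)).indicator (fun s => T.indicator (1 : ℝ × ℝ → ENNReal) (z, s)) s =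
        (Ioo (0 : ℝ) 1).indicator (fun s => ENNReal.ofReal √s * volume (S ∩ Icc (-1) 1)) s := by
      intro s
      by_cases hs : s ∈ Ioo (0 : ℝ) 1
      · have hs0 : 0 < √s := Real.sqrt_pos.2 hs.1
        rw [indicator_of_mem hs]
        have h4 : ∀ z : ℝ, (Ici (z ^ 2)).indicator (fun s => T.indicator (1 : ℝ × ℝ → ENNReal) (z, s)) s =
            ((fun x => (√s)⁻¹ * x) ⁻¹' (S ∩ Icc (-1) 1)).indicator 1 z := by
          intro z
          have h5 : z ^ 2 ≤ s ↔ (√s)⁻¹ * z ∈ Icc (-1 : ℝ) 1 := by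
            rw [mem_Icc, ← abs_le, abs_mul, abs_of_pos (inv_pos.2 hs0), inv_mul_le_iff₀ hs0, mul_one,
              Real.le_sqrt (abs_nonneg _) hs.1.le, sq_abs]
          have h6 : z ∈ (fun x => (√s)⁻¹ * x) ⁻¹' (S ∩ Icc (-1) 1) ↔ z / √s ∈ S ∧ z ^ 2 ≤ s := by
            rw [h5, mem_preimage, mem_inter_iff, div_eq_inv_mul]
          by_cases h7 : z ^ 2 ≤ s
          · rw [indicator_of_mem (mem_Ici.2 h7)]
            by_cases h8 : z / √s ∈ S
            · rw [indicator_of_mem ((hTmem z s).2 ⟨hs, h8⟩), indicator_of_mem (h6.2 ⟨h8, h7⟩)]; rfl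
            · rw [indicator_of_notMem fun h => h8 ((hTmem z s).1 h).2,
                indicator_of_notMem fun h => h8 (h6.1 h).1]
          · rw [indicator_of_notMem fun h => h7 (mem_Ici.1 h),
              indicator_of_notMem fun h => h7 (h6.1 h).2]
        simp_rw [h4]
        rw [lintegral_indicator_one, Real.volume_preimage_mul_left (inv_ne_zero hs0.ne'), inv_inv,
          abs_of_pos hs0]
        exact (by fun_prop : Measurable fun x : ℝ => (√s)⁻¹ * x) (hS.inter measurableSet_Icc)
      · rw [indicator_of_notMem hs]
        refine (lintegral_congr fun z => ?_).trans lintegral_zero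
        rw [indicator_apply, indicator_of_notMem fun h => hs ((hTmem z s).1 h).1, ite_self]
    simp_rw [h3]
    rw [lintegral_indicator measurableSet_Ioo, lintegral_mul_const _ (by fun_prop), ← mul_assoc]
    congr 1
    have h5 : ∫ s in Ioo (0 : ℝ) 1, √s = 2 / 3 := by
      rw [← integral_Ioc_eq_integral_Ioo, ← intervalIntegral.integral_of_le zero_le_one]
      simp_rw [Real.sqrt_eq_rpow]
      rw [integral_rpow (Or.inl (by norm_num))]
      norm_num
    have h6 : IntegrableOn (fun s : ℝ => √s) (Ioo 0 1) :=
      (Continuous.integrableOn_Icc (by fun_prop)).mono_set Ioo_subset_Icc_self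
    rw [← ofReal_integral_eq_lintegral_ofReal h6 (ae_of_all _ fun s => Real.sqrt_nonneg s), h5,
      ← ENNReal.ofReal_mul Real.pi_pos.le]
    congr 1; ring
  · refine Measurable.aemeasurable ?_
    have : Function.uncurry (fun z s : ℝ =>
        (Ici (z ^ 2)).indicator (fun s => T.indicator (1 : ℝ × ℝ → ENNReal) (z, s)) s) =
        ({p : ℝ × ℝ | p.1 ^ 2 ≤ p.2} ∩ T).indicator 1 := by
      ext ⟨z, s⟩
      have h6 : (z, s) ∈ {p : ℝ × ℝ | p.1 ^ 2 ≤ p.2} ∩ T ↔ z ^ 2 ≤ s ∧ (z, s) ∈ T := Iff.rfl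
      rw [Function.uncurry_apply_pair]
      by_cases h7 : z ^ 2 ≤ s
      · rw [indicator_of_mem (mem_Ici.2 h7)]
        by_cases h8 : (z, s) ∈ T
        · rw [indicator_of_mem h8, indicator_of_mem (h6.2 ⟨h7, h8⟩)]
        · rw [indicator_of_notMem h8, indicator_of_notMem fun h => h8 (h6.1 h).2]
      · rw [indicator_of_notMem fun h => h7 (mem_Ici.1 h),
          indicator_of_notMem fun h => h7 (h6.1 h).1]
    rw [this]
    exact measurable_one.indicator
      ((measurableSet_le (by fun_prop) (by fun_prop)).inter hTm)

/-- After rotating `m` to the first axis, this is three times the volume of the cone, `3 * (2π / 3)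
= 2π`. -/
theorem map_inner_surface {m : V} (h1 : ‖m‖ = 1) :
    Measure.map (fun σ : S2 => inner ℝ m (σ : V)) surface =
      ENNReal.ofReal (2 * Real.pi) • volume.restrict (Icc (-1 : ℝ) 1) := by
  set k : V := EuclideanSpace.single 0 1 with hk
  have hk1 : ‖k‖ = 1 := by simp [hk]
  obtain ⟨A, hA, -⟩ := exists_iso_apply_eq (p := k) (q := 0) (p' := m) (q' := 0)
    (hk1.trans h1.symm) rfl (by simp)
  have hM : ∀ w : V, Measurable fun σ : S2 => inner ℝ w (σ : V) := fun w =>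
    Continuous.measurable (by fun_prop)
  have hmap : Measure.map (fun σ : S2 => inner ℝ m (σ : V)) surface =
      Measure.map (fun σ : S2 => inner ℝ k (σ : V)) surface := by
    rw [← (measurePreserving_isoSphere A).map_eq,
      Measure.map_map (hM m) (measurePreserving_isoSphere A).measurable,
      (measurePreserving_isoSphere A).map_eq]
    congr 1
    ext σ
    simp only [Function.comp, isoSphere, ← hA, inner_iso_apply]
  rw [hmap]
  ext S hS
  rw [Measure.map_apply (hM k) hS, surface, Measure.toSphere_apply' _ (hM k hS),
    Measure.smul_apply, Measure.restrict_apply hS, smul_eq_mul]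
  have hset : Ioo (0 : ℝ) 1 • ((↑) '' ((fun σ : S2 => inner ℝ k (σ : V)) ⁻¹' S) : Set V) =
      {v : V | ‖v‖ ^ 2 ∈ Ioo (0 : ℝ) 1 ∧ v 0 / √(‖v‖ ^ 2) ∈ S} := by
    ext v
    simp only [Set.mem_smul, mem_image, mem_preimage, mem_ofPred_eq]
    constructor
    · rintro ⟨r, hr, _, ⟨σ, hσ, rfl⟩, rfl⟩
      have hn : ‖r • (σ : V)‖ = r := by rw [norm_smul, norm_sphere]; simp [abs_of_pos hr.1]
      rw [hn, Real.sqrt_sq hr.1.le]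
      have h0 := hr.1
      have h1 := hr.2
      refine ⟨⟨by positivity, by nlinarith⟩, ?_⟩
      simpa [hk, EuclideanSpace.inner_single_left, hr.1.ne'] using hσ
    · rintro ⟨hr, hv⟩
      have hv0 : 0 < ‖v‖ := by
        by_contra h
        have : ‖v‖ = 0 := le_antisymm (not_lt.1 h) (norm_nonneg v)
        simp [this] at hr
      rw [Real.sqrt_sq hv0.le] at hv
      have hs : ‖v‖⁻¹ • v ∈ Metric.sphere (0 : V) 1 := by
        rw [mem_sphere_zero_iff_norm, norm_smul, norm_inv, norm_norm, inv_mul_cancel₀ hv0.ne']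
      refine ⟨‖v‖, ⟨hv0, ?_⟩, _, ⟨⟨_, hs⟩, ?_, rfl⟩, ?_⟩
      · have := hr.2; nlinarith
      · simpa [hk, EuclideanSpace.inner_single_left, div_eq_inv_mul] using hv
      · simp [smul_smul, hv0.ne']
  rw [hset, volume_cone hS, ← mul_assoc]
  congr 1
  simp only [finrank_euclideanSpace, Fintype.card_fin]
  rw [show ((3 : ℕ) : ENNReal) = ENNReal.ofReal 3 by simp, ← ENNReal.ofReal_mul (by norm_num)]
  congr 1; ring

/-- Integrals over the sphere of functions of `1 - m·σ`. -/
theorem integral_surface_one_sub_inner {m : V} (h1' : ‖m‖ = 1) {h : ℝ → ℝ}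
    (hM : Measurable h) :
    ∫ σ : S2, h (1 - inner ℝ m (σ : V)) ∂surface = 2 * Real.pi * ∫ y in (0 : ℝ)..2, h y := by
  have hmi : Measurable fun σ : S2 => inner ℝ m (σ : V) := Continuous.measurable (by fun_prop)
  have h1 := integral_map (μ := surface) hmi.aemeasurable
    (f := fun x => h (1 - x)) (hM.comp (by fun_prop)).aestronglyMeasurable
  rw [← h1, map_inner_surface h1', integral_smul_measure, integral_Icc_eq_integral_Ioc,
    ← intervalIntegral.integral_of_le (by norm_num), intervalIntegral.integral_comp_sub_left h,
    ENNReal.toReal_ofReal (by positivity), smul_eq_mul]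
  norm_num

/-- Integrability over the sphere of functions of `1 - m·σ`. -/
theorem integrable_surface_one_sub_inner {m : V} (h1' : ‖m‖ = 1) {h : ℝ → ℝ}
    (hM : Measurable h) (hi : IntervalIntegrable h volume 0 2) :
    Integrable (fun σ : S2 => h (1 - inner ℝ m (σ : V))) surface := by
  have hmi : Measurable fun σ : S2 => inner ℝ m (σ : V) := Continuous.measurable (by fun_prop)
  have h1 := (integrable_map_measure (μ := surface) (f := fun σ : S2 => inner ℝ m (σ : V))
    (g := fun x => h (1 - x)) (hM.comp (by fun_prop)).aestronglyMeasurable hmi.aemeasurable).1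
  refine h1 ?_
  rw [map_inner_surface h1']
  refine Integrable.smul_measure ?_ ENNReal.ofReal_ne_top
  have h2 := hi.comp_sub_left 1
  rw [intervalIntegrable_iff] at h2
  rw [← IntegrableOn, integrableOn_Icc_iff_integrableOn_Ioc]
  refine h2.mono_set ?_
  norm_num [uIoc]

/-! ### One-dimensional estimates -/

theorem abs_intervalIntegral_le_of_bound {χ : ℝ → ℝ} (hχ : Continuous χ) {L M : ℝ}
    (hM : ∀ y ∈ Icc 0 L, |χ y| ≤ M) {s t : ℝ} (hs : s ∈ Icc 0 L) (ht : t ∈ Icc 0 L) :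
    |(∫ y in (0 : ℝ)..t, χ y) - ∫ y in (0 : ℝ)..s, χ y| ≤ M * |t - s| := by
  rw [intervalIntegral.integral_interval_sub_left (hχ.intervalIntegrable _ _)
    (hχ.intervalIntegrable _ _), ← Real.norm_eq_abs]
  refine intervalIntegral.norm_integral_le_of_norm_le_const fun y hy => hM y ?_
  exact (uIcc_subset_Icc hs ht) (uIoc_subset_uIcc hy)

/-- Substituting a slow monotone change of variables `φ` into an integral over `[0, L]` costs at
most twice the total displacement. -/
theorem abs_integral_comp_sub_le_of_monotone {φ χ : ℝ → ℝ} {L M : ℝ} (hL : 0 ≤ L)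
    (hφ : Monotone φ) (hd : Monotone fun y => y - φ y) (h0 : φ 0 = 0) (hχ : Continuous χ)
    (hM : ∀ y ∈ Icc 0 L, |χ y| ≤ M) :
    |(∫ y in (0 : ℝ)..L, χ (φ y)) - ∫ y in (0 : ℝ)..L, χ y| ≤ 2 * M * (L - φ L) := by
  have hM0 : 0 ≤ M := (abs_nonneg _).trans (hM 0 ⟨le_rfl, hL⟩)
  have hlip : ∀ x y, |φ x - φ y| ≤ |x - y| := by
    intro x y
    rcases le_total x y with h | h
    · have h1 := hφ h; have h2 := hd h; simp only at h2
      rw [abs_of_nonpos (by linarith), abs_of_nonpos (by linarith)]; linarith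
    · have h1 := hφ h; have h2 := hd h; simp only at h2
      rw [abs_of_nonneg (by linarith), abs_of_nonneg (by linarith)]; linarith
  have hφl : LipschitzWith 1 φ := LipschitzWith.of_dist_le_mul fun x y => by
    simpa [Real.dist_eq] using hlip x y
  have hmem : ∀ y ∈ Icc 0 L, φ y ∈ Icc 0 L := fun y hy => by
    have h1 := hφ hy.1
    have h2 := hd hy.1
    simp only [h0] at h1 h2
    exact ⟨h1, by linarith [hy.2]⟩
  set Ψ : ℝ → ℝ := fun x => ∫ y in (0 : ℝ)..x, χ y with hΨ
  have hΨd : ∀ x, HasDerivAt Ψ (χ x) x := fun x =>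
    intervalIntegral.integral_hasDerivAt_right (hχ.intervalIntegrable _ _)
      (hχ.stronglyMeasurableAtFilter _ _) hχ.continuousAt
  -- `φ` is only Lipschitz, so the substitution rule is obtained from absolute continuity of `Ψ ∘ φ`
  -- and the almost everywhere chain rule.
  have hac : AbsolutelyContinuousOnInterval (fun y => Ψ (φ y)) 0 L := by
    refine LipschitzOnWith.absolutelyContinuousOnInterval (K := ⟨M, hM0⟩) ?_
    rw [uIcc_of_le hL]
    refine LipschitzOnWith.of_dist_le_mul fun x hx y hy => ?_
    rw [Real.dist_eq, Real.dist_eq]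
    refine (abs_intervalIntegral_le_of_bound hχ hM (hmem y hy) (hmem x hx)).trans ?_
    exact mul_le_mul_of_nonneg_left (hlip x y) hM0
  have hacφ : AbsolutelyContinuousOnInterval φ 0 L :=
    hφl.lipschitzOnWith.absolutelyContinuousOnInterval
  have h1 := hac.integral_deriv_eq_sub
  have h2 := hacφ.integral_deriv_eq_sub
  have hdi : IntervalIntegrable (deriv φ) volume 0 L := hacφ.intervalIntegrable_deriv
  have hcφ : Continuous fun y => χ (φ y) := hχ.comp hφl.continuous
  have hderiv : ∀ᵐ x, deriv (fun y => Ψ (φ y)) x = χ (φ x) * deriv φ x ∧ 0 ≤ deriv φ x ∧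
      deriv φ x ≤ 1 := by
    filter_upwards [hφl.ae_differentiableAt (μ := volume)] with x hx
    refine ⟨((hΨd (φ x)).comp x hx.hasDerivAt).deriv, hφ.deriv_nonneg, ?_⟩
    have h3 : 0 ≤ deriv (fun y => y - φ y) x := hd.deriv_nonneg
    have h4 : HasDerivAt (fun y => y - φ y) (1 - deriv φ x) x :=
      (hasDerivAt_id x).sub hx.hasDerivAt
    rw [h4.deriv] at h3
    linarith
  -- The defect in the substitution is `1 - φ'`, which lies in `[0, 1]` and integrates to `L - φ L`.
  -- The second error, `Ψ L - Ψ (φ L)`, has the same size, whence the factor `2`.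
  have h4 : (∫ y in (0 : ℝ)..L, χ (φ y)) - Ψ (φ L) =
      ∫ y in (0 : ℝ)..L, χ (φ y) * (1 - deriv φ y) := by
    have h5 : Ψ (φ L) = ∫ y in (0 : ℝ)..L, χ (φ y) * deriv φ y := by
      have : Ψ (φ 0) = 0 := by simp [hΨ, h0]
      rw [this, sub_zero] at h1
      rw [← h1]
      refine intervalIntegral.integral_congr_ae ?_
      filter_upwards [hderiv] with x hx _ using hx.1
    rw [h5, ← intervalIntegral.integral_sub (hcφ.intervalIntegrable _ _)
      (hdi.continuousOn_mul hcφ.continuousOn)]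
    simp only [mul_sub, mul_one]
  have h5 : |(∫ y in (0 : ℝ)..L, χ (φ y)) - Ψ (φ L)| ≤ M * (L - φ L) := by
    rw [h4, ← Real.norm_eq_abs]
    have hi : IntervalIntegrable (fun y => M * (1 - deriv φ y)) volume 0 L :=
      (intervalIntegrable_const.sub hdi).const_mul M
    refine (intervalIntegral.norm_integral_le_of_norm_le hL ?_ hi).trans ?_
    · filter_upwards [hderiv] with x hx hxL
      rw [norm_mul, Real.norm_eq_abs, Real.norm_of_nonneg (by linarith [hx.2.2])]
      exact mul_le_mul_of_nonneg_right (hM _ (hmem x ⟨hxL.1.le, hxL.2⟩)) (by linarith [hx.2.2])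
    · rw [intervalIntegral.integral_const_mul, intervalIntegral.integral_sub
        intervalIntegrable_const hdi, h2, h0]
      simp
  have h6 : |Ψ L - Ψ (φ L)| ≤ M * (L - φ L) := by
    have hφL := hmem L ⟨hL, le_rfl⟩
    have := abs_intervalIntegral_le_of_bound hχ hM hφL (t := L) ⟨hL, le_rfl⟩
    rwa [abs_of_nonneg (by linarith [hφL.2] : 0 ≤ L - φ L)] at this
  have h7 := abs_sub_le ((∫ y in (0 : ℝ)..L, χ (φ y))) (Ψ (φ L)) (Ψ L)
  rw [abs_sub_comm (Ψ (φ L))] at h7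
  linarith

/-- Restitution coefficients are only controlled on `[0, ∞)`, so `φ` is frozen at its value at `0`
on the negative axis. -/
theorem abs_integral_comp_sub_le {φ χ : ℝ → ℝ} {L M : ℝ} (hL : 0 ≤ L)
    (hφ : MonotoneOn φ (Ici 0)) (hd : MonotoneOn (fun y => y - φ y) (Ici 0)) (h0 : φ 0 = 0)
    (hχ : Continuous χ) (hM : ∀ y ∈ Icc 0 L, |χ y| ≤ M) :
    |(∫ y in (0 : ℝ)..L, χ (φ y)) - ∫ y in (0 : ℝ)..L, χ y| ≤ 2 * M * (L - φ L) := by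
  have hmax : ∀ y : ℝ, max y 0 ∈ Ici (0 : ℝ) := fun y => mem_Ici.2 (le_max_right _ _)
  have h1 := abs_integral_comp_sub_le_of_monotone (φ := fun y => φ (max y 0)) hL
    (fun x y hxy => hφ (hmax x) (hmax y) (max_le_max_right 0 hxy)) ?_ (by simp [h0]) hχ hM
  · simp only [max_eq_left hL] at h1
    have h2 : ∫ y in (0 : ℝ)..L, χ (φ (max y 0)) = ∫ y in (0 : ℝ)..L, χ (φ y) := by
      refine intervalIntegral.integral_congr fun y hy => ?_
      rw [uIcc_of_le hL] at hy
      simp only [max_eq_left hy.1]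
    rwa [h2] at h1
  · intro x y hxy
    have h3 := hd (hmax x) (hmax y) (max_le_max_right 0 hxy)
    simp only at h3 ⊢
    have h4 : x - max x 0 ≤ y - max y 0 := by
      rcases le_total x 0 with hx | hx
      · rcases le_total y 0 with hy | hy
        · rw [max_eq_right hx, max_eq_right hy]; linarith
        · rw [max_eq_right hx, max_eq_left hy]; linarith
      · rw [max_eq_left hx, max_eq_left (hx.trans hxy)]; linarith
    linarith

/-- By the mean value theorem for the cosine: on `[arccos b, arccos a]`, which ends before `π / 2`,
the slope is at least `sin (arccos b)` in absolute value. -/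
theorem arccos_sub_arccos_le {a b : ℝ} (ha : 0 ≤ a) (hab : a ≤ b) (hb : b < 1) :
    Real.arccos a - Real.arccos b ≤ (b - a) / √(1 - b ^ 2) := by
  have hs : 0 < √(1 - b ^ 2) := Real.sqrt_pos.2 (by nlinarith)
  rw [le_div_iff₀ hs, ← Real.sin_arccos]
  rcases hab.eq_or_lt with rfl | hlt
  · simp
  have hlt' : Real.arccos b < Real.arccos a :=
    Real.strictAntiOn_arccos ⟨by linarith, by linarith⟩ ⟨by linarith, by linarith⟩ hlt
  obtain ⟨c, hc, hc'⟩ := exists_hasDerivAt_eq_slope Real.cos (fun x => -Real.sin x) hlt'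
    Real.continuous_cos.continuousOn fun x _ => Real.hasDerivAt_cos x
  rw [Real.cos_arccos (by linarith) (by linarith), Real.cos_arccos (by linarith) (by linarith),
    eq_div_iff (by linarith)] at hc'
  have h2 : Real.arccos a ≤ Real.pi / 2 := Real.arccos_le_pi_div_two.2 ha
  have h3 : Real.sin (Real.arccos b) ≤ Real.sin c :=
    Real.sin_le_sin_of_le_of_le_pi_div_two (by linarith [Real.arccos_nonneg b, Real.pi_pos])
      (by linarith [hc.2]) hc.1.le
  nlinarith

/-- This is the weight of the angle bound. It blows up at `y = 2`, the head-on collisions, but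
remains integrable. -/
theorem intervalIntegrable_rpow_one_sub :
    IntervalIntegrable (fun y : ℝ => (1 - y / 2) ^ (-(1 / 2) : ℝ)) volume 0 2 := by
  have h : IntervalIntegrable (fun t : ℝ => t ^ (-(1 / 2) : ℝ)) volume 1 0 :=
    intervalIntegral.intervalIntegrable_rpow' (by norm_num)
  have h2 := (h.comp_sub_left 1).comp_mul_left (c := 1 / 2)
  norm_num at h2
  refine h2.congr fun y _ => ?_
  ring_nf

theorem integral_rpow_one_sub : ∫ y in (0 : ℝ)..2, (1 - y / 2) ^ (-(1 / 2) : ℝ) = 4 := by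
  have h1 := intervalIntegral.integral_comp_sub_div (a := 0) (b := 2)
    (fun t : ℝ => t ^ (-(1 / 2) : ℝ)) (c := 2) two_ne_zero 1
  rw [h1, integral_rpow (Or.inl (by norm_num))]
  norm_num

/-! ### Displacing pairs of vectors under the average over the orthogonal group -/

/-- The average of `F(Ap) X(Aq)` over all isometries `A`. -/
def pairAverage (F X : V → ℝ) (p q : V) : ℝ :=
  ∫ A : Iso, F ((A : V →L[ℝ] V) p) * X ((A : V →L[ℝ] V) q) ∂isoMeasure

/-- The average of `F(Ap)` over all isometries `A`, i.e. over the sphere through `p`. -/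
def sphereAverage (F : V → ℝ) (p : V) : ℝ := ∫ A : Iso, F ((A : V →L[ℝ] V) p) ∂isoMeasure

theorem continuous_sphereAverage_of {Y : Type*} [TopologicalSpace Y] [FirstCountableTopology Y]
    [LocallyCompactSpace Y] {H : Y → Iso → ℝ} (hH : Continuous (Function.uncurry H)) :
    Continuous fun y => ∫ A, H y A ∂isoMeasure := by
  have := continuous_parametric_integral_of_continuous (μ := isoMeasure) hH isCompact_univ
  simpa using this

theorem continuous_pairAverage {F X : V → ℝ} (hF : Continuous F) (hX : Continuous X) (p : V) :
    Continuous (pairAverage F X p) := by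
  refine continuous_sphereAverage_of (H := fun q (A : Iso) =>
    F ((A : V →L[ℝ] V) p) * X ((A : V →L[ℝ] V) q)) ?_
  have h1 : Continuous fun z : V × Iso => (z.2 : V →L[ℝ] V) p :=
    continuous_iso_apply.comp (f := fun z : V × Iso => (z.2, p)) (by fun_prop)
  have h2 : Continuous fun z : V × Iso => (z.2 : V →L[ℝ] V) z.1 :=
    continuous_iso_apply.comp (f := fun z : V × Iso => (z.2, z.1)) (by fun_prop)
  exact (hF.comp h1).mul (hX.comp h2)

theorem continuous_iso_apply_left (p : V) : Continuous fun A : Iso => (A : V →L[ℝ] V) p :=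
  continuous_iso_apply.comp (f := fun A : Iso => (A, p)) (by fun_prop)

theorem continuous_sphereAverage {F : V → ℝ} (hF : Continuous F) :
    Continuous (sphereAverage F) := by
  refine continuous_sphereAverage_of (H := fun q (A : Iso) => F ((A : V →L[ℝ] V) q)) ?_
  exact hF.comp (continuous_iso_apply.comp (f := fun z : V × Iso => (z.2, z.1)) (by fun_prop))

/-- The condition that `q` lies in the ball of diameter `[0, p]` is invariant under isometries, so
the bound of `X` by `W` holds all along the average. In the application `W` is the product of the
exponential weights of the incoming velocities. -/
theorem abs_pairAverage_le {F X W : V → ℝ} (hF : Continuous F)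
    (hW : Continuous W) (hXW : ∀ p q : V, ‖q‖ ^ 2 ≤ inner ℝ q p → |X q| ≤ W p) {p q : V}
    (hpq : ‖q‖ ^ 2 ≤ inner ℝ q p) :
    |pairAverage F X p q| ≤ sphereAverage (fun x => |F x| * W x) p := by
  have hp := continuous_iso_apply_left p
  have hq := continuous_iso_apply_left q
  rw [← Real.norm_eq_abs]
  refine norm_integral_le_of_norm_le
    (Continuous.integrable_iso (H := fun A : Iso => |F ((A : V →L[ℝ] V) p)| * W ((A : V →L[ℝ] V) p))
      (by fun_prop)) (ae_of_all _ fun A => ?_)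
  rw [norm_mul, Real.norm_eq_abs, Real.norm_eq_abs]
  refine mul_le_mul_of_nonneg_left (hXW _ _ ?_) (abs_nonneg _)
  rwa [norm_iso_apply, inner_iso_apply]

/-- The point at angle `t` from `m` on the circle of radius `ρ` in the plane of `m` and `n`. -/
def circlePoint (ρ : ℝ) (m n : V) (t : ℝ) : V := ρ • (Real.cos t • m + Real.sin t • n)

theorem hasDerivAt_circlePoint (ρ : ℝ) (m n : V) (t : ℝ) :
    HasDerivAt (circlePoint ρ m n) (ρ • (-Real.sin t • m + Real.cos t • n)) t :=
  (((Real.hasDerivAt_cos t).smul_const m).add ((Real.hasDerivAt_sin t).smul_const n)).const_smul ρ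

theorem norm_comb_sq {m n : V} (hm : ‖m‖ = 1) (hn : ‖n‖ = 1) (hmn : inner ℝ m n = 0) (a b : ℝ) :
    ‖a • m + b • n‖ ^ 2 = a ^ 2 + b ^ 2 := by
  rw [norm_add_sq_real, norm_smul, norm_smul, hm, hn, inner_smul_left, inner_smul_right, hmn]
  simp

theorem norm_circlePoint {m n : V} (hm : ‖m‖ = 1) (hn : ‖n‖ = 1) (hmn : inner ℝ m n = 0) {ρ : ℝ}
    (hρ : 0 ≤ ρ) (t : ℝ) : ‖circlePoint ρ m n t‖ = ρ := by
  have h : ‖Real.cos t • m + Real.sin t • n‖ = 1 := by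
    rw [← sq_eq_sq₀ (norm_nonneg _) zero_le_one, norm_comb_sq hm hn hmn]
    simp
  rw [circlePoint, norm_smul, h, Real.norm_of_nonneg hρ, mul_one]

theorem continuous_circlePoint (ρ : ℝ) (m n : V) : Continuous (circlePoint ρ m n) := by
  unfold circlePoint; fun_prop

/-- Rotating `u` along a circle changes a `C¹` function by at most the integral of its gradient. -/
theorem abs_sub_circlePoint_le {F N : V → ℝ} (hF : ContDiff ℝ 1 F) (hN : Continuous N)
    (hFN : ∀ x, ‖fderiv ℝ F x‖ ≤ N x) {m n : V} (hm : ‖m‖ = 1) (hn : ‖n‖ = 1)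
    (hmn : inner ℝ m n = 0) {ρ : ℝ} (hρ : 0 ≤ ρ) (A : Iso) {s t : ℝ} (hst : s ≤ t) :
    |F ((A : V →L[ℝ] V) (circlePoint ρ m n t)) - F ((A : V →L[ℝ] V) (circlePoint ρ m n s))| ≤
      ∫ r in s..t, ρ * N ((A : V →L[ℝ] V) (circlePoint ρ m n r)) := by
  have hc := continuous_circlePoint ρ m n
  have hF' : Continuous (fderiv ℝ F) := hF.continuous_fderiv one_ne_zero
  have hd : ∀ r, HasDerivAt (fun r => F ((A : V →L[ℝ] V) (circlePoint ρ m n r)))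
      (fderiv ℝ F ((A : V →L[ℝ] V) (circlePoint ρ m n r))
        ((A : V →L[ℝ] V) (ρ • (-Real.sin r • m + Real.cos r • n)))) r := fun r =>
    ((hF.differentiable one_ne_zero _).hasFDerivAt).comp_hasDerivAt r
      ((A : V →L[ℝ] V).hasFDerivAt.comp_hasDerivAt r (hasDerivAt_circlePoint ρ m n r))
  have hAc : Continuous fun r => (A : V →L[ℝ] V) (circlePoint ρ m n r) :=
    (A : V →L[ℝ] V).continuous.comp hc
  have hcont : Continuous fun r => fderiv ℝ F ((A : V →L[ℝ] V) (circlePoint ρ m n r))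
      ((A : V →L[ℝ] V) (ρ • (-Real.sin r • m + Real.cos r • n))) :=
    (hF'.comp hAc).clm_apply ((A : V →L[ℝ] V).continuous.comp (by fun_prop))
  rw [← intervalIntegral.integral_eq_sub_of_hasDerivAt (fun r _ => hd r)
    (hcont.intervalIntegrable _ _), ← Real.norm_eq_abs]
  refine intervalIntegral.norm_integral_le_of_norm_le hst (ae_of_all _ fun r _ => ?_)
    (((hN.comp hAc).const_smul ρ).intervalIntegrable _ _)
  refine (ContinuousLinearMap.le_opNorm _ _).trans ?_
  have h : ‖(A : V →L[ℝ] V) (ρ • (-Real.sin r • m + Real.cos r • n))‖ = ρ := by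
    have h1 : ‖-Real.sin r • m + Real.cos r • n‖ = 1 := by
      rw [← sq_eq_sq₀ (norm_nonneg _) zero_le_one, norm_comb_sq hm hn hmn]
      simp
    rw [norm_iso_apply, norm_smul, h1, Real.norm_of_nonneg hρ, mul_one]
  rw [h, mul_comm]
  exact mul_le_mul_of_nonneg_left (hFN _) hρ

/-- Here the derivative is moved onto `F`. The points `q` and `q'` have the same length, so passing
from one to the other only changes the angle with `u`. By invariance of the average, `q'` may be
kept fixed while `u` is rotated in the plane of `u` and `q'`; then `X` is always evaluated at the
same point, and only `F` is differentiated. -/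
theorem abs_pairAverage_sub_le {F N X W : V → ℝ} (hF : ContDiff ℝ 1 F) (hN : Continuous N)
    (hFN : ∀ x, ‖fderiv ℝ F x‖ ≤ N x) (hX : Continuous X) (hW : Continuous W)
    (hXW : ∀ p q : V, ‖q‖ ^ 2 ≤ inner ℝ q p → |X q| ≤ W p) {u q q' : V} (hu : u ≠ 0)
    (hq : ‖q‖ ^ 2 ≤ inner ℝ q u) (hqq : ‖q'‖ = ‖q‖) (hq' : inner ℝ q' u = ‖q'‖ ^ 2) :
    |pairAverage F X u q - pairAverage F X u q'| ≤
      (Real.arccos (‖q‖ / ‖u‖) - Real.arccos (inner ℝ q u / (‖q‖ * ‖u‖))) *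
        (‖u‖ * sphereAverage (fun x => N x * W x) u) := by
  have hN0 : ∀ x, 0 ≤ N x := fun x => (norm_nonneg _).trans (hFN x)
  have hu0 : 0 < ‖u‖ := norm_pos_iff.2 hu
  rcases eq_or_ne q 0 with rfl | hq0
  · have : q' = 0 := by simpa using hqq
    simp [this]
  have hqn : 0 < ‖q‖ := norm_pos_iff.2 hq0
  have hcs : inner ℝ q u ≤ ‖q‖ * ‖u‖ := real_inner_le_norm q u
  have hqu : ‖q‖ ≤ ‖u‖ := by nlinarith
  -- If `u = q'` the plane of rotation degenerates, but then `q = u` as well.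
  rcases eq_or_ne u q' with rfl | huq
  · have h1 : q = u := by
      rw [← sub_eq_zero, ← norm_eq_zero, ← sq_eq_zero_iff, norm_sub_sq_real]
      have h2 : ‖q - u‖ ^ 2 = ‖q‖ ^ 2 - 2 * inner ℝ q u + ‖u‖ ^ 2 := norm_sub_sq_real q u
      have := sq_nonneg ‖q - u‖
      rw [← hqq] at hq hcs ⊢
      nlinarith
    subst h1
    simp [sq, hqn.ne']
  set m : V := ‖q‖⁻¹ • q' with hm
  set d := ‖u - q'‖ with hd
  have hd0 : 0 < d := norm_pos_iff.2 (sub_ne_zero.2 huq)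
  set n : V := d⁻¹ • (u - q') with hn
  have hm1 : ‖m‖ = 1 := by
    rw [hm, norm_smul, hqq, norm_inv, norm_norm, inv_mul_cancel₀ hqn.ne']
  have hn1 : ‖n‖ = 1 := by
    rw [hn, norm_smul, ← hd, norm_inv, Real.norm_of_nonneg hd0.le, inv_mul_cancel₀ hd0.ne']
  have hmn : inner ℝ m n = 0 := by
    rw [hm, hn, inner_smul_left, inner_smul_right, inner_sub_right, hq', real_inner_self_eq_norm_sq]
    simp
  have hdsq : d ^ 2 = ‖u‖ ^ 2 - ‖q‖ ^ 2 := by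
    rw [hd, norm_sub_sq_real, real_inner_comm, hq', hqq]; ring
  -- The angles that `q'` and `q` make with `u`: the rotating vector is at angle `ξ` from `q'` when
  -- it equals `u`, and at angle `η` when its Gram matrix with `q'` is that of `u` with `q`.
  set ξ := Real.arccos (‖q‖ / ‖u‖) with hξ
  set η := Real.arccos (inner ℝ q u / (‖q‖ * ‖u‖)) with hη
  have hab : ‖q‖ / ‖u‖ ≤ inner ℝ q u / (‖q‖ * ‖u‖) := by
    rw [div_le_div_iff₀ hu0 (by positivity)]; nlinarith
  have hb1 : inner ℝ q u / (‖q‖ * ‖u‖) ≤ 1 := (div_le_one (by positivity)).2 hcs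
  have ha0 : 0 ≤ ‖q‖ / ‖u‖ := by positivity
  have hηξ : η ≤ ξ := Real.arccos_le_arccos hab
  have hcosξ : Real.cos ξ = ‖q‖ / ‖u‖ := Real.cos_arccos (by linarith) (by linarith)
  have hcosη : Real.cos η = inner ℝ q u / (‖q‖ * ‖u‖) :=
    Real.cos_arccos (by linarith) hb1
  have hsinξ : Real.sin ξ = d / ‖u‖ := by
    rw [hξ, Real.sin_arccos, div_pow, Real.sqrt_eq_iff_mul_self_eq _ (by positivity)]
    · field_simp; linarith
    · rw [sub_nonneg, ← div_pow]
      exact pow_le_one₀ ha0 (by linarith)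
  have hpξ : circlePoint ‖u‖ m n ξ = u := by
    rw [circlePoint, hcosξ, hsinξ, hm, hn, smul_smul, smul_smul, smul_add, smul_smul, smul_smul]
    have e1 : ‖u‖ * (‖q‖ / ‖u‖ * ‖q‖⁻¹) = 1 := by field_simp
    have e2 : ‖u‖ * (d / ‖u‖ * d⁻¹) = 1 := by field_simp
    rw [e1, e2]; simp
  have hq'm : q' = ‖q‖ • m := by rw [hm, smul_smul, mul_inv_cancel₀ hqn.ne', one_smul]
  have hinner : ∀ t, inner ℝ q' (circlePoint ‖u‖ m n t) = ‖q‖ * ‖u‖ * Real.cos t := fun t => by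
    have h1 : inner ℝ m (Real.cos t • m + Real.sin t • n) = Real.cos t := by
      rw [inner_add_right, inner_smul_right _ _ (Real.cos t), inner_smul_right _ n, hmn,
        real_inner_self_eq_norm_sq, hm1]
      ring
    rw [hq'm, circlePoint, inner_smul_left, inner_smul_right, h1]
    simp; ring
  have hpn : ∀ t, ‖circlePoint ‖u‖ m n t‖ = ‖u‖ := norm_circlePoint hm1 hn1 hmn hu0.le
  have hJ : pairAverage F X u q = pairAverage F X (circlePoint ‖u‖ m n η) q' := by
    refine integral_iso_pair_eq (hpn η).symm hqq.symm ?_ (fun x y => F x * X y)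
    rw [real_inner_comm, real_inner_comm q' (circlePoint _ _ _ _), hinner, hcosη]
    field_simp
  -- The angle never exceeds `ξ`, so `q'` stays in the ball whose diameter is the rotated vector,
  -- and `W` keeps bounding `X`.
  have hcw : ∀ t ∈ Icc η ξ, ‖q'‖ ^ 2 ≤ inner ℝ q' (circlePoint ‖u‖ m n t) := fun t ht => by
    have h1 : Real.cos ξ ≤ Real.cos t := Real.cos_le_cos_of_nonneg_of_le_pi
      ((Real.arccos_nonneg _).trans ht.1) (Real.arccos_le_pi _) ht.2
    rw [hinner, hqq, sq, mul_assoc]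
    rw [hcosξ, div_le_iff₀ hu0] at h1
    nlinarith
  have hcA : Continuous fun z : Iso × ℝ => (z.1 : V →L[ℝ] V) (circlePoint ‖u‖ m n z.2) :=
    continuous_iso_apply.comp (f := fun z : Iso × ℝ => (z.1, circlePoint ‖u‖ m n z.2))
      (continuous_fst.prodMk ((continuous_circlePoint _ _ _).comp continuous_snd))
  set Gf : Iso → ℝ → ℝ := fun A t => ‖u‖ * (N ((A : V →L[ℝ] V) (circlePoint ‖u‖ m n t)) *
    W ((A : V →L[ℝ] V) (circlePoint ‖u‖ m n t))) with hGf
  have hGc : Continuous (Function.uncurry Gf) :=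
    continuous_const.mul ((hN.comp hcA).mul (hW.comp hcA))
  have hGi : Integrable (Function.uncurry Gf) (isoMeasure.prod (volume.restrict (Ioc η ξ))) := by
    have h1 : IntegrableOn (Function.uncurry Gf) (univ ×ˢ Icc η ξ) (isoMeasure.prod volume) :=
      hGc.continuousOn.integrableOn_compact (isCompact_univ.prod isCompact_Icc)
    have h2 := h1.mono_set (Set.prod_mono subset_rfl Ioc_subset_Icc_self)
    rwa [IntegrableOn, ← Measure.prod_restrict, Measure.restrict_univ] at h2
  have hpt : ∀ A : Iso, |F ((A : V →L[ℝ] V) (circlePoint ‖u‖ m n η)) * X ((A : V →L[ℝ] V) q') -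
      F ((A : V →L[ℝ] V) u) * X ((A : V →L[ℝ] V) q')| ≤ ∫ t in Ioc η ξ, Gf A t := fun A => by
    have h1 := abs_sub_circlePoint_le hF hN hFN hm1 hn1 hmn hu0.le A hηξ
    rw [hpξ, intervalIntegral.integral_of_le hηξ] at h1
    have hcA' : Continuous fun t => (A : V →L[ℝ] V) (circlePoint ‖u‖ m n t) :=
      (A : V →L[ℝ] V).continuous.comp (continuous_circlePoint _ _ _)
    rw [← sub_mul, abs_mul, abs_sub_comm]
    calc _ ≤ (∫ t in Ioc η ξ, ‖u‖ * N ((A : V →L[ℝ] V) (circlePoint ‖u‖ m n t))) *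
          |X ((A : V →L[ℝ] V) q')| := by gcongr
      _ = ∫ t in Ioc η ξ, ‖u‖ * N ((A : V →L[ℝ] V) (circlePoint ‖u‖ m n t)) *
          |X ((A : V →L[ℝ] V) q')| := by rw [integral_mul_const]
      _ ≤ _ := by
        refine setIntegral_mono_on ?_ ?_ measurableSet_Ioc fun t ht => ?_
        · exact (((continuous_const.mul (hN.comp hcA')).mul
            continuous_const).integrableOn_Icc).mono_set Ioc_subset_Icc_self
        · exact ((continuous_const.mul ((hN.comp hcA').mul
            (hW.comp hcA'))).integrableOn_Icc).mono_set Ioc_subset_Icc_self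
        · simp only [hGf, mul_assoc]
          refine mul_le_mul_of_nonneg_left (mul_le_mul_of_nonneg_left (hXW _ _ ?_) (hN0 _)) hu0.le
          rw [norm_iso_apply, inner_iso_apply]
          exact hcw t ⟨ht.1.le, ht.2⟩
  rw [hJ]
  unfold pairAverage
  have hcq := continuous_iso_apply_left q'
  have hFc := hF.continuous
  have hi : ∀ p : V, Integrable (fun A : Iso => F ((A : V →L[ℝ] V) p) * X ((A : V →L[ℝ] V) q'))
      isoMeasure := fun p =>
    Continuous.integrable_iso ((hFc.comp (continuous_iso_apply_left p)).mul (hX.comp hcq))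
  rw [← integral_sub (hi _) (hi _), ← Real.norm_eq_abs]
  refine (norm_integral_le_of_norm_le hGi.integral_prod_left (ae_of_all _ hpt)).trans ?_
  have hswap := integral_integral_swap (f := Gf) hGi
  simp only [Function.uncurry_apply_pair]
  rw [hswap]
  -- The rotated vector keeps the length of `u`, so the averaged gradient does not depend on `t` and
  -- the integral over the angle is a plain product.
  have hconst : ∀ t, ∫ A, Gf A t ∂isoMeasure = ‖u‖ * sphereAverage (fun x => N x * W x) u := fun t => by
    simp only [hGf]
    rw [integral_const_mul]
    congr 1
    exact integral_iso_norm_eq (hpn t) fun x => N x * W x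
  simp only [hconst]
  rw [setIntegral_const]
  simp [hηξ]

/-! ### The angular integral at a fixed relative velocity -/

theorem exists_unit_orthogonal (u : V) : ∃ n : V, ‖n‖ = 1 ∧ inner ℝ u n = 0 := by
  set k : V := EuclideanSpace.single 0 ‖u‖ with hk
  obtain ⟨A, hA, -⟩ := exists_iso_apply_eq (p := k) (q := 0) (p' := u) (q' := 0)
    (by simp [hk]) rfl (by simp)
  refine ⟨(A : V →L[ℝ] V) (EuclideanSpace.single 1 1), by rw [norm_iso_apply]; simp, ?_⟩
  rw [← hA, inner_iso_apply, hk, EuclideanSpace.inner_single_left]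
  simp

/-- The point `q` of the plane of `u` and `n` with `|q|² = q·u = |u|² y / 2`. -/
def elasticPoint (u n : V) (y : ℝ) : V :=
  (y / 2) • u + (‖u‖ * √(y / 2 * (1 - y / 2))) • n

theorem continuous_elasticPoint (u n : V) : Continuous (elasticPoint u n) := by
  unfold elasticPoint; fun_prop

theorem inner_elasticPoint {u n : V} (hun : inner ℝ u n = 0) (y : ℝ) :
    inner ℝ (elasticPoint u n y) u = ‖u‖ ^ 2 * y / 2 := by
  rw [elasticPoint, inner_add_left, inner_smul_left, inner_smul_left, real_inner_comm u n, hun,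
    real_inner_self_eq_norm_sq]
  simp; ring

theorem norm_elasticPoint_sq {u n : V} (hn : ‖n‖ = 1) (hun : inner ℝ u n = 0) {y : ℝ}
    (hy : y ∈ Icc 0 2) : ‖elasticPoint u n y‖ ^ 2 = ‖u‖ ^ 2 * y / 2 := by
  have h0 : 0 ≤ y / 2 * (1 - y / 2) := mul_nonneg (by linarith [hy.1]) (by linarith [hy.2])
  rw [elasticPoint, norm_add_sq_real, inner_smul_left, inner_smul_right, hun, norm_smul, norm_smul,
    hn, mul_pow, mul_pow, Real.norm_eq_abs, Real.norm_eq_abs, sq_abs, sq_abs, mul_pow,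
    Real.sq_sqrt h0]
  simp; ring

theorem one_sub_inner_mem {m : V} (hm : ‖m‖ = 1) (σ : S2) :
    1 - inner ℝ m (σ : V) ∈ Icc (0 : ℝ) 2 := by
  have := abs_real_inner_le_norm m (σ : V)
  rw [hm, norm_sphere, one_mul, abs_le] at this
  constructor <;> linarith

theorem ae_one_sub_inner_ne {m : V} (hm : ‖m‖ = 1) :
    ∀ᵐ σ : S2 ∂surface, 1 - inner ℝ m (σ : V) ≠ 2 := by
  have hmi : Measurable fun σ : S2 => inner ℝ m (σ : V) := Continuous.measurable (by fun_prop)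
  have h : surface ((fun σ : S2 => inner ℝ m (σ : V)) ⁻¹' {-1}) = 0 := by
    rw [← Measure.map_apply hmi (measurableSet_singleton _), map_inner_surface hm]
    simp
  filter_upwards [measure_eq_zero_iff_ae_notMem.1 h] with σ hσ h2
  exact hσ (by simp only [mem_preimage, mem_singleton_iff]; linarith)

/-- The main estimate at a fixed relative velocity `u`: the family `q` of transferred velocities is
compared to the elastic family `q₁`. -/
theorem abs_integral_pairAverage_sub_le {F N X W : V → ℝ} (hF : ContDiff ℝ 1 F)
    (hN : Continuous N) (hFN : ∀ x, ‖fderiv ℝ F x‖ ≤ N x) (hX : Continuous X) (hW : Continuous W)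
    (hXW : ∀ p q : V, ‖q‖ ^ 2 ≤ inner ℝ q p → |X q| ≤ W p) {u : V} (hu : u ≠ 0)
    {q q₁ : S2 → V} (hqc : Continuous q)
    {φ κ : ℝ → ℝ} (hφ : Continuous φ) (hφm : MonotoneOn φ (Ici 0))
    (hφd : MonotoneOn (fun y => y - φ y) (Ici 0)) (hφ0 : φ 0 = 0)
    (hκ : Continuous κ) (hκm : ∀ y ∈ Icc (0 : ℝ) 2, κ y ∈ Icc (0 : ℝ) 2)
    {δ : ℝ} (hq : ∀ σ, ‖q σ‖ ^ 2 ≤ inner ℝ (q σ) u)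
    (hqφ : ∀ σ, ‖q σ‖ ^ 2 = ‖u‖ ^ 2 * κ (φ (1 - inner ℝ (‖u‖⁻¹ • u) (σ : V))) / 2)
    (hq₁ : ∀ σ, ‖q₁ σ‖ ^ 2 = ‖u‖ ^ 2 * κ (1 - inner ℝ (‖u‖⁻¹ • u) (σ : V)) / 2)
    (hq₁u : ∀ σ, inner ℝ (q₁ σ) u = ‖q₁ σ‖ ^ 2)
    (hθ : ∀ σ : S2, 1 - inner ℝ (‖u‖⁻¹ • u) (σ : V) < 2 →
      Real.arccos (‖q σ‖ / ‖u‖) - Real.arccos (inner ℝ (q σ) u / (‖q σ‖ * ‖u‖)) ≤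
        δ / 2 * (1 - (1 - inner ℝ (‖u‖⁻¹ • u) (σ : V)) / 2) ^ (-(1 / 2) : ℝ))
    (hφ2 : 2 - φ 2 ≤ 2 * δ) :
    |∫ σ, (pairAverage F X u (q σ) - pairAverage F X u (q₁ σ)) ∂surface| ≤
      8 * Real.pi * δ * (‖u‖ * sphereAverage (fun x => N x * W x) u +
        sphereAverage (fun x => |F x| * W x) u) := by
  obtain ⟨n, hn, hun⟩ := exists_unit_orthogonal u
  have hu0 : 0 < ‖u‖ := norm_pos_iff.2 hu
  set m : V := ‖u‖⁻¹ • u with hm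
  have hm1 : ‖m‖ = 1 := by rw [hm, norm_smul, norm_inv, norm_norm, inv_mul_cancel₀ hu0.ne']
  have hmem : ∀ σ : S2, 1 - inner ℝ m (σ : V) ∈ Icc (0 : ℝ) 2 := one_sub_inner_mem hm1
  have hφmem : ∀ y ∈ Icc (0 : ℝ) 2, φ y ∈ Icc (0 : ℝ) 2 := fun y hy => by
    have h1 := hφm (mem_Ici.2 le_rfl) (mem_Ici.2 hy.1) hy.1
    have h2 := hφd (mem_Ici.2 le_rfl) (mem_Ici.2 hy.1) hy.1
    simp only [hφ0] at h1 h2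
    exact ⟨h1, by linarith [hy.2]⟩
  set NW := sphereAverage (fun x => N x * W x) u with hNW
  set FW := sphereAverage (fun x => |F x| * W x) u with hFW
  have hN0 : ∀ x, 0 ≤ N x := fun x => (norm_nonneg _).trans (hFN x)
  have hW0 : ∀ x, 0 ≤ W x := fun x => (abs_nonneg _).trans (hXW x 0 (by simp))
  have hNW0 : 0 ≤ NW := integral_nonneg fun A => mul_nonneg (hN0 _) (hW0 _)
  set J := pairAverage F X u with hJ
  have hJc : Continuous J := continuous_pairAverage hF.continuous hX u
  set Js : ℝ → ℝ := fun y => J (elasticPoint u n y) with hJs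
  have hJsc : Continuous Js := hJc.comp (continuous_elasticPoint u n)
  -- On the Thales sphere the length determines the angle, hence the Gram matrix, hence the average.
  have hJeq : ∀ (p : V) (y : ℝ), y ∈ Icc (0 : ℝ) 2 → ‖p‖ ^ 2 = ‖u‖ ^ 2 * y / 2 →
      inner ℝ p u = ‖p‖ ^ 2 → J p = Js y := fun p y hy h1 h2 => by
    refine integral_iso_pair_eq rfl ?_ ?_ (fun a b => F a * X b)
    · rw [← sq_eq_sq₀ (norm_nonneg _) (norm_nonneg _), h1, norm_elasticPoint_sq hn hun hy]
    · rw [real_inner_comm, h2, h1, real_inner_comm, inner_elasticPoint hun]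
  have hyc : Continuous fun σ : S2 => 1 - inner ℝ m (σ : V) := by fun_prop
  have hI : ∀ {H : S2 → ℝ}, Continuous H → Integrable H surface := fun hH =>
    hH.integrable_of_hasCompactSupport (HasCompactSupport.of_compactSpace _)
  -- The intermediate point is the one on the Thales sphere with the length of `q σ`. The first
  -- difference is a rotation, the second a change of variable in `y`.
  have hsplit : ∫ σ, (J (q σ) - J (q₁ σ)) ∂surface =
      (∫ σ : S2, (J (q σ) - Js (κ (φ (1 - inner ℝ m (σ : V))))) ∂surface) +
      (∫ σ : S2, Js (κ (φ (1 - inner ℝ m (σ : V)))) ∂surface -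
        ∫ σ : S2, Js (κ (1 - inner ℝ m (σ : V))) ∂surface) := by
    have c1 : Continuous fun σ => J (q σ) := hJc.comp hqc
    have c2 : Continuous fun σ : S2 => Js (κ (φ (1 - inner ℝ m (σ : V)))) :=
      hJsc.comp (hκ.comp (hφ.comp hyc))
    have c3 : Continuous fun σ : S2 => Js (κ (1 - inner ℝ m (σ : V))) := hJsc.comp (hκ.comp hyc)
    have e : (fun σ => J (q σ) - J (q₁ σ)) =
        fun σ : S2 => J (q σ) - Js (κ (1 - inner ℝ m (σ : V))) := by
      ext σ
      rw [hJeq (q₁ σ) _ (hκm _ (hmem σ)) (hq₁ σ) (hq₁u σ)]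
    rw [e, integral_sub (hI c1) (hI c3), integral_sub (hI c1) (hI c2)]
    ring
  have hrot : |∫ σ : S2, (J (q σ) - Js (κ (φ (1 - inner ℝ m (σ : V))))) ∂surface| ≤
      8 * Real.pi * δ * (‖u‖ * NW) / 2 := by
    have hmeas : Measurable fun y : ℝ => (1 - y / 2) ^ (-(1 / 2) : ℝ) := by fun_prop
    have hi := integrable_surface_one_sub_inner hm1 hmeas intervalIntegrable_rpow_one_sub
    have hint := integral_surface_one_sub_inner hm1 hmeas
    rw [integral_rpow_one_sub] at hint
    rw [← Real.norm_eq_abs]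
    refine (norm_integral_le_of_norm_le (hi.const_mul (δ / 2 * (‖u‖ * NW))) ?_).trans ?_
    · filter_upwards [ae_one_sub_inner_ne hm1] with σ hσ
      have hy := hmem σ
      have hlt : 1 - inner ℝ m (σ : V) < 2 := lt_of_le_of_ne hy.2 hσ
      have hκy := hκm _ (hφmem _ hy)
      have h1 := abs_pairAverage_sub_le hF hN hFN hX hW hXW hu (hq σ)
        (q' := elasticPoint u n (κ (φ (1 - inner ℝ m (σ : V)))))
        (by rw [← sq_eq_sq₀ (norm_nonneg _) (norm_nonneg _), norm_elasticPoint_sq hn hun hκy, hqφ σ])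
        (by rw [inner_elasticPoint hun, norm_elasticPoint_sq hn hun hκy])
      rw [Real.norm_eq_abs]
      refine h1.trans ?_
      rw [mul_right_comm (δ / 2)]
      exact mul_le_mul_of_nonneg_right (hθ σ hlt) (mul_nonneg hu0.le hNW0)
    · rw [integral_const_mul, hint]
      exact le_of_eq (by ring)
  have hmov : |∫ σ : S2, Js (κ (φ (1 - inner ℝ m (σ : V)))) ∂surface -
        ∫ σ : S2, Js (κ (1 - inner ℝ m (σ : V))) ∂surface| ≤ 8 * Real.pi * δ * FW := by
    have hFW0 : 0 ≤ FW := integral_nonneg fun A => mul_nonneg (abs_nonneg _) (hW0 _)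
    have i1 := integral_surface_one_sub_inner hm1
      (h := fun y => Js (κ (φ y))) (hJsc.comp (hκ.comp hφ)).measurable
    have i2 := integral_surface_one_sub_inner hm1
      (h := fun y => Js (κ y)) (hJsc.comp hκ).measurable
    rw [i1, i2, ← mul_sub, abs_mul, abs_of_pos (by positivity : 0 < 2 * Real.pi)]
    have h1 := abs_integral_comp_sub_le (L := 2) (M := FW) (by norm_num) hφm hφd hφ0
      (hJsc.comp hκ) fun y hy => abs_pairAverage_le hF.continuous hW hXW (by
        rw [inner_elasticPoint hun, norm_elasticPoint_sq hn hun (hκm y hy)])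
    calc _ ≤ 2 * Real.pi * (2 * FW * (2 - φ 2)) := by gcongr; exact h1
      _ ≤ 2 * Real.pi * (2 * FW * (2 * δ)) := by gcongr
      _ = _ := by ring
  have hδ : 0 ≤ δ := by linarith [(hφmem 2 ⟨by norm_num, le_rfl⟩).2]
  rw [hsplit]
  refine (abs_add_le _ _).trans ((add_le_add hrot hmov).trans ?_)
  have : 0 ≤ 8 * Real.pi * δ * (‖u‖ * NW) := by positivity
  linarith

/-! ### The two families of transferred velocities -/

/-- With `|q| = b s` and `q·u = b s²` the two cosines are `b s / ρ` and `s / ρ`, which differ by a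
factor `b`. -/
theorem arccos_sub_arccos_shift_le {ρ s b : ℝ} (hs : 0 ≤ s) (hsρ : s < ρ)
    (hb : 1 / 2 ≤ b) (hb1 : b ≤ 1) :
    Real.arccos (b * s / ρ) - Real.arccos (b * s ^ 2 / (b * s * ρ)) ≤
      (1 - b) / √(1 - (s / ρ) ^ 2) := by
  have hρ : 0 < ρ := hs.trans_lt hsρ
  have h1 : b * s ^ 2 / (b * s * ρ) = s / ρ := by
    rcases hs.eq_or_lt with rfl | hs
    · simp
    · field_simp
  have hsr : s / ρ < 1 := (div_lt_one hρ).2 hsρ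
  have hsr0 : 0 ≤ s / ρ := by positivity
  rw [h1, mul_div_assoc]
  refine (arccos_sub_arccos_le (by positivity) (mul_le_of_le_one_left hsr0 hb1) hsr).trans ?_
  exact div_le_div_of_nonneg_right (by nlinarith) (Real.sqrt_nonneg _)

/-- Here `z` is the length of `u - q`. The cosines differ by `s² b (1 - b) / (z ρ)`, and the sine of
the smaller angle is `b s √(1 - (s / ρ)²) / z`; in the quotient `z` cancels and a factor `s / ρ ≤ 1`
is left over. -/
theorem arccos_sub_arccos_sub_shift_le {ρ s b z : ℝ} (hs : 0 ≤ s) (hsρ : s < ρ)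
    (hb : 1 / 2 ≤ b) (hb1 : b ≤ 1) (hz : 0 ≤ z) (hz2 : z ^ 2 = ρ ^ 2 - s ^ 2 * (b * (2 - b))) :
    Real.arccos (z / ρ) - Real.arccos ((ρ ^ 2 - b * s ^ 2) / (z * ρ)) ≤
      (1 - b) / √(1 - (s / ρ) ^ 2) := by
  have hρ : 0 < ρ := hs.trans_lt hsρ
  have hr : 0 ≤ (1 - b) / √(1 - (s / ρ) ^ 2) := div_nonneg (by linarith) (Real.sqrt_nonneg _)
  rcases hs.eq_or_lt with rfl | hs
  · have : z = ρ := by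
      rw [← sq_eq_sq₀ hz hρ.le, hz2]; ring
    subst this
    have e : (z ^ 2 - b * 0 ^ 2) / (z * z) = z / z := by field_simp; ring
    rw [e, sub_self]; exact hr
  have hss : s ^ 2 < ρ ^ 2 := by nlinarith
  have hbb : b * (2 - b) ≤ 1 := by nlinarith [sq_nonneg (1 - b)]
  have hb0 : 0 < b * (2 - b) := mul_pos (by linarith) (by linarith)
  have hz0 : 0 < z := by
    have : 0 < z ^ 2 := by rw [hz2]; nlinarith
    exact lt_of_le_of_ne hz fun h => by simp [← h] at this
  have hid : (z * ρ) ^ 2 - (ρ ^ 2 - b * s ^ 2) ^ 2 = (b * s) ^ 2 * (ρ ^ 2 - s ^ 2) := by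
    rw [mul_pow, hz2]; ring
  have hpos : 0 < (b * s) ^ 2 * (ρ ^ 2 - s ^ 2) :=
    mul_pos (by positivity) (by linarith)
  have hnum : 0 < ρ ^ 2 - b * s ^ 2 := by nlinarith
  have hlt : (ρ ^ 2 - b * s ^ 2) / (z * ρ) < 1 := by
    rw [div_lt_one (by positivity)]
    nlinarith [mul_pos hz0 hρ]
  have hle : z / ρ ≤ (ρ ^ 2 - b * s ^ 2) / (z * ρ) := by
    rw [div_le_div_iff₀ hρ (by positivity)]
    have : z ^ 2 ≤ ρ ^ 2 - b * s ^ 2 := by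
      rw [hz2]; nlinarith [mul_nonneg (sq_nonneg s) (mul_nonneg (by linarith : 0 ≤ b) (by linarith : 0 ≤ 1 - b))]
    nlinarith
  refine (arccos_sub_arccos_le (by positivity) hle hlt).trans ?_
  have hroot : √(1 - ((ρ ^ 2 - b * s ^ 2) / (z * ρ)) ^ 2) =
      b * s * √(1 - (s / ρ) ^ 2) / z := by
    have h0 : 0 ≤ 1 - (s / ρ) ^ 2 := by
      rw [div_pow, sub_nonneg, div_le_one (by positivity)]; exact hss.le
    rw [Real.sqrt_eq_iff_mul_self_eq_of_pos]
    · have h1 : b * s * √(1 - (s / ρ) ^ 2) / z * (b * s * √(1 - (s / ρ) ^ 2) / z) =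
          (b * s) ^ 2 * (√(1 - (s / ρ) ^ 2)) ^ 2 / z ^ 2 := by ring
      rw [h1, Real.sq_sqrt h0]
      field_simp
      linarith [hid]
    · have : 0 < 1 - (s / ρ) ^ 2 := by
        rw [div_pow, sub_pos, div_lt_one (by positivity)]; exact hss
      have := Real.sqrt_pos.2 this
      have : 0 < b := by linarith
      positivity
  rw [hroot]
  have hS : 0 < √(1 - (s / ρ) ^ 2) := by
    refine Real.sqrt_pos.2 ?_
    rw [div_pow, sub_pos, div_lt_one (by positivity)]; exact hss
  have hdiff : (ρ ^ 2 - b * s ^ 2) / (z * ρ) - z / ρ = s ^ 2 * b * (1 - b) / (z * ρ) := by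
    field_simp; rw [hz2]; ring
  rw [hdiff]
  have hb' : 0 < b := by linarith
  have e : s ^ 2 * b * (1 - b) / (z * ρ) / (b * s * √(1 - (s / ρ) ^ 2) / z) =
      s / ρ * ((1 - b) / √(1 - (s / ρ) ^ 2)) := by field_simp
  rw [e]
  exact mul_le_of_le_one_left hr ((div_le_one hρ).2 hsρ.le)

theorem impactVelocity_sq {u : V} (hu : u ≠ 0) (σ : S2) :
    impactVelocity u σ ^ 2 = ‖u‖ ^ 2 * ((1 - inner ℝ (‖u‖⁻¹ • u) (σ : V)) / 2) := by
  have hu0 : 0 < ‖u‖ := norm_pos_iff.2 hu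
  rw [impactVelocity_eq, div_pow, norm_sub_smul_sq, inner_smul_left]
  simp; field_simp

theorem impactVelocity_eq_sqrt {u : V} (σ : S2) :
    impactVelocity u σ = ‖u‖ * √((1 - inner ℝ (‖u‖⁻¹ • u) (σ : V)) / 2) := rfl

theorem norm_shift {e : ℝ → ℝ} (he : IsCoeff e) (u : V) (σ : S2) :
    ‖shift e u σ‖ = (1 + e (impactVelocity u σ)) / 2 * impactVelocity u σ := by
  have h1 := he.nonneg _ (impactVelocity_nonneg u σ)
  rw [shift, norm_smul, Real.norm_of_nonneg (by positivity), impactVelocity_eq]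
  ring

theorem inner_shift (e : ℝ → ℝ) (u : V) (σ : S2) :
    inner ℝ (shift e u σ) u = (1 + e (impactVelocity u σ)) / 2 * impactVelocity u σ ^ 2 := by
  have h3 : inner ℝ (u - ‖u‖ • (σ : V)) u = ‖u - ‖u‖ • (σ : V)‖ ^ 2 / 2 := by
    rw [norm_sub_smul_sq, inner_sub_left, inner_smul_left, real_inner_self_eq_norm_sq,
      real_inner_comm]
    simp; ring
  rw [shift, inner_smul_left, h3, impactVelocity_eq]
  simp; ring

theorem norm_sub_shift_sq {e : ℝ → ℝ} (he : IsCoeff e) (u : V) (σ : S2) :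
    ‖u - shift e u σ‖ ^ 2 = ‖u‖ ^ 2 - impactVelocity u σ ^ 2 *
      ((1 + e (impactVelocity u σ)) / 2 * (2 - (1 + e (impactVelocity u σ)) / 2)) := by
  rw [norm_sub_sq_real, real_inner_comm, inner_shift, norm_shift he]; ring

theorem inner_sub_shift (e : ℝ → ℝ) (u : V) (σ : S2) :
    inner ℝ (u - shift e u σ) u =
      ‖u‖ ^ 2 - (1 + e (impactVelocity u σ)) / 2 * impactVelocity u σ ^ 2 := by
  rw [inner_sub_left, inner_shift, real_inner_self_eq_norm_sq]

/-- The inelasticity factor `β` as a function of `y = 1 - û·σ`, at relative speed `ρ`. -/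
def factor (e : ℝ → ℝ) (ρ y : ℝ) : ℝ := (1 + e (ρ * √(y / 2))) / 2

theorem continuous_factor {e : ℝ → ℝ} (he : IsCoeff e) {ρ : ℝ} (hρ : 0 < ρ) :
    Continuous (factor e ρ) := by
  have : Continuous fun y => e (ρ * √(y / 2)) :=
    he.continuousOn.comp_continuous (by fun_prop) fun y => mem_Ici.2 (by positivity)
  unfold factor; exact (continuous_const.add this).div_const 2

theorem half_le_factor {e : ℝ → ℝ} (he : IsCoeff e) {ρ : ℝ} (hρ : 0 < ρ)
    (y : ℝ) : 1 / 2 ≤ factor e ρ y := by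
  have := he.nonneg (ρ * √(y / 2)) (by positivity)
  unfold factor; linarith

theorem factor_le_one {e : ℝ → ℝ} (he : IsCoeff e) {ρ : ℝ} (hρ : 0 < ρ)
    (y : ℝ) : factor e ρ y ≤ 1 := by
  have := he.le_one (ρ * √(y / 2)) (by positivity)
  unfold factor; linarith

theorem factor_antitone {e : ℝ → ℝ} (he : IsCoeff e) {ρ : ℝ} (hρ : 0 < ρ)
    {x y : ℝ} (hxy : x ≤ y) : factor e ρ y ≤ factor e ρ x := by
  have h : ρ * √(x / 2) ≤ ρ * √(y / 2) := by gcongr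
  have := he.antitone (mem_Ici.2 (by positivity)) (mem_Ici.2 (by positivity)) h
  unfold factor; linarith

/-- This is where the monotonicity of `r e(r)` enters. -/
theorem sqrt_mul_factor_mono {e : ℝ → ℝ} (he : IsCoeff e) {ρ : ℝ} (hρ : 0 < ρ)
    {x y : ℝ} (hxy : x ≤ y) :
    √(x / 2) * factor e ρ x ≤ √(y / 2) * factor e ρ y := by
  have h : ρ * √(x / 2) ≤ ρ * √(y / 2) := by gcongr
  have h2 := he.monotone (mem_Ici.2 (by positivity)) (mem_Ici.2 (by positivity)) h
  simp only [mul_assoc] at h2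
  have h3 := le_of_mul_le_mul_left h2 hρ
  have h4 : √(x / 2) ≤ √(y / 2) := by gcongr
  unfold factor
  linarith

/-- Up to a constant, `y β²` is the squared length of the transferred velocity. It is the square of
the increasing quantity `√(y / 2) β`, up to a factor. -/
theorem monotoneOn_mul_factor_sq {e : ℝ → ℝ} (he : IsCoeff e) {ρ : ℝ} (hρ : 0 < ρ) :
    MonotoneOn (fun y => y * factor e ρ y ^ 2) (Ici 0) := by
  have h : ∀ y ∈ Ici (0 : ℝ), y * factor e ρ y ^ 2 = 2 * (√(y / 2) * factor e ρ y) ^ 2 :=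
    fun y hy => by
      rw [mul_pow, Real.sq_sqrt (by have := mem_Ici.1 hy; positivity)]; ring
  intro x hx y hy hxy
  simp only [h x hx, h y hy]
  have := half_le_factor he hρ x
  have := sqrt_mul_factor_mono he hρ hxy
  gcongr

theorem monotoneOn_sub_mul_factor_sq {e : ℝ → ℝ} (he : IsCoeff e) {ρ : ℝ} (hρ : 0 < ρ) :
    MonotoneOn (fun y => y - y * factor e ρ y ^ 2) (Ici 0) := by
  intro x hx y hy hxy
  have h1 := factor_antitone he hρ hxy
  have h2 := half_le_factor he hρ y
  have h3 := factor_le_one he hρ x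
  have h4 : factor e ρ y ^ 2 ≤ factor e ρ x ^ 2 := by gcongr
  have h5 : factor e ρ x ^ 2 ≤ 1 := pow_le_one₀ (by linarith) h3
  have h6 : x * (1 - factor e ρ x ^ 2) ≤ y * (1 - factor e ρ y ^ 2) :=
    mul_le_mul hxy (by linarith) (by linarith) hy
  simp only; linarith

/-- Both `√(y / 2) β` and `√(y / 2) (2 - β)` increase, the second because `e` decreases. -/
theorem monotoneOn_mul_factor_mul {e : ℝ → ℝ} (he : IsCoeff e) {ρ : ℝ} (hρ : 0 < ρ) :
    MonotoneOn (fun y => y * (factor e ρ y * (2 - factor e ρ y))) (Ici 0) := by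
  have h : ∀ y ∈ Ici (0 : ℝ), y * (factor e ρ y * (2 - factor e ρ y)) =
      2 * ((√(y / 2) * factor e ρ y) * (√(y / 2) * (2 - factor e ρ y))) := fun y hy => by
    have : √(y / 2) * √(y / 2) = y / 2 :=
      Real.mul_self_sqrt (by have := mem_Ici.1 hy; positivity)
    linear_combination (-2 * factor e ρ y * (2 - factor e ρ y)) * this
  intro x hx y hy hxy
  simp only [h x hx, h y hy]
  have h1 := half_le_factor he hρ x
  have h2 := factor_le_one he hρ x
  have h3 := sqrt_mul_factor_mono he hρ hxy
  have h4 := factor_antitone he hρ hxy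
  have h5 : √(x / 2) ≤ √(y / 2) := by gcongr
  have h6 : √(x / 2) * (2 - factor e ρ x) ≤ √(y / 2) * (2 - factor e ρ y) :=
    mul_le_mul h5 (by linarith) (by linarith) (Real.sqrt_nonneg _)
  have h7 : 0 ≤ √(x / 2) * (2 - factor e ρ x) := mul_nonneg (Real.sqrt_nonneg _) (by linarith)
  have h8 : 0 ≤ √(y / 2) * factor e ρ y :=
    mul_nonneg (Real.sqrt_nonneg _) (by linarith [half_le_factor he hρ y])
  have := mul_le_mul h3 h6 h7 h8
  linarith

/-- The function is `y (1 - β)²`. -/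
theorem monotoneOn_sub_mul_factor_mul {e : ℝ → ℝ} (he : IsCoeff e) {ρ : ℝ} (hρ : 0 < ρ) :
    MonotoneOn (fun y => y - y * (factor e ρ y * (2 - factor e ρ y))) (Ici 0) := by
  intro x hx y hy hxy
  have h1 := factor_antitone he hρ hxy
  have h3 := factor_le_one he hρ x
  have h4 : (1 - factor e ρ x) ^ 2 ≤ (1 - factor e ρ y) ^ 2 :=
    pow_le_pow_left₀ (by linarith) (by linarith) 2
  have h6 : x * (1 - factor e ρ x) ^ 2 ≤ y * (1 - factor e ρ y) ^ 2 :=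
    mul_le_mul hxy h4 (sq_nonneg _) hy
  simp only; linarith

theorem one_sub_factor_two (e : ℝ → ℝ) (ρ : ℝ) : 1 - factor e ρ 2 = (1 - e ρ) / 2 := by
  unfold factor; norm_num; ring

theorem inv_sqrt_eq_rpow {x : ℝ} (hx : 0 ≤ x) (c : ℝ) : c / √x = c * x ^ (-(1 / 2) : ℝ) := by
  rw [Real.rpow_neg hx, ← Real.sqrt_eq_rpow, div_eq_mul_inv]

theorem impactVelocity_lt {u : V} (hu : u ≠ 0) {σ : S2}
    (h : 1 - inner ℝ (‖u‖⁻¹ • u) (σ : V) < 2) : impactVelocity u σ < ‖u‖ := by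
  have hu0 : 0 < ‖u‖ := norm_pos_iff.2 hu
  rw [← sq_lt_sq₀ (impactVelocity_nonneg _ _) hu0.le, impactVelocity_sq hu]
  nlinarith [pow_pos hu0 2]

/-- The impact velocity is at most `|u|` and `e` decreases, so the defect at impact is dominated by
the one at `|u|`, which is independent of `σ`. -/
theorem angle_bound_le {e : ℝ → ℝ} (he : IsCoeff e) {u : V} (hu : u ≠ 0) {σ : S2}
    (h : 1 - inner ℝ (‖u‖⁻¹ • u) (σ : V) < 2) :
    (1 - (1 + e (impactVelocity u σ)) / 2) / √(1 - (impactVelocity u σ / ‖u‖) ^ 2) ≤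
      (1 - e ‖u‖) / 2 * (1 - (1 - inner ℝ (‖u‖⁻¹ • u) (σ : V)) / 2) ^ (-(1 / 2) : ℝ) := by
  have hu0 : 0 < ‖u‖ := norm_pos_iff.2 hu
  have h1 : (impactVelocity u σ / ‖u‖) ^ 2 = (1 - inner ℝ (‖u‖⁻¹ • u) (σ : V)) / 2 := by
    rw [div_pow, impactVelocity_sq hu]; field_simp
  have h2 := he.antitone (impactVelocity_nonneg u σ) (norm_nonneg u) (impactVelocity_le u σ)
  have h3 : 0 ≤ 1 - (1 - inner ℝ (‖u‖⁻¹ • u) (σ : V)) / 2 := by linarith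
  rw [h1, inv_sqrt_eq_rpow h3]
  exact mul_le_mul_of_nonneg_right (by linarith) (Real.rpow_nonneg h3 _)

/-- The family seen from a fixed `v`: `|q|² = |u|² y β² / 2`, so `φ y = y β²`. -/
theorem abs_integral_pairAverage_shift_le {F N X W : V → ℝ} (hF : ContDiff ℝ 1 F)
    (hN : Continuous N) (hFN : ∀ x, ‖fderiv ℝ F x‖ ≤ N x) (hX : Continuous X) (hW : Continuous W)
    (hXW : ∀ p q : V, ‖q‖ ^ 2 ≤ inner ℝ q p → |X q| ≤ W p) {e : ℝ → ℝ} (he : IsCoeff e)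
    {u : V} (hu : u ≠ 0) :
    |∫ σ, (pairAverage F X u (shift e u σ) - pairAverage F X u (shift elastic u σ)) ∂surface| ≤
      8 * Real.pi * (1 - e ‖u‖) * (‖u‖ * sphereAverage (fun x => N x * W x) u +
        sphereAverage (fun x => |F x| * W x) u) := by
  have hu0 : 0 < ‖u‖ := norm_pos_iff.2 hu
  have hc : ∀ {e : ℝ → ℝ}, IsCoeff e → Continuous (shift e u) := fun h =>
    h.continuous_shift.comp (f := fun σ : S2 => (u, σ)) (by fun_prop)
  have hfc := continuous_factor he hu0
  have hb1 := half_le_factor he hu0 2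
  have hb2 := factor_le_one he hu0 2
  have hb3 := one_sub_factor_two e ‖u‖
  refine abs_integral_pairAverage_sub_le hF hN hFN hX hW hXW hu (hc he)
    (φ := fun y => y * factor e ‖u‖ y ^ 2) (κ := fun y => y) (by fun_prop)
    (monotoneOn_mul_factor_sq he hu0) (monotoneOn_sub_mul_factor_sq he hu0) (by simp)
    continuous_id (fun y hy => hy) (he.norm_shift_sq_le u) (fun σ => ?_) (fun σ => ?_) (fun σ => ?_)
    (fun σ hσ => ?_) ?_
  · rw [norm_shift he, mul_pow, impactVelocity_sq hu, factor, ← impactVelocity_eq_sqrt]; ring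
  · rw [norm_shift isCoeff_elastic, mul_pow, impactVelocity_sq hu, elastic]; ring
  · rw [norm_shift isCoeff_elastic, inner_shift, elastic]; ring
  · rw [norm_shift he, inner_shift]
    have h0 := he.nonneg _ (impactVelocity_nonneg u σ)
    have h1 := he.le_one _ (impactVelocity_nonneg u σ)
    exact (arccos_sub_arccos_shift_le (impactVelocity_nonneg u σ) (impactVelocity_lt hu hσ)
      (by linarith) (by linarith)).trans (angle_bound_le he hu hσ)
  -- With `β` at `y = 2`: `2 (1 - β²) ≤ 4 (1 - β) = 2 (1 - e |u|)`.
  · nlinarith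

/-- The family seen from a fixed `w`: `|u - q|² = |u|² (2 - y β (2 - β)) / 2`, so lengths decrease
in `y`; hence `κ y = 2 - y` and `φ y = y β (2 - β)`. -/
theorem abs_integral_pairAverage_sub_shift_le {F N X W : V → ℝ} (hF : ContDiff ℝ 1 F)
    (hN : Continuous N) (hFN : ∀ x, ‖fderiv ℝ F x‖ ≤ N x) (hX : Continuous X) (hW : Continuous W)
    (hXW : ∀ p q : V, ‖q‖ ^ 2 ≤ inner ℝ q p → |X q| ≤ W p) {e : ℝ → ℝ} (he : IsCoeff e)
    {u : V} (hu : u ≠ 0) :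
    |∫ σ, (pairAverage F X u (u - shift e u σ) - pairAverage F X u (u - shift elastic u σ))
      ∂surface| ≤
      8 * Real.pi * (1 - e ‖u‖) * (‖u‖ * sphereAverage (fun x => N x * W x) u +
        sphereAverage (fun x => |F x| * W x) u) := by
  have hu0 : 0 < ‖u‖ := norm_pos_iff.2 hu
  have hc : ∀ {e : ℝ → ℝ}, IsCoeff e → Continuous fun σ => u - shift e u σ := fun h =>
    continuous_const.sub (h.continuous_shift.comp (f := fun σ : S2 => (u, σ)) (by fun_prop))
  have hfc := continuous_factor he hu0
  have hb1 := half_le_factor he hu0 2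
  have hb2 := factor_le_one he hu0 2
  have hb3 := one_sub_factor_two e ‖u‖
  refine abs_integral_pairAverage_sub_le hF hN hFN hX hW hXW hu (hc he)
    (φ := fun y => y * (factor e ‖u‖ y * (2 - factor e ‖u‖ y))) (κ := fun y => 2 - y) (by fun_prop)
    (monotoneOn_mul_factor_mul he hu0) (monotoneOn_sub_mul_factor_mul he hu0) (by simp)
    (by fun_prop) (fun y hy => ⟨by linarith [hy.2], by linarith [hy.1]⟩) (fun σ => ?_)
    (fun σ => ?_) (fun σ => ?_) (fun σ => ?_) (fun σ hσ => ?_) ?_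
  · rw [norm_sub_shift_sq he, inner_sub_shift]
    have h0 := he.nonneg _ (impactVelocity_nonneg u σ)
    have h1 := he.le_one _ (impactVelocity_nonneg u σ)
    have := mul_nonneg (sq_nonneg (impactVelocity u σ)) (mul_nonneg
      (by linarith : 0 ≤ (1 + e (impactVelocity u σ)) / 2)
      (by linarith : 0 ≤ 1 - (1 + e (impactVelocity u σ)) / 2))
    nlinarith
  · rw [norm_sub_shift_sq he, impactVelocity_sq hu]
    simp only [factor, ← impactVelocity_eq_sqrt]; ring
  · rw [norm_sub_shift_sq isCoeff_elastic, impactVelocity_sq hu, elastic]; ring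
  · rw [norm_sub_shift_sq isCoeff_elastic, inner_sub_shift, elastic]; ring
  · rw [inner_sub_shift]
    have h0 := he.nonneg _ (impactVelocity_nonneg u σ)
    have h1 := he.le_one _ (impactVelocity_nonneg u σ)
    exact (arccos_sub_arccos_sub_shift_le (impactVelocity_nonneg u σ) (impactVelocity_lt hu hσ)
      (by linarith) (by linarith) (norm_nonneg _) (norm_sub_shift_sq he u σ)).trans
      (angle_bound_le he hu hσ)
  · nlinarith

/-! ### Integration over the relative velocity -/

/-- Invariance of the measure under each isometry, followed by Fubini. -/
theorem integral_eq_integral_iso {α : Type*} [MeasurableSpace α] {μ : Measure α}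
    [IsFiniteMeasure μ] {act : Iso → α → α} (hact : Measurable (Function.uncurry act))
    (hmp : ∀ A, MeasurePreserving (act A) μ μ) {Φ : α → ℝ} (hΦ : Measurable Φ) {K : Set α}
    (hK : ∀ᵐ x ∂μ, x ∈ K) (hKact : ∀ A, ∀ x ∈ K, act A x ∈ K) {M : ℝ} (hM : ∀ x ∈ K, |Φ x| ≤ M) :
    ∫ x, Φ x ∂μ = ∫ x, ∫ A, Φ (act A x) ∂isoMeasure ∂μ := by
  -- `Φ` is bounded on `K` only; truncation gives a globally bounded function, for which Fubini
  -- needs no further check.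
  set Ψ : α → ℝ := fun x => max (-M) (min M (Φ x)) with hΨ
  have hΨm : Measurable Ψ := measurable_const.max (measurable_const.min hΦ)
  have heq : ∀ x ∈ K, Ψ x = Φ x := fun x hx => by
    have := abs_le.1 (hM x hx)
    simp only [hΨ]
    rw [min_eq_right this.2, max_eq_right this.1]
  have hb : ∀ x, |Ψ x| ≤ |M| := fun x => by
    rw [abs_le]
    constructor
    · exact (neg_le_neg (le_abs_self M)).trans (le_max_left _ _)
    · exact max_le (neg_le_abs M) ((min_le_left _ _).trans (le_abs_self M))
  have hi : Integrable (Function.uncurry fun (A : Iso) x => Ψ (act A x)) (isoMeasure.prod μ) :=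
    Integrable.of_bound (hΨm.comp hact).aestronglyMeasurable |M| (ae_of_all _ fun x => hb _)
  calc ∫ x, Φ x ∂μ = ∫ x, Ψ x ∂μ := by
        refine integral_congr_ae ?_
        filter_upwards [hK] with x hx using (heq x hx).symm
    _ = ∫ A : Iso, ∫ x, Ψ (act A x) ∂μ ∂isoMeasure := by
        have : ∀ A, ∫ x, Ψ (act A x) ∂μ = ∫ x, Ψ x ∂μ := fun A => by
          have h := integral_map (hmp A).aemeasurable hΨm.aestronglyMeasurable
          rw [(hmp A).map_eq] at h
          exact h.symm
        simp [this]
    _ = ∫ x, ∫ A, Ψ (act A x) ∂isoMeasure ∂μ := integral_integral_swap hi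
    _ = _ := by
        refine integral_congr_ae ?_
        filter_upwards [hK] with x hx
        exact integral_congr_ae (ae_of_all _ fun A => heq _ (hKact A x hx))

theorem measurePreserving_iso_restrict (A : Iso) (R : ℝ) :
    MeasurePreserving (fun u => (A : V →L[ℝ] V) u)
      (volume.restrict (Metric.closedBall 0 R)) (volume.restrict (Metric.closedBall 0 R)) := by
  have h := (measurePreserving_iso_apply A).restrict_preimage
    (s := Metric.closedBall (0 : V) R) measurableSet_closedBall
  have : (fun u => (A : V →L[ℝ] V) u) ⁻¹' Metric.closedBall (0 : V) R = Metric.closedBall 0 R := by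
    ext u; simp [norm_iso_apply]
  rwa [this] at h

instance (R : ℝ) : IsFiniteMeasure ((volume : Measure V).restrict (Metric.closedBall 0 R)) :=
  ⟨by rw [Measure.restrict_apply_univ]; exact measure_closedBall_lt_top⟩

theorem integral_closedBall_eq_sphereAverage {Φ : V → ℝ} (hΦ : Continuous Φ) (R : ℝ) :
    ∫ u in Metric.closedBall (0 : V) R, Φ u = ∫ u in Metric.closedBall (0 : V) R, sphereAverage Φ u := by
  obtain ⟨M, hM⟩ := (isCompact_closedBall (0 : V) R).exists_bound_of_continuousOn hΦ.continuousOn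
  refine integral_eq_integral_iso (act := fun A u => (A : V →L[ℝ] V) u)
    continuous_iso_apply.measurable
    (fun A => measurePreserving_iso_restrict A R) hΦ.measurable
    (ae_restrict_mem measurableSet_closedBall) (fun A u hu => ?_) hM
  simpa [norm_iso_apply] using hu

theorem integral_closedBall_sphere_eq {Φ : V × S2 → ℝ} (hΦ : Continuous Φ) (R : ℝ) :
    ∫ u in Metric.closedBall (0 : V) R, ∫ σ, Φ (u, σ) ∂surface =
      ∫ u in Metric.closedBall (0 : V) R, ∫ σ, ∫ A : Iso,
        Φ ((A : V →L[ℝ] V) u, isoSphere A σ) ∂isoMeasure ∂surface := by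
  have hcomp : IsCompact (Metric.closedBall (0 : V) R ×ˢ (univ : Set S2)) :=
    (isCompact_closedBall (0 : V) R).prod isCompact_univ
  obtain ⟨M, hM⟩ := hcomp.exists_bound_of_continuousOn hΦ.continuousOn
  have hactc : Continuous fun p : Iso × V × S2 =>
      ((p.1 : V →L[ℝ] V) p.2.1, isoSphere p.1 p.2.2) :=
    (continuous_iso_apply.comp (f := fun p : Iso × V × S2 => (p.1, p.2.1)) (by fun_prop)).prodMk
      (continuous_isoSphere.comp (f := fun p : Iso × V × S2 => (p.1, p.2.2)) (by fun_prop))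
  have hmem : ∀ᵐ x ∂((volume.restrict (Metric.closedBall (0 : V) R)).prod surface),
      x ∈ Metric.closedBall (0 : V) R ×ˢ (univ : Set S2) := by
    have h := Measure.prod_restrict (μ := (volume : Measure V)) (ν := surface)
      (Metric.closedBall 0 R) univ
    rw [Measure.restrict_univ] at h
    rw [h]
    exact ae_restrict_mem (measurableSet_closedBall.prod MeasurableSet.univ)
  have h := integral_eq_integral_iso
    (μ := (volume.restrict (Metric.closedBall (0 : V) R)).prod surface)
    (act := fun A p => ((A : V →L[ℝ] V) p.1, isoSphere A p.2)) hactc.measurable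
    (fun A => (measurePreserving_iso_restrict A R).prod (measurePreserving_isoSphere A))
    hΦ.measurable hmem (fun A p hp => ⟨by simpa [norm_iso_apply] using hp.1, mem_univ _⟩) hM
  have hi : ∀ {H : V × S2 → ℝ}, Continuous H →
      Integrable H ((volume.restrict (Metric.closedBall (0 : V) R)).prod surface) := fun {H} hH => by
    obtain ⟨M', hM'⟩ := hcomp.exists_bound_of_continuousOn hH.continuousOn
    refine Integrable.of_bound hH.aestronglyMeasurable M' ?_
    filter_upwards [hmem] with x hx using hM' x hx
  rw [integral_prod _ (hi hΦ), integral_prod] at h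
  · exact h
  · refine hi (continuous_sphereAverage_of (H := fun (p : V × S2) (A : Iso) =>
      Φ ((A : V →L[ℝ] V) p.1, isoSphere A p.2)) ?_)
    exact hΦ.comp (hactc.comp (f := fun z : (V × S2) × Iso => (z.2, z.1)) (by fun_prop))

/-- The effect of replacing the transferred velocities `q₁` by `q`, tested against a `C¹` density,
given the bound at fixed relative velocity. -/
theorem abs_integral_displacement_le {F N X W : V → ℝ} (hF : Continuous F)
    (hN : Continuous N) (hX : Continuous X) (hW : Continuous W) {e : ℝ → ℝ} (he : IsCoeff e)
    {q q₁ : V → S2 → V} (hq : Continuous fun p : V × S2 => q p.1 p.2)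
    (hq₁ : Continuous fun p : V × S2 => q₁ p.1 p.2)
    (hqA : ∀ (A : Iso) u σ, q ((A : V →L[ℝ] V) u) (isoSphere A σ) = (A : V →L[ℝ] V) (q u σ))
    (hqA₁ : ∀ (A : Iso) u σ, q₁ ((A : V →L[ℝ] V) u) (isoSphere A σ) = (A : V →L[ℝ] V) (q₁ u σ))
    (h : ∀ u ≠ 0, |∫ σ, (pairAverage F X u (q u σ) - pairAverage F X u (q₁ u σ)) ∂surface| ≤
      8 * Real.pi * (1 - e ‖u‖) * (‖u‖ * sphereAverage (fun x => N x * W x) u +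
        sphereAverage (fun x => |F x| * W x) u)) (R : ℝ) :
    |∫ u in Metric.closedBall (0 : V) R, F u * (‖u‖ * ∫ σ, (X (q u σ) - X (q₁ u σ)) ∂surface)| ≤
      8 * Real.pi * ∫ u in Metric.closedBall (0 : V) R,
        ‖u‖ * (1 - e ‖u‖) * (‖u‖ * N u + |F u|) * W u := by
  have hec : Continuous fun u : V => e ‖u‖ :=
    he.continuousOn.comp_continuous continuous_norm fun u => norm_nonneg u
  have hcp := fun (q : V → S2 → V) (hq : Continuous fun p : V × S2 => q p.1 p.2) =>
    hX.comp hq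
  have hcq := hcp q hq
  have hcq₁ := hcp q₁ hq₁
  have hΦ : Continuous fun p : V × S2 => ‖p.1‖ * (F p.1 * X (q p.1 p.2) - F p.1 * X (q₁ p.1 p.2)) := by
    have h1 : Continuous fun p : V × S2 => F p.1 := hF.comp continuous_fst
    exact (continuous_fst.norm).mul ((h1.mul hcq).sub (h1.mul hcq₁))
  have h1 : ∫ u in Metric.closedBall (0 : V) R, F u * (‖u‖ * ∫ σ, (X (q u σ) - X (q₁ u σ)) ∂surface) =
      ∫ u in Metric.closedBall (0 : V) R, ‖u‖ *
        ∫ σ, (pairAverage F X u (q u σ) - pairAverage F X u (q₁ u σ)) ∂surface := by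
    have h2 := integral_closedBall_sphere_eq hΦ R
    have h3 : ∀ u, ∫ σ, ‖u‖ * (F u * X (q u σ) - F u * X (q₁ u σ)) ∂surface =
        F u * (‖u‖ * ∫ σ, (X (q u σ) - X (q₁ u σ)) ∂surface) := fun u => by
      rw [← mul_assoc, ← integral_const_mul]
      exact integral_congr_ae (ae_of_all _ fun σ => by ring)
    have hint : ∀ (u p : V), Integrable (fun A : Iso => F ((A : V →L[ℝ] V) u) *
        X ((A : V →L[ℝ] V) p)) isoMeasure := fun u p => Continuous.integrable_iso
      ((hF.comp (continuous_iso_apply_left u)).mul (hX.comp (continuous_iso_apply_left p)))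
    have h4 : ∀ u σ, ∫ A : Iso, ‖(A : V →L[ℝ] V) u‖ * (F ((A : V →L[ℝ] V) u) *
        X (q ((A : V →L[ℝ] V) u) (isoSphere A σ)) - F ((A : V →L[ℝ] V) u) *
        X (q₁ ((A : V →L[ℝ] V) u) (isoSphere A σ))) ∂isoMeasure =
        ‖u‖ * (pairAverage F X u (q u σ) - pairAverage F X u (q₁ u σ)) := fun u σ => by
      simp only [norm_iso_apply, hqA, hqA₁]
      rw [integral_const_mul, integral_sub (hint _ _) (hint _ _)]
      rfl
    simp only [h3, h4] at h2
    rw [h2]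
    simp only [integral_const_mul]
  rw [h1]
  have hNW : Continuous fun x => N x * W x := hN.mul hW
  have hFW : Continuous fun x => |F x| * W x := hF.abs.mul hW
  have hsN := continuous_sphereAverage hNW
  have hsF := continuous_sphereAverage hFW
  have hfin : Continuous fun u : V => ‖u‖ * (1 - e ‖u‖) * (‖u‖ * N u + |F u|) * W u :=
    ((continuous_norm.mul (continuous_const.sub hec)).mul ((continuous_norm.mul hN).add hF.abs)).mul hW
  rw [integral_closedBall_eq_sphereAverage hfin, ← integral_const_mul, ← Real.norm_eq_abs]
  refine norm_integral_le_of_norm_le ?_ (ae_of_all _ fun u => ?_)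
  · exact ((continuous_sphereAverage hfin).continuousOn.integrableOn_compact
      (isCompact_closedBall _ _)).const_mul _
  · have h5 : sphereAverage (fun u : V => ‖u‖ * (1 - e ‖u‖) * (‖u‖ * N u + |F u|) * W u) u =
        ‖u‖ * (1 - e ‖u‖) * (‖u‖ * sphereAverage (fun x => N x * W x) u +
          sphereAverage (fun x => |F x| * W x) u) := by
      unfold sphereAverage
      simp only [norm_iso_apply]
      have i1 : Integrable (fun A : Iso => N ((A : V →L[ℝ] V) u) * W ((A : V →L[ℝ] V) u))
        isoMeasure := Continuous.integrable_iso (hNW.comp (continuous_iso_apply_left u))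
      have i2 : Integrable (fun A : Iso => |F ((A : V →L[ℝ] V) u)| * W ((A : V →L[ℝ] V) u))
        isoMeasure := Continuous.integrable_iso (hFW.comp (continuous_iso_apply_left u))
      rw [← integral_const_mul, ← integral_add (i1.const_mul _) i2, ← integral_const_mul]
      exact integral_congr_ae (ae_of_all _ fun A => by ring)
    rw [h5, norm_mul, norm_norm, Real.norm_eq_abs]
    rcases eq_or_ne u 0 with rfl | hu
    · simp
    · calc _ ≤ ‖u‖ * _ := mul_le_mul_of_nonneg_left (h u hu) (norm_nonneg u)
        _ = _ := by ring

/-! ### Mollification and weak derivatives -/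

/-- Convolution with a normalised bump function. -/
def mollify (φ : ContDiffBump (0 : V)) (g : V → ℝ) : V → ℝ :=
  convolution (φ.normed volume) g (ContinuousLinearMap.lsmul ℝ ℝ) volume

theorem mollify_apply (φ : ContDiffBump (0 : V)) (g : V → ℝ) (x : V) :
    mollify φ g x = ∫ t, φ.normed volume t * g (x - t) := rfl

theorem integrable_mollify_integrand (φ : ContDiffBump (0 : V)) {g : V → ℝ}
    (hg : LocallyIntegrable g) (x : V) :
    Integrable fun t => φ.normed volume t * g (x - t) :=
  φ.hasCompactSupport_normed.convolutionExists_left (ContinuousLinearMap.lsmul ℝ ℝ)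
    φ.continuous_normed hg x

theorem contDiff_mollify (φ : ContDiffBump (0 : V)) {g : V → ℝ} (hg : LocallyIntegrable g) :
    ContDiff ℝ 1 (mollify φ g) :=
  φ.hasCompactSupport_normed.contDiff_convolution_left (n := 1) _ φ.contDiff_normed hg

theorem integrable_mollify (φ : ContDiffBump (0 : V)) {g : V → ℝ} (hg : Integrable g) :
    Integrable (mollify φ g) :=
  φ.integrable_normed.integrable_convolution _ hg

theorem mollify_sub (φ : ContDiffBump (0 : V)) {g h : V → ℝ} (hg : LocallyIntegrable g)
    (hh : LocallyIntegrable h) : mollify φ (g - h) = mollify φ g - mollify φ h := by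
  ext x
  simp only [mollify_apply, Pi.sub_apply, mul_sub]
  exact integral_sub (integrable_mollify_integrand φ hg x) (integrable_mollify_integrand φ hh x)

theorem integral_abs_mollify_le (φ : ContDiffBump (0 : V)) {g : V → ℝ} (hg : Integrable g) :
    ∫ x, |mollify φ g x| ≤ ∫ x, |g x| := by
  have h1 : ∫ x, mollify φ (fun y => |g y|) x = ∫ x, |g x| := by
    have := integral_convolution (μ := (volume : Measure V)) (ν := volume)
      (ContinuousLinearMap.lsmul ℝ ℝ : ℝ →L[ℝ] ℝ →L[ℝ] ℝ) (φ.integrable_normed (μ := volume)) hg.abs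
    rw [φ.integral_normed] at this
    simpa [mollify] using this
  rw [← h1]
  refine integral_mono (integrable_mollify φ hg).abs (integrable_mollify φ hg.abs) fun x => ?_
  rw [mollify_apply, mollify_apply]
  refine (abs_integral_le_integral_abs).trans (le_of_eq ?_)
  exact integral_congr_ae (ae_of_all _ fun t => by
    simp only [abs_mul, abs_of_nonneg (φ.nonneg_normed t)])

/-- The partial derivatives of a mollification are the mollified weak partial derivatives. -/
theorem IsWeakPartial.fderiv_mollify {i : Fin 3} {g h : V → ℝ} (hh : IsWeakPartial i g h)
    (hg : LocallyIntegrable g) (φ : ContDiffBump (0 : V)) (x : V) :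
    fderiv ℝ (mollify φ g) x (EuclideanSpace.single i 1) = mollify φ h x := by
  have hd := φ.hasCompactSupport_normed (μ := volume).hasFDerivAt_convolution_left
    (ContinuousLinearMap.lsmul ℝ ℝ : ℝ →L[ℝ] ℝ →L[ℝ] ℝ) (φ.contDiff_normed (n := 1)) hg x
  have hd' : fderiv ℝ (mollify φ g) x = _ := hd.fderiv
  have hint := (φ.hasCompactSupport_normed (μ := volume)).fderiv ℝ |>.convolutionExists_left
    ((ContinuousLinearMap.lsmul ℝ ℝ : ℝ →L[ℝ] ℝ →L[ℝ] ℝ).precompL V)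
    (φ.contDiff_normed (n := 1) |>.continuous_fderiv one_ne_zero) hg x
  rw [hd', convolution_def, ContinuousLinearMap.integral_apply hint]
  have hφ : ContDiff ℝ ∞ fun y => φ.normed volume (x - y) :=
    φ.contDiff_normed.comp (contDiff_const.sub contDiff_id)
  have hc : HasCompactSupport fun y => φ.normed volume (x - y) :=
    φ.hasCompactSupport_normed.comp_homeomorph (Homeomorph.subLeft x)
  have h1 := hh.2 _ hφ hc
  have h2 : ∀ y, fderiv ℝ (fun y => φ.normed volume (x - y)) y =
      -fderiv ℝ (φ.normed volume) (x - y) := fun y => by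
    have h3 := ((φ.contDiff_normed (n := 1) (μ := volume)).differentiable one_ne_zero
      (x - y)).hasFDerivAt.comp y ((hasFDerivAt_const x y).sub (hasFDerivAt_id y))
    rw [show (fun y => φ.normed volume (x - y)) = φ.normed volume ∘ (fun y => x - id y) from rfl]
    refine HasFDerivAt.fderiv (h3.congr_fderiv ?_)
    ext; simp
  simp only [h2] at h1
  rw [mollify_apply, ← integral_sub_left_eq_self (fun t => φ.normed volume t * h (x - t)) volume x,
    ← integral_sub_left_eq_self _ volume x]
  simp only [ContinuousLinearMap.precompL_apply, ContinuousLinearMap.lsmul_apply, sub_sub_cancel,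
    smul_eq_mul]
  rw [← neg_inj, ← integral_neg]
  refine (integral_congr_ae (ae_of_all _ fun y => ?_)).trans (h1.trans ?_)
  · simp; ring
  · congr 1; exact integral_congr_ae (ae_of_all _ fun y => by simp only; ring)

theorem norm_clm_le_sum (L : V →L[ℝ] ℝ) : ‖L‖ ≤ ∑ i, |L (EuclideanSpace.single i 1)| := by
  refine L.opNorm_le_bound (Finset.sum_nonneg fun i _ => abs_nonneg _) fun x => ?_
  have hx : x = ∑ i, x i • EuclideanSpace.single i (1 : ℝ) := by
    ext j; simp [Fin.sum_univ_three]; fin_cases j <;> simp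
  conv_lhs => rw [hx]
  rw [map_sum, Finset.sum_mul]
  refine (norm_sum_le _ _).trans (Finset.sum_le_sum fun i _ => ?_)
  rw [map_smul, norm_smul, mul_comm, Real.norm_eq_abs (L _)]
  exact mul_le_mul_of_nonneg_left (PiLp.norm_apply_le x i) (abs_nonneg _)

/-- A sequence of bump functions shrinking to the origin. -/
def bump (n : ℕ) : ContDiffBump (0 : V) where
  rIn := 1 / (2 * (n + 1))
  rOut := 1 / (n + 1)
  rIn_pos := by positivity
  rIn_lt_rOut := by
    have : (0 : ℝ) < n + 1 := by positivity
    exact one_div_lt_one_div_of_lt this (by linarith)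

theorem tendsto_integral_abs_mollify_sub_of_continuous {c : V → ℝ} (hc : Continuous c)
    (hcs : HasCompactSupport c) :
    Tendsto (fun n => ∫ x, |mollify (bump n) c x - c x|) atTop (𝓝 0) := by
  obtain ⟨M, hM⟩ := hc.bounded_above_of_compact_support hcs
  have hM0 : 0 ≤ M := (norm_nonneg _).trans (hM 0)
  obtain ⟨R, hR⟩ := hcs.isCompact.isBounded.subset_closedBall (0 : V)
  have hz : ∀ x, R < ‖x‖ → c x = 0 := fun x hx => by
    by_contra h
    have := hR (subset_tsupport c (Function.mem_support.2 h))
    rw [mem_closedBall_zero_iff] at this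
    linarith
  have hli : LocallyIntegrable c volume := hc.locallyIntegrable
  have hp : ∀ x, Tendsto (fun n => mollify (bump n) c x) atTop (𝓝 (c x)) := fun x =>
    ContDiffBump.convolution_tendsto_right_of_continuous (μ := volume) (φ := bump)
      (by simpa [bump] using tendsto_one_div_add_atTop_nhds_zero_nat (𝕜 := ℝ)) hc x
  have hb : ∀ n x, |mollify (bump n) c x| ≤ M := fun n x => by
    rw [mollify_apply, ← Real.norm_eq_abs]
    calc _ ≤ ∫ t, (bump n).normed volume t * M := by
          refine norm_integral_le_of_norm_le (((bump n).integrable_normed (μ := volume)).mul_const M)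
            (ae_of_all _ fun t => ?_)
          rw [norm_mul, Real.norm_of_nonneg ((bump n).nonneg_normed t)]
          exact mul_le_mul_of_nonneg_left (hM _) ((bump n).nonneg_normed t)
      _ = M := by rw [integral_mul_const, (bump n).integral_normed, one_mul]
  have hs : ∀ n x, R + 1 < ‖x‖ → mollify (bump n) c x = 0 := fun n x hx => by
    rw [mollify_apply]
    refine integral_eq_zero_of_ae (ae_of_all _ fun t => ?_)
    by_cases ht : t ∈ Metric.ball (0 : V) (bump n).rOut
    · have h1 : ‖t‖ < 1 := by
        rw [mem_ball_zero_iff] at ht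
        refine ht.trans_le ?_
        simp only [bump]
        rw [div_le_one (by positivity)]
        linarith [Nat.cast_nonneg (α := ℝ) n]
      have := norm_sub_norm_le x t
      simp [hz (x - t) (by linarith)]
    · rw [← (bump n).support_normed_eq (μ := volume), Function.notMem_support] at ht
      simp [ht]
  have h := tendsto_integral_of_dominated_convergence (μ := (volume : Measure V))
    (F := fun n x => |mollify (bump n) c x - c x|) (f := fun _ => 0)
    ((Metric.closedBall (0 : V) (R + 1)).indicator fun _ => 2 * M)
    (fun n => ((contDiff_mollify _ hli).continuous.sub hc).abs.aestronglyMeasurable)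
    ((integrable_indicator_iff measurableSet_closedBall).2
      (integrableOn_const measure_closedBall_lt_top.ne)) (fun n => ae_of_all _ fun x => ?_)
    (ae_of_all _ fun x => ?_)
  · simpa using h
  · rw [Real.norm_eq_abs, abs_abs]
    by_cases hx : x ∈ Metric.closedBall (0 : V) (R + 1)
    · rw [indicator_of_mem hx]
      have := abs_sub (mollify (bump n) c x) (c x)
      have h1 := hM x
      rw [Real.norm_eq_abs] at h1
      linarith [hb n x]
    · rw [indicator_of_notMem hx]
      rw [mem_closedBall_zero_iff, not_le] at hx
      simp [hs n x hx, hz x (by linarith)]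
  · simpa using ((hp x).sub_const (c x)).abs

/-- Mollification contracts the `L¹` norm, and continuous functions with compact support are dense.
-/
theorem tendsto_integral_abs_mollify_sub {g : V → ℝ} (hg : Integrable g) :
    Tendsto (fun n => ∫ x, |mollify (bump n) g x - g x|) atTop (𝓝 0) := by
  rw [Metric.tendsto_atTop]
  intro ε hε
  obtain ⟨c, hcs, hcg, hc, hci⟩ := hg.exists_hasCompactSupport_integral_sub_le
    (ε := ε / 4) (by linarith)
  obtain ⟨n₀, hn₀⟩ := Metric.tendsto_atTop.1
    (tendsto_integral_abs_mollify_sub_of_continuous hc hcs) (ε / 4) (by linarith)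
  refine ⟨n₀, fun n hn => ?_⟩
  have h1 := hn₀ n hn
  rw [Real.dist_0_eq_abs, abs_of_nonneg (integral_nonneg fun x => abs_nonneg _)] at h1 ⊢
  have h2 := integral_abs_mollify_le (bump n) (hg.sub hci)
  have hgm := integrable_mollify (bump n) hg
  have hcm := integrable_mollify (bump n) hci
  rw [mollify_sub _ hg.locallyIntegrable hci.locallyIntegrable] at h2
  have h3 : ∫ x, |mollify (bump n) g x - g x| ≤
      ∫ x, (|(mollify (bump n) g - mollify (bump n) c) x| + |mollify (bump n) c x - c x|) +
        |(g - c) x| := by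
    refine integral_mono (hgm.sub hg).abs (((hgm.sub hcm).abs.add (hcm.sub hci).abs).add
      (hg.sub hci).abs) fun x => ?_
    have := abs_add_le (mollify (bump n) g x - mollify (bump n) c x) (mollify (bump n) c x - c x)
    have := abs_add_le (mollify (bump n) g x - mollify (bump n) c x + (mollify (bump n) c x - c x)) (c x - g x)
    rw [abs_sub_comm (c x)] at this
    simp only [Pi.sub_apply]
    refine le_trans (le_of_eq (by congr 1; ring)) (this.trans ?_)
    linarith
  have i1 : Integrable fun x => |(mollify (bump n) g - mollify (bump n) c) x| := (hgm.sub hcm).abs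
  have i2 : Integrable fun x => |mollify (bump n) c x - c x| := (hcm.sub hci).abs
  have i3 : Integrable fun x => |(g - c) x| := (hg.sub hci).abs
  have i4 : Integrable fun x => |(mollify (bump n) g - mollify (bump n) c) x| +
    |mollify (bump n) c x - c x| := i1.add i2
  rw [integral_add i4 i3, integral_add i1 i2] at h3
  have h4 : ∫ x, |(g - c) x| ≤ ε / 4 := by simpa using hcg
  linarith

theorem tendsto_setIntegral_comp_mul {g : ℕ → V → ℝ} {g' : V → ℝ} (hg : ∀ n, Integrable (g n))
    (hg' : Integrable g') (h : Tendsto (fun n => ∫ x, |g n x - g' x|) atTop (𝓝 0)) {T : V → V}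
    (hT : MeasurePreserving T volume volume) {k : V → ℝ} (hk : Continuous k) (R : ℝ) :
    Tendsto (fun n => ∫ x in Metric.closedBall (0 : V) R, g n (T x) * k x) atTop
      (𝓝 (∫ x in Metric.closedBall (0 : V) R, g' (T x) * k x)) := by
  obtain ⟨M, hM⟩ := (isCompact_closedBall (0 : V) R).exists_bound_of_continuousOn hk.continuousOn
  have hM' : ∀ x ∈ Metric.closedBall (0 : V) R, ‖k x‖ ≤ |M| := fun x hx =>
    (hM x hx).trans (le_abs_self M)
  have hi : ∀ {u : V → ℝ}, Integrable u →
      Integrable (fun x => u (T x) * k x) (volume.restrict (Metric.closedBall (0 : V) R)) :=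
    fun {u} hu => ((hT.integrable_comp_of_integrable hu).restrict).mul_bdd (c := |M|)
      hk.aestronglyMeasurable.restrict
      ((ae_restrict_iff' measurableSet_closedBall).2 (ae_of_all _ hM'))
  rw [tendsto_iff_norm_sub_tendsto_zero]
  refine squeeze_zero (fun n => norm_nonneg _) (fun n => ?_)
    (by simpa using h.mul_const |M|)
  have hd : Integrable fun x => |g n x - g' x| := ((hg n).sub hg').abs
  have hdT : Integrable fun x => |g n (T x) - g' (T x)| := hT.integrable_comp_of_integrable hd
  rw [← integral_sub (hi (hg n)) (hi hg')]
  calc _ ≤ ∫ x in Metric.closedBall (0 : V) R, |g n (T x) - g' (T x)| * |M| := by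
        refine norm_integral_le_of_norm_le (hdT.restrict.mul_const _)
          ((ae_restrict_iff' measurableSet_closedBall).2 (ae_of_all _ fun x hx => ?_))
        rw [← sub_mul, norm_mul, Real.norm_eq_abs]
        exact mul_le_mul_of_nonneg_left (hM' x hx) (abs_nonneg _)
    _ ≤ ∫ x, |g n (T x) - g' (T x)| * |M| :=
        setIntegral_le_integral (hdT.mul_const _) (ae_of_all _ fun x => by positivity)
    _ = (∫ x, |g n x - g' x|) * |M| := by
        rw [integral_mul_const]
        congr 1
        have h1 := integral_map (μ := (volume : Measure V)) hT.aemeasurable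
          (f := fun x => |g n x - g' x|) (by rw [hT.map_eq]; exact hd.aestronglyMeasurable)
        rw [hT.map_eq] at h1
        exact h1.symm

/-! ### The displacement bound for Sobolev functions -/

/-- The `C¹` displacement bound, extended to functions with integrable weak derivatives composed
with a measure preserving affine isometry. -/
theorem abs_setIntegral_le_of_weakPartial {k w : V → ℝ} (hk : Continuous k) (hw : Continuous w)
    {R B : ℝ}
    (hC1 : ∀ F N : V → ℝ, ContDiff ℝ 1 F → Continuous N → (∀ x, ‖fderiv ℝ F x‖ ≤ N x) →
      |∫ u in Metric.closedBall (0 : V) R, F u * k u| ≤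
        B * ∫ u in Metric.closedBall (0 : V) R, (‖u‖ * N u + |F u|) * w u)
    {T : V → V} (hT : MeasurePreserving T volume volume) (hTs : ContDiff ℝ 1 T)
    (hTd : ∀ x, ‖fderiv ℝ T x‖ ≤ 1) {g : V → ℝ} {h : Fin 3 → V → ℝ} (hg : Integrable g)
    (hh : ∀ i, Integrable (h i)) (hgh : ∀ i, IsWeakPartial i g (h i)) :
    |∫ u in Metric.closedBall (0 : V) R, g (T u) * k u| ≤
      B * ((∑ i, ∫ u in Metric.closedBall (0 : V) R, |h i (T u)| * (‖u‖ * w u)) +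
        ∫ u in Metric.closedBall (0 : V) R, |g (T u)| * w u) := by
  have habs : ∀ {u : V → ℝ}, Integrable u →
      Tendsto (fun n => ∫ x, |(|mollify (bump n) u x|) - (|u x|)|) atTop (𝓝 0) := fun {u} hu => by
    refine squeeze_zero (fun n => integral_nonneg fun x => abs_nonneg _) (fun n => ?_)
      (tendsto_integral_abs_mollify_sub hu)
    exact integral_mono ((integrable_mollify _ hu).abs.sub hu.abs).abs
      ((integrable_mollify _ hu).sub hu).abs fun x => abs_abs_sub_abs_le _ _
  have l1 := (tendsto_setIntegral_comp_mul (fun n => integrable_mollify (bump n) hg) hg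
    (tendsto_integral_abs_mollify_sub hg) hT hk R).abs
  have l2 := tendsto_setIntegral_comp_mul (fun n => (integrable_mollify (bump n) hg).abs) hg.abs
    (habs hg) hT hw R
  have l3 := tendsto_finsetSum Finset.univ fun i _ =>
    tendsto_setIntegral_comp_mul (fun n => (integrable_mollify (bump n) (hh i)).abs) (hh i).abs
      (habs (hh i)) hT (show Continuous fun u : V => ‖u‖ * w u from continuous_norm.mul hw) R
  refine le_of_tendsto_of_tendsto' l1 ((l3.add l2).const_mul B) fun n => ?_
  have hgs : ContDiff ℝ 1 (mollify (bump n) g) := contDiff_mollify _ hg.locallyIntegrable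
  have hhc : ∀ i, Continuous fun u => |mollify (bump n) (h i) (T u)| := fun i =>
    ((contDiff_mollify _ (hh i).locallyIntegrable).continuous.comp hTs.continuous).abs
  have hgc : Continuous fun u => |mollify (bump n) g (T u)| :=
    (hgs.continuous.comp hTs.continuous).abs
  -- The gradient majorant `N` is the sum of the absolute values of the mollified weak partial
  -- derivatives; each of them converges in `L¹`, so the bound survives the limit.
  refine (hC1 (fun u => mollify (bump n) g (T u)) (fun u => ∑ i, |mollify (bump n) (h i) (T u)|)
    (hgs.comp hTs) (continuous_finsetSum _ fun i _ => hhc i) fun x => ?_).trans (le_of_eq ?_)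
  · have h1 : fderiv ℝ (fun u => mollify (bump n) g (T u)) x =
        (fderiv ℝ (mollify (bump n) g) (T x)).comp (fderiv ℝ T x) :=
      fderiv_comp x (hgs.differentiable one_ne_zero _) (hTs.differentiable one_ne_zero _)
    rw [h1]
    refine (ContinuousLinearMap.opNorm_comp_le _ _).trans
      ((mul_le_of_le_one_right (norm_nonneg _) (hTd x)).trans ((norm_clm_le_sum _).trans
        (le_of_eq ?_)))
    exact Finset.sum_congr rfl fun i _ => by
      rw [(hgh i).fderiv_mollify hg.locallyIntegrable]
  · congr 1
    have hi : ∀ {u : V → ℝ}, Continuous u →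
        Integrable u (volume.restrict (Metric.closedBall (0 : V) R)) := fun hu =>
      hu.continuousOn.integrableOn_compact (isCompact_closedBall _ _)
    have i1 : ∀ i, Integrable (fun u => |mollify (bump n) (h i) (T u)| * (‖u‖ * w u))
        (volume.restrict (Metric.closedBall (0 : V) R)) := fun i =>
      hi ((hhc i).mul (continuous_norm.mul hw))
    have i2 : Integrable (fun u => |mollify (bump n) g (T u)| * w u)
        (volume.restrict (Metric.closedBall (0 : V) R)) := hi (hgc.mul hw)
    rw [← integral_finsetSum _ fun i _ => i1 i,
      ← integral_add (integrable_finsetSum _ fun i _ => i1 i) i2]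
    refine integral_congr_ae (ae_of_all _ fun u => ?_)
    simp only [Fin.sum_univ_three]
    ring

theorem continuous_integral_surface {H : V × S2 → ℝ} (hH : Continuous H) :
    Continuous fun u => ∫ σ, H (u, σ) ∂surface := by
  have := continuous_parametric_integral_of_continuous (μ := surface)
    (f := fun (u : V) (σ : S2) => H (u, σ)) hH isCompact_univ
  simpa using this

theorem setIntegral_comp_mul_le {T : V → V} (hT : MeasurePreserving T volume volume) {h : V → ℝ}
    {η a κ R : ℝ} (hη : 0 ≤ η) (ha : 0 ≤ a) (hh : MemL1 η a h) {k : V → ℝ} (hk : Continuous k)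
    (hkw : ∀ u ∈ Metric.closedBall (0 : V) R, k u ≤ κ * weight η a (T u)) (hκ : 0 ≤ κ) :
    ∫ u in Metric.closedBall (0 : V) R, |h (T u)| * k u ≤ κ * normL1 η a h := by
  have i1 : Integrable fun u => |h (T u)| * weight η a (T u) :=
    hT.integrable_comp_of_integrable hh.integrable_abs
  obtain ⟨M, hM⟩ := (isCompact_closedBall (0 : V) R).exists_bound_of_continuousOn hk.continuousOn
  have i2 : Integrable (fun u => |h (T u)| * k u) (volume.restrict (Metric.closedBall (0 : V) R)) :=
    ((hT.integrable_comp_of_integrable (hh.integrable hη ha).abs).restrict).mul_bdd (c := M)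
      hk.aestronglyMeasurable.restrict
      ((ae_restrict_iff' measurableSet_closedBall).2 (ae_of_all _ hM))
  calc _ ≤ ∫ u in Metric.closedBall (0 : V) R, κ * (|h (T u)| * weight η a (T u)) := by
        refine integral_mono_ae i2 (i1.const_mul κ).restrict ?_
        refine (ae_restrict_iff' measurableSet_closedBall).2 (ae_of_all _ fun u hu => ?_)
        have := mul_le_mul_of_nonneg_left (hkw u hu) (abs_nonneg (h (T u)))
        simp only; linarith
    _ ≤ ∫ u, κ * (|h (T u)| * weight η a (T u)) :=
        setIntegral_le_integral (i1.const_mul κ) (ae_of_all _ fun u =>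
          mul_nonneg hκ (mul_nonneg (abs_nonneg _) (weight_pos _ _ _).le))
    _ = κ * normL1 η a h := by
        rw [integral_const_mul, normL1]
        congr 1
        have h1 := integral_map (μ := (volume : Measure V)) hT.aemeasurable
          (f := fun x => |h x| * weight η a x)
          (by rw [hT.map_eq]; exact hh.integrable_abs.aestronglyMeasurable)
        rw [hT.map_eq] at h1
        exact h1.symm

theorem normW11_eq (η a : ℝ) (g : V → ℝ) :
    normW11 η a g = normL1 η a g + ∑ i, normL1 η a (weakPartial i g) := rfl

theorem normW11_nonneg (η a : ℝ) (g : V → ℝ) : 0 ≤ normW11 η a g :=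
  add_nonneg (normL1_nonneg _ _ _) (Finset.sum_nonneg fun _ _ => normL1_nonneg _ _ _)

theorem normL1_le_normW11 (η a : ℝ) (g : V → ℝ) : normL1 η a g ≤ normW11 η a g :=
  le_add_of_nonneg_right (Finset.sum_nonneg fun _ _ => normL1_nonneg _ _ _)

theorem MemW11.isWeakPartial {η a : ℝ} {g : V → ℝ} (hg : MemW11 η a g) (i : Fin 3) :
    IsWeakPartial i g (weakPartial i g) :=
  isWeakPartial_weakPartial ((hg.2 i).imp fun _ h => h.1)

theorem MemW11.memL1_weakPartial {η a : ℝ} {g : V → ℝ} (hg : MemW11 η a g) (i : Fin 3) :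
    MemL1 η a (weakPartial i g) := by
  obtain ⟨h, h1, h2⟩ := hg.2 i
  refine h2.congr ?_
  filter_upwards [h1.ae_eq (hg.isWeakPartial i)] with x hx
  rw [hx]

/-- The displacement bound in weighted spaces, with the relative velocity restricted to a ball. -/
theorem abs_setIntegral_displacement_le {X W : V → ℝ} (hX : Continuous X) (hW : Continuous W)
    {e : ℝ → ℝ} (he : IsCoeff e) {q q₁ : V → S2 → V} (hq : Continuous fun p : V × S2 => q p.1 p.2)
    (hq₁ : Continuous fun p : V × S2 => q₁ p.1 p.2)
    (hqA : ∀ (A : Iso) u σ, q ((A : V →L[ℝ] V) u) (isoSphere A σ) = (A : V →L[ℝ] V) (q u σ))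
    (hqA₁ : ∀ (A : Iso) u σ, q₁ ((A : V →L[ℝ] V) u) (isoSphere A σ) = (A : V →L[ℝ] V) (q₁ u σ))
    (h : ∀ F N : V → ℝ, ContDiff ℝ 1 F → Continuous N → (∀ x, ‖fderiv ℝ F x‖ ≤ N x) →
      ∀ u ≠ 0, |∫ σ, (pairAverage F X u (q u σ) - pairAverage F X u (q₁ u σ)) ∂surface| ≤
        8 * Real.pi * (1 - e ‖u‖) * (‖u‖ * sphereAverage (fun x => N x * W x) u +
          sphereAverage (fun x => |F x| * W x) u))
    {T : V → V} (hT : MeasurePreserving T volume volume) (hTs : ContDiff ℝ 1 T)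
    (hTd : ∀ x, ‖fderiv ℝ T x‖ ≤ 1) {η a κ R : ℝ} (hη : 0 ≤ η) (ha : 0 ≤ a) (hκ : 0 ≤ κ)
    (hb₁ : ∀ u, ‖u‖ ≤ R → ‖u‖ * (1 - e ‖u‖) * W u ≤ κ * weight η a (T u))
    (hb₂ : ∀ u, ‖u‖ ≤ R → ‖u‖ * (‖u‖ * (1 - e ‖u‖) * W u) ≤ κ * weight η a (T u))
    {g : V → ℝ} (hg : MemW11 η a g) :
    |∫ u in Metric.closedBall (0 : V) R, g (T u) * (‖u‖ * ∫ σ, (X (q u σ) - X (q₁ u σ)) ∂surface)| ≤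
      8 * Real.pi * κ * normW11 η a g := by
  have hec : Continuous fun u : V => e ‖u‖ :=
    he.continuousOn.comp_continuous continuous_norm fun u => norm_nonneg u
  have hw : Continuous fun u : V => ‖u‖ * (1 - e ‖u‖) * W u :=
    (continuous_norm.mul (continuous_const.sub hec)).mul hW
  have hk : Continuous fun u => ‖u‖ * ∫ σ, (X (q u σ) - X (q₁ u σ)) ∂surface :=
    continuous_norm.mul (continuous_integral_surface (H := fun p => X (q p.1 p.2) - X (q₁ p.1 p.2))
      ((hX.comp hq).sub (hX.comp hq₁)))
  have h1 := abs_setIntegral_le_of_weakPartial hk hw (R := R) (B := 8 * Real.pi)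
    (fun F N hF hN hFN => by
      refine (abs_integral_displacement_le hF.continuous hN hX hW he hq hq₁ hqA hqA₁
        (h F N hF hN hFN) R).trans (le_of_eq ?_)
      congr 1
      exact integral_congr_ae (ae_of_all _ fun u => by simp only; ring))
    hT hTs hTd (hg.1.integrable hη ha) (fun i => (hg.memL1_weakPartial i).integrable hη ha)
    (fun i => hg.isWeakPartial i)
  refine h1.trans ?_
  rw [mul_assoc (8 * Real.pi) κ]
  refine mul_le_mul_of_nonneg_left ?_ (by positivity)
  rw [normW11_eq, mul_add, Finset.mul_sum, add_comm (κ * _)]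
  exact add_le_add (Finset.sum_le_sum fun i _ =>
      setIntegral_comp_mul_le hT hη ha (hg.memL1_weakPartial i) (continuous_norm.mul hw)
        (fun u hu => hb₂ u (by simpa using hu)) hκ)
    (setIntegral_comp_mul_le hT hη ha hg.1 hw (fun u hu => hb₁ u (by simpa using hu)) hκ)

/-! ### Small relative velocities -/

/-- The difference of the tested collision kernels, restricted to relative velocities at most `R`. -/
def nearKernel (e : ℝ → ℝ) (ψ : V → ℝ) (R : ℝ) (p : V × V × S2) : ℝ :=
  if ‖p.1 - p.2.1‖ ≤ R then (ψ (postVelocity e p.1 p.2.1 p.2.2) -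
    ψ (postVelocity elastic p.1 p.2.1 p.2.2)) * (‖p.1 - p.2.1‖ / (4 * Real.pi)) else 0

theorem integral_nearKernel (e : ℝ → ℝ) (ψ : V → ℝ) (R : ℝ) (v w : V) :
    ∫ σ, nearKernel e ψ R (v, w, σ) ∂surface =
      (Metric.closedBall (0 : V) R).indicator (fun u => ‖u‖ *
        ∫ σ, (ψ (v - shift e u σ) - ψ (v - shift elastic u σ)) ∂surface) (v - w) /
        (4 * Real.pi) := by
  by_cases h : ‖v - w‖ ≤ R
  · rw [indicator_of_mem (by simpa using h)]
    simp only [nearKernel, if_pos h, postVelocity_eq]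
    rw [integral_mul_const]; ring
  · rw [indicator_of_notMem (by simpa using h)]
    simp [nearKernel, if_neg h]

theorem measurable_nearKernel {e : ℝ → ℝ} (he : IsCoeff e) {ψ : V → ℝ} (hψ : Continuous ψ) (R : ℝ) :
    Measurable (nearKernel e ψ R) := by
  have h1 := he.continuous_postVelocity
  have h2 := isCoeff_elastic.continuous_postVelocity
  have h3 : Continuous fun p : V × V × S2 => (ψ (postVelocity e p.1 p.2.1 p.2.2) -
    ψ (postVelocity elastic p.1 p.2.1 p.2.2)) * (‖p.1 - p.2.1‖ / (4 * Real.pi)) := by fun_prop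
  refine Measurable.ite ?_ h3.measurable measurable_const
  exact measurableSet_le (by fun_prop) measurable_const

/-- For fixed `v`, the substitution `w = v - u` gives `v' = v - q` with `q` the transferred
velocity. Since `q` lies in the ball of diameter `[0, u]`, energy dissipation bounds `ψ (v - q)` by
the weights of `v` and `v - u`. -/
theorem abs_integral_right_nearKernel_le {e : ℝ → ℝ} (he : IsCoeff e) {η a κ R : ℝ} (hη : 0 ≤ η) (ha : 0 ≤ a) (hκ : 0 ≤ κ)
    (hb₁ : ∀ v w : V, ‖v - w‖ ≤ R → ‖v - w‖ * (1 - e ‖v - w‖) *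
    (Real.exp (a * ‖v‖) * Real.exp (a * ‖w‖)) ≤ κ * (weight η a v * weight η a w))
    (hb₂ : ∀ v w : V, ‖v - w‖ ≤ R → ‖v - w‖ * (‖v - w‖ * (1 - e ‖v - w‖) *
    (Real.exp (a * ‖v‖) * Real.exp (a * ‖w‖))) ≤ κ * (weight η a v * weight η a w))
    {ψ : V → ℝ} (hψ : Continuous ψ) (hψb : ∀ z, |ψ z| ≤ Real.exp (a * ‖z‖))
    {g : V → ℝ} (hg : MemW11 η a g) (v : V) :
    |∫ w, g w * ∫ σ, nearKernel e ψ R (v, w, σ) ∂surface| ≤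
      2 * κ * weight η a v * normW11 η a g := by
  have h1 : ∫ w, g w * ∫ σ, nearKernel e ψ R (v, w, σ) ∂surface =
      (∫ u in Metric.closedBall (0 : V) R, g (v - u) *
        (‖u‖ * ∫ σ, (ψ (v - shift e u σ) - ψ (v - shift elastic u σ)) ∂surface)) /
        (4 * Real.pi) := by
    rw [← integral_sub_left_eq_self _ volume v, ← integral_indicator measurableSet_closedBall,
      ← integral_div]
    refine integral_congr_ae (ae_of_all _ fun u => ?_)
    simp only [integral_nearKernel, sub_sub_cancel]
    rw [← mul_div_assoc]
    by_cases hu : u ∈ Metric.closedBall (0 : V) R <;> simp [hu]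
  rw [h1, abs_div, abs_of_pos (by positivity : 0 < 4 * Real.pi), div_le_iff₀ (by positivity)]
  refine (abs_setIntegral_displacement_le (T := fun u => v - u) (X := fun z => ψ (v - z))
    (W := fun u => Real.exp (a * ‖v‖) * Real.exp (a * ‖v - u‖)) (κ := κ * weight η a v)
    (by fun_prop) (by fun_prop) he he.continuous_shift isCoeff_elastic.continuous_shift
    (shift_iso e) (shift_iso elastic)
    (fun F N hF hN hFN u hu => abs_integral_pairAverage_shift_le hF hN hFN (by fun_prop)
      (by fun_prop) (fun p q hpq => (hψb _).trans ?_) he hu)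
    (Measure.measurePreserving_sub_left volume v) (by fun_prop) (fun x => ?_) hη ha
    (mul_nonneg hκ (weight_pos _ _ _).le) (fun u hu => ?_) (fun u hu => ?_) hg).trans
    (le_of_eq (by ring))
  · rw [← Real.exp_add, ← mul_add]
    exact Real.exp_le_exp.2 (mul_le_mul_of_nonneg_left (norm_sub_le_of_inner hpq) ha)
  · rw [fderiv_const_sub, norm_neg, fderiv_fun_id]
    exact ContinuousLinearMap.norm_id_le
  · have := hb₁ v (v - u) (by simpa using hu)
    simpa [mul_assoc] using this
  · have := hb₂ v (v - u) (by simpa using hu)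
    simpa [mul_assoc] using this

/-- For fixed `w`, the substitution `v = w + u` gives `v' = w + (u - q)`, so `u - q` plays the role
of the transferred velocity. -/
theorem abs_integral_left_nearKernel_le {e : ℝ → ℝ} (he : IsCoeff e) {η a κ R : ℝ} (hη : 0 ≤ η) (ha : 0 ≤ a) (hκ : 0 ≤ κ)
    (hb₁ : ∀ v w : V, ‖v - w‖ ≤ R → ‖v - w‖ * (1 - e ‖v - w‖) *
    (Real.exp (a * ‖v‖) * Real.exp (a * ‖w‖)) ≤ κ * (weight η a v * weight η a w))
    (hb₂ : ∀ v w : V, ‖v - w‖ ≤ R → ‖v - w‖ * (‖v - w‖ * (1 - e ‖v - w‖) *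
    (Real.exp (a * ‖v‖) * Real.exp (a * ‖w‖))) ≤ κ * (weight η a v * weight η a w))
    {ψ : V → ℝ} (hψ : Continuous ψ) (hψb : ∀ z, |ψ z| ≤ Real.exp (a * ‖z‖))
    {f : V → ℝ} (hf : MemW11 η a f) (w : V) :
    |∫ v, f v * ∫ σ, nearKernel e ψ R (v, w, σ) ∂surface| ≤
      2 * κ * weight η a w * normW11 η a f := by
  have h1 : ∫ v, f v * ∫ σ, nearKernel e ψ R (v, w, σ) ∂surface =
      (∫ u in Metric.closedBall (0 : V) R, f (w + u) *
        (‖u‖ * ∫ σ, (ψ (w + (u - shift e u σ)) - ψ (w + (u - shift elastic u σ))) ∂surface)) /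
        (4 * Real.pi) := by
    rw [← integral_add_left_eq_self _ w, ← integral_indicator measurableSet_closedBall,
      ← integral_div]
    refine integral_congr_ae (ae_of_all _ fun u => ?_)
    simp only [integral_nearKernel, add_sub_cancel_left, add_sub_assoc]
    rw [← mul_div_assoc]
    by_cases hu : u ∈ Metric.closedBall (0 : V) R <;> simp [hu]
  rw [h1, abs_div, abs_of_pos (by positivity : 0 < 4 * Real.pi), div_le_iff₀ (by positivity)]
  refine (abs_setIntegral_displacement_le (T := fun u => w + u) (X := fun z => ψ (w + z))
    (W := fun u => Real.exp (a * ‖w‖) * Real.exp (a * ‖w + u‖)) (κ := κ * weight η a w)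
    (by fun_prop) (by fun_prop) he (continuous_fst.sub he.continuous_shift)
    (continuous_fst.sub isCoeff_elastic.continuous_shift)
    (fun A u σ => by rw [shift_iso, map_sub]) (fun A u σ => by rw [shift_iso, map_sub])
    (fun F N hF hN hFN u hu => abs_integral_pairAverage_sub_shift_le hF hN hFN (by fun_prop)
      (by fun_prop) (fun p q hpq => (hψb _).trans ?_) he hu)
    (measurePreserving_add_left volume w) (by fun_prop) (fun x => ?_) hη ha
    (mul_nonneg hκ (weight_pos _ _ _).le) (fun u hu => ?_) (fun u hu => ?_) hf).trans
    (le_of_eq (by ring))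
  · rw [← Real.exp_add, ← mul_add]
    exact Real.exp_le_exp.2 (mul_le_mul_of_nonneg_left (norm_add_le_of_inner hpq) ha)
  · rw [fderiv_const_add, fderiv_fun_id]
    exact ContinuousLinearMap.norm_id_le
  · have := hb₁ (w + u) w (by simpa using hu)
    simp only [add_sub_cancel_left] at this
    linarith
  · have := hb₂ (w + u) w (by simpa using hu)
    simp only [add_sub_cancel_left] at this
    linarith

/-- The contribution of relative velocities at most `R`, when the second argument has a derivative. -/
theorem abs_integral_nearKernel_le_right {e : ℝ → ℝ} (he : IsCoeff e) {η a κ R : ℝ} (hη : 0 ≤ η) (ha : 0 ≤ a) (hκ : 0 ≤ κ)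
    (hb₁ : ∀ v w : V, ‖v - w‖ ≤ R → ‖v - w‖ * (1 - e ‖v - w‖) *
    (Real.exp (a * ‖v‖) * Real.exp (a * ‖w‖)) ≤ κ * (weight η a v * weight η a w))
    (hb₂ : ∀ v w : V, ‖v - w‖ ≤ R → ‖v - w‖ * (‖v - w‖ * (1 - e ‖v - w‖) *
    (Real.exp (a * ‖v‖) * Real.exp (a * ‖w‖))) ≤ κ * (weight η a v * weight η a w))
    {ψ : V → ℝ} (hψ : Continuous ψ) (hψb : ∀ z, |ψ z| ≤ Real.exp (a * ‖z‖))
    {f g : V → ℝ} (hf : MemL1 η a f) (hg : MemW11 η a g)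
    (hI : Integrable (fun p : V × V × S2 => f p.1 * g p.2.1 * nearKernel e ψ R p)
      collisionMeasure) :
    |∫ p, f p.1 * g p.2.1 * nearKernel e ψ R p ∂collisionMeasure| ≤
      2 * κ * (normL1 η a f * normW11 η a g) := by
  rw [integral_prod _ hI]
  have h1 : ∀ᵐ v : V, ∫ q : V × S2, f v * g q.1 * nearKernel e ψ R (v, q)
      ∂((volume : Measure V).prod surface) =
      f v * ∫ w, g w * ∫ σ, nearKernel e ψ R (v, w, σ) ∂surface := by
    filter_upwards [hI.prod_right_ae] with v hv
    rw [integral_prod _ hv]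
    simp only [mul_assoc, integral_const_mul]
  rw [integral_congr_ae h1, ← Real.norm_eq_abs]
  calc _ ≤ ∫ v, 2 * κ * normW11 η a g * (|f v| * weight η a v) := by
        refine norm_integral_le_of_norm_le (hf.integrable_abs.const_mul _)
          (ae_of_all _ fun v => ?_)
        rw [norm_mul, Real.norm_eq_abs, Real.norm_eq_abs]
        have := mul_le_mul_of_nonneg_left (abs_integral_right_nearKernel_le he hη ha hκ hb₁ hb₂ hψ
          hψb hg v) (abs_nonneg (f v))
        linarith
    _ = _ := by rw [integral_const_mul, normL1]; ring

/-- The contribution of relative velocities at most `R`, when the first argument has a derivative. -/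
theorem abs_integral_nearKernel_le_left {e : ℝ → ℝ} (he : IsCoeff e) {η a κ R : ℝ} (hη : 0 ≤ η) (ha : 0 ≤ a) (hκ : 0 ≤ κ)
    (hb₁ : ∀ v w : V, ‖v - w‖ ≤ R → ‖v - w‖ * (1 - e ‖v - w‖) *
    (Real.exp (a * ‖v‖) * Real.exp (a * ‖w‖)) ≤ κ * (weight η a v * weight η a w))
    (hb₂ : ∀ v w : V, ‖v - w‖ ≤ R → ‖v - w‖ * (‖v - w‖ * (1 - e ‖v - w‖) *
    (Real.exp (a * ‖v‖) * Real.exp (a * ‖w‖))) ≤ κ * (weight η a v * weight η a w))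
    {ψ : V → ℝ} (hψ : Continuous ψ) (hψb : ∀ z, |ψ z| ≤ Real.exp (a * ‖z‖))
    {f g : V → ℝ} (hf : MemW11 η a f) (hg : MemL1 η a g)
    (hI : Integrable (fun p : V × V × S2 => f p.1 * g p.2.1 * nearKernel e ψ R p)
      collisionMeasure) :
    |∫ p, f p.1 * g p.2.1 * nearKernel e ψ R p ∂collisionMeasure| ≤
      2 * κ * (normL1 η a g * normW11 η a f) := by
  -- Exchanging `v` and `w` makes the variable of the Sobolev factor the inner one.
  have hmp : MeasurePreserving (fun p : V × V × S2 => (p.2.1, p.1, p.2.2)) collisionMeasure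
      collisionMeasure := by
    have h1 := (measurePreserving_prodAssoc (volume : Measure V) (volume : Measure V) surface).symm
    have h2 := (Measure.measurePreserving_swap (μ := (volume : Measure V))
      (ν := (volume : Measure V))).prod (MeasurePreserving.id surface)
    exact (measurePreserving_prodAssoc (volume : Measure V) (volume : Measure V) surface).comp
      (h2.comp h1)
  have hI' : Integrable (fun p : V × V × S2 => f p.2.1 * g p.1 * nearKernel e ψ R (p.2.1, p.1, p.2.2))
      collisionMeasure := hmp.integrable_comp_of_integrable hI
  have h0 := integral_map (μ := collisionMeasure) hmp.aemeasurable
    (f := fun p => f p.1 * g p.2.1 * nearKernel e ψ R p) (by rw [hmp.map_eq]; exact hI.1)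
  rw [hmp.map_eq] at h0
  refine (congrArg abs (h0.trans (integral_prod _ hI'))).trans_le ?_
  have h1 : ∀ᵐ w : V, ∫ q : V × S2, f q.1 * g w * nearKernel e ψ R (q.1, w, q.2)
      ∂((volume : Measure V).prod surface) =
      g w * ∫ v, f v * ∫ σ, nearKernel e ψ R (v, w, σ) ∂surface := by
    filter_upwards [hI'.prod_right_ae] with w hw
    refine (integral_prod _ hw).trans ?_
    rw [← integral_const_mul]
    refine integral_congr_ae (ae_of_all _ fun v => ?_)
    simp only [integral_const_mul]
    ring
  rw [integral_congr_ae h1, ← Real.norm_eq_abs]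
  calc _ ≤ ∫ w, 2 * κ * normW11 η a f * (|g w| * weight η a w) := by
        refine norm_integral_le_of_norm_le (hg.integrable_abs.const_mul _)
          (ae_of_all _ fun w => ?_)
        rw [norm_mul, Real.norm_eq_abs, Real.norm_eq_abs]
        have := mul_le_mul_of_nonneg_left (abs_integral_left_nearKernel_le he hη ha hκ hb₁ hb₂ hψ
          hψb hf w) (abs_nonneg (g w))
        linarith
    _ = _ := by rw [integral_const_mul, normL1]; ring

/-! ### Large relative velocities: angular decay of the exponential weight -/

theorem surface_real_univ : surface.real univ = 4 * Real.pi := by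
  have hm : ‖(EuclideanSpace.single 0 1 : V)‖ = 1 := by simp
  have := integral_surface_one_sub_inner hm (h := fun _ => 1) measurable_const
  simp at this
  rw [this]; ring

theorem integral_exp_neg_mul_le {c : ℝ} (hc : 0 < c) : ∫ y in (0 : ℝ)..2, Real.exp (-(c * y)) ≤ 1 / c := by
  have h1 : ∀ y ∈ uIcc (0 : ℝ) 2, HasDerivAt (fun y => -Real.exp (-(c * y)) / c)
      (Real.exp (-(c * y))) y := fun y _ => by
    have := ((((hasDerivAt_id y).const_mul c).neg.exp).neg).div_const c
    refine this.congr_deriv ?_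
    simp; field_simp
  rw [intervalIntegral.integral_eq_sub_of_hasDerivAt h1
    (Continuous.intervalIntegrable (by fun_prop) _ _)]
  have := Real.exp_pos (-(c * 2))
  rw [mul_zero, neg_zero, Real.exp_zero, ← sub_div]
  gcongr
  linarith

/-- The velocity of the second particle after an elastic collision. -/
def recoil (v w : V) (σ : S2) : V := (1 / 2 : ℝ) • (v + w) - (‖v - w‖ / 2) • (σ : V)

theorem norm_recoil_sq (v w : V) (σ : S2) :
    ‖recoil v w σ‖ ^ 2 = ‖(1 / 2 : ℝ) • (v + w)‖ ^ 2 + (‖v - w‖ / 2) ^ 2 -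
      2 * (‖v - w‖ / 2) * inner ℝ ((1 / 2 : ℝ) • (v + w)) (σ : V) := by
  rw [recoil, norm_sub_sq_real, norm_smul _ (σ : V), norm_sphere, inner_smul_right,
    Real.norm_of_nonneg (by positivity)]
  ring

theorem norm_sq_add_norm_sq (v w : V) : ‖v‖ ^ 2 + ‖w‖ ^ 2 =
    2 * (‖(1 / 2 : ℝ) • (v + w)‖ ^ 2 + (‖v - w‖ / 2) ^ 2) := by
  rw [norm_smul, mul_pow, norm_add_sq_real, div_pow, norm_sub_sq_real]
  norm_num; ring

theorem postVelocity_elastic (v w : V) (σ : S2) :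
    postVelocity elastic v w σ = (1 / 2 : ℝ) • (v + w) + (‖v - w‖ / 2) • (σ : V) := by
  simp only [postVelocity, elastic]
  module

theorem norm_postVelocity_elastic_sq (v w : V) (σ : S2) :
    ‖postVelocity elastic v w σ‖ ^ 2 + ‖recoil v w σ‖ ^ 2 = ‖v‖ ^ 2 + ‖w‖ ^ 2 := by
  rw [norm_recoil_sq, norm_sq_add_norm_sq, postVelocity_elastic, norm_add_sq_real,
    norm_smul _ (σ : V), norm_sphere, inner_smul_right, Real.norm_of_nonneg (by positivity)]
  ring

/-- Energy transferred to the recoiling particle lowers the outgoing speed. -/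
theorem IsCoeff.recoil_sq_le {e : ℝ → ℝ} (he : IsCoeff e) (v w : V) (σ : S2) {E : ℝ} (hE : 0 < E)
    (hE2 : E ^ 2 = ‖v‖ ^ 2 + ‖w‖ ^ 2) :
    ‖recoil v w σ‖ ^ 2 / (4 * E) ≤ ‖v‖ + ‖w‖ - ‖postVelocity e v w σ‖ := by
  have h0 := he.nonneg _ (impactVelocity_nonneg (v - w) σ)
  have h1 := he.le_one _ (impactVelocity_nonneg (v - w) σ)
  set β := (1 + e (impactVelocity (v - w) σ)) / 2 with hβ
  -- The inelastic outgoing velocity is a convex combination of `v` and the elastic one, with weight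
  -- `β ≥ 1 / 2` on the latter. So at least half of the elastic loss of speed is retained.
  have h2 : postVelocity e v w σ = (1 - β) • v + β • postVelocity elastic v w σ := by
    simp only [postVelocity, elastic, ← hβ]
    module
  have h3 : ‖postVelocity e v w σ‖ ≤ (1 - β) * ‖v‖ + β * ‖postVelocity elastic v w σ‖ := by
    rw [h2]
    refine (norm_add_le _ _).trans (le_of_eq ?_)
    rw [norm_smul, norm_smul, Real.norm_of_nonneg (by linarith), Real.norm_of_nonneg (by linarith)]
  have h4 := norm_postVelocity_elastic_sq v w σ
  have h5 : E ≤ ‖v‖ + ‖w‖ := by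
    refine (sq_le_sq₀ hE.le (by positivity)).1 ?_
    nlinarith [mul_nonneg (norm_nonneg v) (norm_nonneg w)]
  -- Conservation of energy writes the recoil energy as `(E - |v'|) (E + |v'|)`, with `v'` the
  -- elastic outgoing velocity, and `|v'| ≤ E`.
  have h6 : ‖recoil v w σ‖ ^ 2 / (2 * E) ≤ E - ‖postVelocity elastic v w σ‖ := by
    rw [div_le_iff₀ (by positivity)]
    nlinarith [sq_nonneg (E - ‖postVelocity elastic v w σ‖)]
  have h7 : 0 ≤ ‖recoil v w σ‖ ^ 2 / (2 * E) := by positivity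
  have h8 : ‖recoil v w σ‖ ^ 2 / (4 * E) = ‖recoil v w σ‖ ^ 2 / (2 * E) / 2 := by
    field_simp; ring
  rw [h8]
  have h9 : 0 ≤ (1 - β) * ‖w‖ := mul_nonneg (by linarith) (norm_nonneg w)
  have h10 : 1 / 2 * (‖v‖ + ‖w‖ - ‖postVelocity elastic v w σ‖) ≤
      β * (‖v‖ + ‖w‖ - ‖postVelocity elastic v w σ‖) :=
    mul_le_mul_of_nonneg_right (by linarith) (by linarith)
  nlinarith

/-- The angular average of the exponential weight after a collision gains a factor `1 / (a |u|)`. -/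
theorem integral_exp_postVelocity_le {e : ℝ → ℝ} (he : IsCoeff e) {a : ℝ} (ha : 0 < a) {v w : V}
    (hvw : v ≠ w) :
    ∫ σ, Real.exp (a * ‖postVelocity e v w σ‖) ∂surface ≤
      256 * Real.pi / (a * ‖v - w‖) * (Real.exp (a * ‖v‖) * Real.exp (a * ‖w‖)) := by
  have hu : 0 < ‖v - w‖ := norm_pos_iff.2 (sub_ne_zero.2 hvw)
  set U := (1 / 2 : ℝ) • (v + w) with hU
  set r := ‖v - w‖ / 2 with hr
  have hr0 : 0 < r := by positivity
  set E := √(‖v‖ ^ 2 + ‖w‖ ^ 2) with hEd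
  have hE2 : E ^ 2 = ‖v‖ ^ 2 + ‖w‖ ^ 2 := Real.sq_sqrt (by positivity)
  have hEU : E ^ 2 = 2 * (‖U‖ ^ 2 + r ^ 2) := by rw [hE2, norm_sq_add_norm_sq]
  have hE : 0 < E := by
    refine lt_of_le_of_ne (Real.sqrt_nonneg _) fun h => ?_
    rw [← h] at hEU
    nlinarith [sq_nonneg ‖U‖]
  have hpt : ∀ σ, Real.exp (a * ‖postVelocity e v w σ‖) ≤
      Real.exp (a * ‖v‖) * Real.exp (a * ‖w‖) *
        Real.exp (-(a * (‖recoil v w σ‖ ^ 2 / (4 * E)))) := fun σ => by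
    rw [← Real.exp_add, ← Real.exp_add]
    refine Real.exp_le_exp.2 ?_
    have := mul_le_mul_of_nonneg_left (he.recoil_sq_le v w σ hE hE2) ha.le
    linarith
  have hpc : Continuous fun σ => postVelocity e v w σ :=
    he.continuous_postVelocity.comp (f := fun σ : S2 => (v, w, σ)) (by fun_prop)
  have hrc : Continuous fun σ => recoil v w σ := by unfold recoil; fun_prop
  have hint : ∀ {G : S2 → ℝ}, Continuous G → Integrable G surface := fun hG =>
    hG.continuousOn.integrableOn_compact isCompact_univ |>.integrable_of_forall_notMem_eq_zero
      fun x hx => absurd (mem_univ x) hx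
  have hmain : ∫ σ, Real.exp (-(a * (‖recoil v w σ‖ ^ 2 / (4 * E)))) ∂surface ≤
      256 * Real.pi / (a * ‖v - w‖) := by
    -- If the mean velocity `U` is not small against `r`, the recoil vanishes at most in the
    -- direction of `U`, and its energy is at least linear in `1 - cos`; integration in that
    -- variable gives the factor. Otherwise the recoil is at least `r / 2` for every `σ`, and the
    -- exponential is small everywhere.
    rcases le_or_gt (r / 2) ‖U‖ with h | h
    · have hU0 : 0 < ‖U‖ := by linarith
      have hm : ‖‖U‖⁻¹ • U‖ = 1 := by rw [norm_smul, norm_inv, norm_norm, inv_mul_cancel₀ hU0.ne']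
      set c := a * r / 8 with hc
      have hc0 : 0 < c := by positivity
      have hE4 : E ≤ 4 * ‖U‖ := by
        refine (sq_le_sq₀ hE.le (by positivity)).1 ?_
        nlinarith
      have hb : ∀ σ : S2, c * (1 - inner ℝ (‖U‖⁻¹ • U) (σ : V)) ≤
          a * (‖recoil v w σ‖ ^ 2 / (4 * E)) := fun σ => by
        have h1 : inner ℝ U (σ : V) = ‖U‖ * inner ℝ (‖U‖⁻¹ • U) (σ : V) := by
          rw [real_inner_smul_left U (σ : V) ‖U‖⁻¹, ← mul_assoc, mul_inv_cancel₀ hU0.ne', one_mul]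
        have h2 : inner ℝ (‖U‖⁻¹ • U) (σ : V) ≤ 1 := by
          have := real_inner_le_norm (‖U‖⁻¹ • U) (σ : V)
          rwa [hm, norm_sphere, one_mul] at this
        have h3 := norm_recoil_sq v w σ
        rw [← hU, ← hr, h1] at h3
        set x := inner ℝ (‖U‖⁻¹ • U) (σ : V)
        have h4 : 2 * r * ‖U‖ * (1 - x) ≤ ‖recoil v w σ‖ ^ 2 := by
          rw [h3]; nlinarith [sq_nonneg (‖U‖ - r)]
        have h5 : r / 8 * (1 - x) ≤ ‖recoil v w σ‖ ^ 2 / (4 * E) := by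
          rw [le_div_iff₀ (by positivity)]
          have : r * (1 - x) * E ≤ r * (1 - x) * (4 * ‖U‖) :=
            mul_le_mul_of_nonneg_left hE4 (mul_nonneg hr0.le (by linarith))
          linarith
        have := mul_le_mul_of_nonneg_left h5 ha.le
        rw [hc]; linarith
      calc _ ≤ ∫ σ : S2, Real.exp (-(c * (1 - inner ℝ (‖U‖⁻¹ • U) (σ : V)))) ∂surface :=
            integral_mono (hint (by fun_prop)) (hint (by fun_prop)) fun σ =>
              Real.exp_le_exp.2 (neg_le_neg (hb σ))
        _ = 2 * Real.pi * ∫ y in (0 : ℝ)..2, Real.exp (-(c * y)) :=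
            integral_surface_one_sub_inner hm (h := fun y => Real.exp (-(c * y))) (by fun_prop)
        _ ≤ 2 * Real.pi * (1 / c) := by gcongr; exact integral_exp_neg_mul_le hc0
        _ = 32 * Real.pi / (a * ‖v - w‖) := by rw [hc, hr]; field_simp; norm_num
        _ ≤ _ := by gcongr; norm_num
    · have hE4 : E ≤ 2 * r := by
        refine (sq_le_sq₀ hE.le (by positivity)).1 ?_
        nlinarith [norm_nonneg U]
      have hb : ∀ σ : S2, Real.exp (-(a * (‖recoil v w σ‖ ^ 2 / (4 * E)))) ≤ 64 / (a * ‖v - w‖) :=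
        fun σ => by
        have h1 : r / 2 ≤ ‖recoil v w σ‖ := by
          have := norm_sub_norm_le (r • (σ : V)) U
          rw [norm_smul, norm_sphere, Real.norm_of_nonneg hr0.le, norm_sub_rev] at this
          simp only [recoil]
          linarith
        have h2 : r / 32 ≤ ‖recoil v w σ‖ ^ 2 / (4 * E) := by
          rw [le_div_iff₀ (by positivity)]
          nlinarith
        have h3 : 0 < a * ‖v - w‖ / 64 := by positivity
        have h4 : a * ‖v - w‖ / 64 ≤ a * (‖recoil v w σ‖ ^ 2 / (4 * E)) := by
          have := mul_le_mul_of_nonneg_left h2 ha.le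
          rw [hr] at this; linarith
        calc _ ≤ Real.exp (-(a * ‖v - w‖ / 64)) := Real.exp_le_exp.2 (neg_le_neg h4)
          _ ≤ (a * ‖v - w‖ / 64)⁻¹ := by
            rw [Real.exp_neg]
            exact inv_anti₀ h3 (by linarith [Real.add_one_le_exp (a * ‖v - w‖ / 64)])
          _ = _ := by rw [inv_div]
      calc _ ≤ ∫ _ : S2, 64 / (a * ‖v - w‖) ∂surface :=
            integral_mono (hint (by fun_prop)) (integrable_const _) hb
        _ = _ := by rw [integral_const, surface_real_univ, smul_eq_mul]; ring
  calc _ ≤ ∫ σ, Real.exp (a * ‖v‖) * Real.exp (a * ‖w‖) *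
        Real.exp (-(a * (‖recoil v w σ‖ ^ 2 / (4 * E)))) ∂surface :=
        integral_mono (hint (by fun_prop)) (hint (by fun_prop)) hpt
    _ = Real.exp (a * ‖v‖) * Real.exp (a * ‖w‖) *
        ∫ σ, Real.exp (-(a * (‖recoil v w σ‖ ^ 2 / (4 * E)))) ∂surface := integral_const_mul _ _
    _ ≤ _ := by
        rw [mul_comm]
        gcongr

/-! ### Joining small and large relative velocities -/

/-- Beyond `R` nothing is gained from the difference of the two values of `ψ`: each is bounded by
its exponential weight, and only the average over `σ` matters. -/
theorem abs_integral_collision_sub_le {e : ℝ → ℝ} (he : IsCoeff e) {η a δ R : ℝ} (hη : 1 ≤ η)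
    (ha : 0 ≤ a) (hδ : 0 ≤ δ)
    (hfar : ∀ v w : V, R < ‖v - w‖ → ‖v - w‖ / (4 * Real.pi) *
      ((∫ σ, Real.exp (a * ‖postVelocity e v w σ‖) ∂surface) +
        ∫ σ, Real.exp (a * ‖postVelocity elastic v w σ‖) ∂surface) ≤
      δ * (weight η a v * weight η a w))
    {ψ : V → ℝ} (hψ : Continuous ψ) (hψb : ∀ z, |ψ z| ≤ Real.exp (a * ‖z‖))
    {f g : V → ℝ} (hf : MemL1 η a f) (hg : MemL1 η a g) {B : ℝ}
    (hnear : Integrable (fun p : V × V × S2 => f p.1 * g p.2.1 * nearKernel e ψ R p)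
      collisionMeasure → |∫ p, f p.1 * g p.2.1 * nearKernel e ψ R p ∂collisionMeasure| ≤ B) :
    |∫ p, f p.1 * g p.2.1 * ((ψ (postVelocity e p.1 p.2.1 p.2.2) -
        ψ (postVelocity elastic p.1 p.2.1 p.2.2)) * (‖p.1 - p.2.1‖ / (4 * Real.pi)))
        ∂collisionMeasure| ≤ B + δ * (normL1 η a f * normL1 η a g) := by
  have hp := he.continuous_postVelocity
  have hp' := isCoeff_elastic.continuous_postVelocity
  set H : V × V × S2 → ℝ := fun p => (ψ (postVelocity e p.1 p.2.1 p.2.2) -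
    ψ (postVelocity elastic p.1 p.2.1 p.2.2)) * (‖p.1 - p.2.1‖ / (4 * Real.pi)) with hH
  have hHc : Continuous H := by fun_prop
  have hHb : ∀ v w σ, |H (v, w, σ)| ≤ 2 * (2 / (4 * Real.pi)) * (weight 1 a v * weight 1 a w) :=
    fun v w σ => by
    simp only [hH, sub_mul]
    have h1 := abs_kernel_le a v w ((hψb _).trans (exp_postVelocity_le he ha v w σ))
    have h2 := abs_kernel_le a v w ((hψb _).trans (exp_postVelocity_le isCoeff_elastic ha v w σ))
    refine (abs_sub _ _).trans ?_
    linarith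
  have hnH : ∀ p, nearKernel e ψ R p = if ‖p.1 - p.2.1‖ ≤ R then H p else 0 := fun p => rfl
  have hf1 := hf.mono hη
  have hg1 := hg.mono hη
  have hI : Integrable (fun p : V × V × S2 => f p.1 * g p.2.1 * H p) collisionMeasure :=
    integrable_mul_kernel hf1 hg1 hHc.aestronglyMeasurable hHb
  have hnm := measurable_nearKernel he hψ R
  have hnI : Integrable (fun p : V × V × S2 => f p.1 * g p.2.1 * nearKernel e ψ R p)
      collisionMeasure :=
    integrable_mul_kernel hf1 hg1 hnm.aestronglyMeasurable fun v w σ => by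
      rw [hnH]
      split_ifs
      · exact hHb v w σ
      · exact (abs_zero.trans_le ((abs_nonneg _).trans (hHb v w σ)))
  have hfI : Integrable (fun p : V × V × S2 => f p.1 * g p.2.1 * (H p - nearKernel e ψ R p))
      collisionMeasure :=
    integrable_mul_kernel hf1 hg1 (hHc.aestronglyMeasurable.sub hnm.aestronglyMeasurable)
      fun v w σ => by
        rw [hnH]
        split_ifs
        · rw [sub_self]
          exact (abs_zero.trans_le ((abs_nonneg _).trans (hHb v w σ)))
        · rw [sub_zero]; exact hHb v w σ
  have hsplit : ∫ p, f p.1 * g p.2.1 * H p ∂collisionMeasure =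
      (∫ p, f p.1 * g p.2.1 * nearKernel e ψ R p ∂collisionMeasure) +
        ∫ p, f p.1 * g p.2.1 * (H p - nearKernel e ψ R p) ∂collisionMeasure := by
    rw [← integral_add hnI hfI]
    exact integral_congr_ae (ae_of_all _ fun p => by simp only; ring)
  rw [hsplit]
  refine (abs_add_le _ _).trans (add_le_add (hnear hnI) ?_)
  refine (abs_integral_mul_kernel_le hf hg hfI (C := δ) fun v w => ?_).trans_eq (mul_assoc _ _ _)
  rcases le_or_gt ‖v - w‖ R with h | h
  · have : ∀ σ, H (v, w, σ) - nearKernel e ψ R (v, w, σ) = 0 := fun σ => by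
      rw [hnH, if_pos h, sub_self]
    simp only [this, abs_zero, integral_zero]
    exact mul_nonneg hδ (mul_nonneg (weight_pos _ _ _).le (weight_pos _ _ _).le)
  · refine le_trans ?_ (hfar v w h)
    have hint : ∀ {G : S2 → ℝ}, Continuous G → Integrable G surface := fun hG =>
      hG.continuousOn.integrableOn_compact isCompact_univ |>.integrable_of_forall_notMem_eq_zero
        fun x hx => absurd (mem_univ x) hx
    have hpc : Continuous fun σ => postVelocity e v w σ :=
      hp.comp (f := fun σ : S2 => (v, w, σ)) (by fun_prop)
    have hpc' : Continuous fun σ => postVelocity elastic v w σ :=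
      hp'.comp (f := fun σ : S2 => (v, w, σ)) (by fun_prop)
    have i1 : Integrable (fun σ => Real.exp (a * ‖postVelocity e v w σ‖)) surface :=
      hint (by fun_prop)
    have i2 : Integrable (fun σ => Real.exp (a * ‖postVelocity elastic v w σ‖)) surface :=
      hint (by fun_prop)
    rw [← integral_add i1 i2, ← integral_const_mul]
    have hnc : ∀ σ, H (v, w, σ) - nearKernel e ψ R (v, w, σ) = H (v, w, σ) := fun σ => by
      rw [hnH, if_neg (not_le.2 h), sub_zero]
    simp only [hnc]
    refine integral_mono (hint (hHc.comp (f := fun σ : S2 => (v, w, σ)) (by fun_prop)).abs)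
      ((i1.add i2).const_mul _) fun σ => ?_
    simp only [hH]
    rw [abs_mul, abs_of_nonneg (by positivity : 0 ≤ ‖v - w‖ / (4 * Real.pi)), mul_comm]
    refine mul_le_mul_of_nonneg_left ?_ (by positivity)
    exact (abs_sub _ _).trans (add_le_add (hψb _) (hψb _))

theorem gainDifferenceBound_of_near_far {e : ℝ → ℝ} {l : ℝ} (he : IsCoeff (rescale e l))
    {η a κ δ R : ℝ} (hη : 1 ≤ η) (ha : 0 ≤ a) (hκ : 0 ≤ κ) (hδ : 0 ≤ δ)
    (hb₁ : ∀ v w : V, ‖v - w‖ ≤ R → ‖v - w‖ * (1 - rescale e l ‖v - w‖) *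
      (Real.exp (a * ‖v‖) * Real.exp (a * ‖w‖)) ≤ κ * (weight η a v * weight η a w))
    (hb₂ : ∀ v w : V, ‖v - w‖ ≤ R → ‖v - w‖ * (‖v - w‖ * (1 - rescale e l ‖v - w‖) *
      (Real.exp (a * ‖v‖) * Real.exp (a * ‖w‖))) ≤ κ * (weight η a v * weight η a w))
    (hfar : ∀ v w : V, R < ‖v - w‖ → ‖v - w‖ / (4 * Real.pi) *
      ((∫ σ, Real.exp (a * ‖postVelocity (rescale e l) v w σ‖) ∂surface) +
        ∫ σ, Real.exp (a * ‖postVelocity elastic v w σ‖) ∂surface) ≤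
      δ * (weight η a v * weight η a w)) {c : ℝ} (hc : 2 * κ + δ ≤ c) (f g : V → ℝ) :
    (MemL1 η a f → MemW11 η a g →
      GainDifferenceBound e l a f g (c * normL1 η a f * normW11 η a g)) ∧
    (MemL1 η a g → MemW11 η a f →
      GainDifferenceBound e l a f g (c * normL1 η a g * normW11 η a f)) := by
  have hη0 : 0 ≤ η := by linarith
  constructor
  · intro hf hg
    refine gainDifferenceBound_of_pairing he ha (hf.mono hη) (hg.1.mono hη) fun ψ hψ _ hψb => ?_
    refine (abs_integral_collision_sub_le he hη ha hδ hfar hψ hψb hf hg.1 fun hI =>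
      abs_integral_nearKernel_le_right he hη0 ha hκ hb₁ hb₂ hψ hψb hf hg hI).trans ?_
    have h1 := mul_le_mul_of_nonneg_left (normL1_le_normW11 η a g) (normL1_nonneg η a f)
    have h2 := mul_le_mul_of_nonneg_left h1 hδ
    have h3 := mul_le_mul_of_nonneg_right hc
      (mul_nonneg (normL1_nonneg η a f) (normW11_nonneg η a g))
    linarith
  · intro hg hf
    refine gainDifferenceBound_of_pairing he ha (hf.1.mono hη) (hg.mono hη) fun ψ hψ _ hψb => ?_
    refine (abs_integral_collision_sub_le he hη ha hδ hfar hψ hψb hf.1 hg fun hI =>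
      abs_integral_nearKernel_le_left he hη0 ha hκ hb₁ hb₂ hψ hψb hf hg hI).trans ?_
    have h1 := mul_le_mul_of_nonneg_left (normL1_le_normW11 η a f) (normL1_nonneg η a g)
    have h2 := mul_le_mul_of_nonneg_left h1 hδ
    have h3 := mul_le_mul_of_nonneg_right hc
      (mul_nonneg (normL1_nonneg η a g) (normW11_nonneg η a f))
    linarith

/-! ### Rates and the choice of the cut-off -/

/-- Near `0` this is the asymptotic expansion; for `r ≥ d` the left side is below `1 ≤ (r / d) ^ γ`.
Making the bound global removes any condition on `l` from the `l ^ γ` estimate. -/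
theorem IsRestitution.exists_one_sub_le {e : ℝ → ℝ} {α γ : ℝ} (h : IsRestitution e α γ) :
    ∃ A, 0 < A ∧ ∀ r, 0 < r → 1 - e r ≤ A * r ^ γ := by
  have h1 := h.asymptotics.def zero_lt_one
  rw [eventually_nhdsWithin_iff, Metric.eventually_nhds_iff] at h1
  obtain ⟨d, hd, h1⟩ := h1
  have hα := h.alpha_pos
  have hdγ : 0 < (d ^ γ)⁻¹ := inv_pos.2 (Real.rpow_pos_of_pos hd γ)
  refine ⟨α + 1 + (d ^ γ)⁻¹, by positivity, fun r hr => ?_⟩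
  have hrγ : 0 < r ^ γ := Real.rpow_pos_of_pos hr γ
  rcases lt_or_ge r d with hrd | hrd
  · have h2 := h1 (y := r) (by rwa [Real.dist_0_eq_abs, abs_of_pos hr]) hr
    rw [Real.norm_eq_abs, Real.norm_of_nonneg hrγ.le] at h2
    have h3 := (abs_le.1 h2).1
    have := mul_pos hdγ hrγ
    linarith
  · have h2 := h.pos r hr.le
    have h3 : 1 ≤ (d ^ γ)⁻¹ * r ^ γ := by
      rw [inv_mul_eq_div, one_le_div (Real.rpow_pos_of_pos hd γ)]
      exact Real.rpow_le_rpow hd.le hrd h.gamma_nonneg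
    have := mul_pos hα hrγ
    linarith

theorem integral_exp_postVelocity_le_const {e : ℝ → ℝ} (he : IsCoeff e) {a : ℝ} (ha : 0 ≤ a)
    (v w : V) : ∫ σ, Real.exp (a * ‖postVelocity e v w σ‖) ∂surface ≤
      4 * Real.pi * (Real.exp (a * ‖v‖) * Real.exp (a * ‖w‖)) := by
  calc _ ≤ ∫ _ : S2, Real.exp (a * ‖v‖) * Real.exp (a * ‖w‖) ∂surface := by
        refine integral_mono_of_nonneg (ae_of_all _ fun σ => (Real.exp_pos _).le)
          (integrable_const _) (ae_of_all _ fun σ => exp_postVelocity_le he ha v w σ)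
    _ = _ := by rw [integral_const, surface_real_univ, smul_eq_mul]

/-- The rate `l ^ γ` with polynomial weights of degree at least `γ + 2`. -/
theorem gainDifferenceBound_of_rpow_le {e : ℝ → ℝ} (he : IsCoeff e) {γ A : ℝ} (hγ : 0 ≤ γ)
    (hA0 : 0 < A) (hA : ∀ r, 0 < r → 1 - e r ≤ A * r ^ γ) {η a l : ℝ} (hη : γ + 2 ≤ η)
    (ha : 0 ≤ a) (hl : 0 < l) (f g : V → ℝ) :
    (MemL1 η a f → MemW11 η a g → GainDifferenceBound e l a f g
      ((2 * (A * 2 ^ (γ + 2)) + 8) * l ^ γ * normL1 η a f * normW11 η a g)) ∧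
    (MemL1 η a g → MemW11 η a f → GainDifferenceBound e l a f g
      ((2 * (A * 2 ^ (γ + 2)) + 8) * l ^ γ * normL1 η a g * normW11 η a f)) := by
  have hlγ : 0 < l ^ γ := Real.rpow_pos_of_pos hl γ
  have hpow : ∀ p : ℝ, 0 ≤ p → p ≤ γ + 2 → ∀ v w : V, ‖v - w‖ ^ p *
      (Real.exp (a * ‖v‖) * Real.exp (a * ‖w‖)) ≤ 2 ^ p * (weight η a v * weight η a w) :=
    fun p hp hp' v w => norm_sub_rpow_mul_exp_le hp (hp'.trans hη) a v w
  have hdef : ∀ r, 0 < r → 1 - rescale e l r ≤ A * l ^ γ * r ^ γ := fun r hr => by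
    have := hA (l * r) (by positivity)
    rwa [Real.mul_rpow hl.le hr.le, ← mul_assoc] at this
  -- Beyond this `R` one has `1 ≤ l ^ γ |u|`, so one additional power of `|u|`, paid by the weights,
  -- yields the factor `l ^ γ` without any angular averaging.
  refine gainDifferenceBound_of_near_far (he.rescale hl) (R := (l ^ γ)⁻¹)
    (κ := A * l ^ γ * 2 ^ (γ + 2)) (δ := 8 * l ^ γ) (by linarith) ha (by positivity) (by positivity)
    (fun v w _ => ?_) (fun v w _ => ?_) (fun v w h => ?_) (le_of_eq (by ring)) f g
  · have hW := mul_pos (weight_pos η a v) (weight_pos η a w)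
    rcases (norm_nonneg (v - w)).eq_or_lt with h0 | h0
    · rw [← h0]; simp only [zero_mul]; positivity
    · calc _ ≤ ‖v - w‖ * (A * l ^ γ * ‖v - w‖ ^ γ) * (Real.exp (a * ‖v‖) * Real.exp (a * ‖w‖)) := by
            gcongr; exact hdef _ h0
        _ = A * l ^ γ * (‖v - w‖ ^ (γ + 1) * (Real.exp (a * ‖v‖) * Real.exp (a * ‖w‖))) := by
            rw [Real.rpow_add_one h0.ne']; ring
        _ ≤ A * l ^ γ * (2 ^ (γ + 1) * (weight η a v * weight η a w)) := by
            exact mul_le_mul_of_nonneg_left (hpow _ (by linarith) (by linarith) v w) (by positivity)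
        _ ≤ A * l ^ γ * (2 ^ (γ + 2) * (weight η a v * weight η a w)) := by
            gcongr <;> norm_num
        _ = _ := by ring
  · have hW := mul_pos (weight_pos η a v) (weight_pos η a w)
    rcases (norm_nonneg (v - w)).eq_or_lt with h0 | h0
    · rw [← h0]; simp only [zero_mul]; positivity
    · calc _ ≤ ‖v - w‖ * (‖v - w‖ * (A * l ^ γ * ‖v - w‖ ^ γ) *
            (Real.exp (a * ‖v‖) * Real.exp (a * ‖w‖))) := by
            gcongr; exact hdef _ h0
        _ = A * l ^ γ * (‖v - w‖ ^ (γ + 2) * (Real.exp (a * ‖v‖) * Real.exp (a * ‖w‖))) := by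
            rw [Real.rpow_add h0, Real.rpow_two]; ring
        _ ≤ A * l ^ γ * (2 ^ (γ + 2) * (weight η a v * weight η a w)) := by
            exact mul_le_mul_of_nonneg_left (hpow _ (by linarith) le_rfl v w) (by positivity)
        _ = _ := by ring
  · have h1 := integral_exp_postVelocity_le_const (he.rescale hl) ha v w
    have h2 := integral_exp_postVelocity_le_const isCoeff_elastic ha v w
    have h3 : 1 ≤ l ^ γ * ‖v - w‖ := by
      have := mul_lt_mul_of_pos_left h hlγ
      rw [mul_inv_cancel₀ hlγ.ne'] at this
      exact this.le
    have h4 := hpow 2 (by norm_num) (by linarith) v w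
    rw [Real.rpow_two, Real.rpow_two] at h4
    calc _ ≤ ‖v - w‖ / (4 * Real.pi) * (4 * Real.pi * (Real.exp (a * ‖v‖) * Real.exp (a * ‖w‖)) +
          4 * Real.pi * (Real.exp (a * ‖v‖) * Real.exp (a * ‖w‖))) := by gcongr
      _ = 2 * ‖v - w‖ * (Real.exp (a * ‖v‖) * Real.exp (a * ‖w‖)) * 1 := by field_simp; ring
      _ ≤ 2 * ‖v - w‖ * (Real.exp (a * ‖v‖) * Real.exp (a * ‖w‖)) * (l ^ γ * ‖v - w‖) := by gcongr
      _ = 2 * l ^ γ * (‖v - w‖ ^ 2 * (Real.exp (a * ‖v‖) * Real.exp (a * ‖w‖))) := by ring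
      _ ≤ 2 * l ^ γ * (2 ^ 2 * (weight η a v * weight η a w)) := by gcongr
      _ = _ := by ring

/-- The bound obtained by cutting off relative velocities larger than `R`. -/
theorem gainDifferenceBound_of_cutoff {e : ℝ → ℝ} (he : IsCoeff e) {a l R : ℝ} (ha : 0 < a)
    (hl : 0 < l) (hR : 1 ≤ R) {c : ℝ} (hc : 4 * R * (1 - e (l * R)) + 256 / a * R⁻¹ ≤ c)
    (f g : V → ℝ) :
    (MemL1 1 a f → MemW11 1 a g → GainDifferenceBound e l a f g
      (c * normL1 1 a f * normW11 1 a g)) ∧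
    (MemL1 1 a g → MemW11 1 a f → GainDifferenceBound e l a f g
      (c * normL1 1 a g * normW11 1 a f)) := by
  have hR0 : 0 < R := by linarith
  have hpow : ∀ v w : V, ‖v - w‖ * (Real.exp (a * ‖v‖) * Real.exp (a * ‖w‖)) ≤
      2 * (weight 1 a v * weight 1 a w) := fun v w => by
    have := norm_sub_rpow_mul_exp_le zero_le_one (le_refl (1 : ℝ)) a v w
    rwa [Real.rpow_one, Real.rpow_one] at this
  have hd : 0 ≤ 1 - e (l * R) := by linarith [he.le_one (l * R) (by positivity)]
  have hmono : ∀ v w : V, ‖v - w‖ ≤ R → 1 - rescale e l ‖v - w‖ ≤ 1 - e (l * R) :=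
    fun v w h => by
      have : e (l * R) ≤ e (l * ‖v - w‖) := he.antitone (mem_Ici.2 (by positivity))
        (mem_Ici.2 (by positivity)) (by gcongr)
      unfold rescale; linarith
  -- In `κ` one power of `|u|` is absorbed by the weights at the cost of `2`, and the further power
  -- coming with the gradient is bounded by `R`. In `δ` the decay `1 / (a |u|)` cancels the `|u|` of
  -- the kernel, and the unused weight is traded for `R⁻¹`.
  refine gainDifferenceBound_of_near_far (he.rescale hl) (R := R)
    (κ := 2 * R * (1 - e (l * R))) (δ := 256 / a * R⁻¹) le_rfl ha.le (by positivity) (by positivity)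
    (fun v w h => ?_) (fun v w h => ?_) (fun v w h => ?_) ?_ f g
  · have hW := mul_pos (weight_pos 1 a v) (weight_pos 1 a w)
    calc _ ≤ ‖v - w‖ * (1 - e (l * R)) * (Real.exp (a * ‖v‖) * Real.exp (a * ‖w‖)) := by
          gcongr; linarith [hmono v w h]
      _ = (1 - e (l * R)) * (‖v - w‖ * (Real.exp (a * ‖v‖) * Real.exp (a * ‖w‖))) := by ring
      _ ≤ (1 - e (l * R)) * (2 * (weight 1 a v * weight 1 a w)) := by exact mul_le_mul_of_nonneg_left (hpow v w) (by positivity)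
      _ = 1 * ((1 - e (l * R)) * (2 * (weight 1 a v * weight 1 a w))) := by ring
      _ ≤ R * ((1 - e (l * R)) * (2 * (weight 1 a v * weight 1 a w))) := by gcongr
      _ = _ := by ring
  · have hW := mul_pos (weight_pos 1 a v) (weight_pos 1 a w)
    calc _ ≤ R * (‖v - w‖ * (1 - e (l * R)) * (Real.exp (a * ‖v‖) * Real.exp (a * ‖w‖))) := by
          have := hmono v w h
          gcongr
          exact mul_nonneg (mul_nonneg (norm_nonneg _)
            (by linarith [(he.rescale hl).le_one _ (norm_nonneg (v - w))])) (by positivity)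
      _ = R * (1 - e (l * R)) * (‖v - w‖ * (Real.exp (a * ‖v‖) * Real.exp (a * ‖w‖))) := by ring
      _ ≤ R * (1 - e (l * R)) * (2 * (weight 1 a v * weight 1 a w)) := by exact mul_le_mul_of_nonneg_left (hpow v w) (by positivity)
      _ = _ := by ring
  · have hu : 0 < ‖v - w‖ := hR0.trans h
    have hvw : v ≠ w := sub_ne_zero.1 (norm_pos_iff.1 hu)
    have h1 := integral_exp_postVelocity_le (he.rescale hl) ha hvw
    have h2 := integral_exp_postVelocity_le isCoeff_elastic ha hvw
    have h3 : 1 ≤ R⁻¹ * ‖v - w‖ := by rw [inv_mul_eq_div, one_le_div hR0]; exact h.le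
    calc _ ≤ ‖v - w‖ / (4 * Real.pi) *
          (256 * Real.pi / (a * ‖v - w‖) * (Real.exp (a * ‖v‖) * Real.exp (a * ‖w‖)) +
          256 * Real.pi / (a * ‖v - w‖) * (Real.exp (a * ‖v‖) * Real.exp (a * ‖w‖))) := by gcongr
      _ = 128 / a * (Real.exp (a * ‖v‖) * Real.exp (a * ‖w‖)) * 1 := by
          field_simp; norm_num
      _ ≤ 128 / a * (Real.exp (a * ‖v‖) * Real.exp (a * ‖w‖)) * (R⁻¹ * ‖v - w‖) := by gcongr
      _ = 128 / a * R⁻¹ * (‖v - w‖ * (Real.exp (a * ‖v‖) * Real.exp (a * ‖w‖))) := by ring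
      _ ≤ 128 / a * R⁻¹ * (2 * (weight 1 a v * weight 1 a w)) := by exact mul_le_mul_of_nonneg_left (hpow v w) (by positivity)
      _ = _ := by ring
  · linarith

/-- For small `l`, the cutoff at `R = l ^ (-γ / (8 + 3γ))` makes the elastic defect negligible. -/
theorem exists_cutoff_defect_le {e : ℝ → ℝ} {α γ : ℝ} (h : IsRestitution e α γ) :
    ∃ l₀ : ℝ, 0 < l₀ ∧ l₀ < 1 ∧ ∀ l : ℝ, 0 < l → l < l₀ →
      (l ^ (γ / (8 + 3 * γ)))⁻¹ * (1 - e (l * (l ^ (γ / (8 + 3 * γ)))⁻¹)) ≤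
        l ^ (γ / (8 + 3 * γ)) := by
  obtain ⟨A, hA0, hA⟩ := h.exists_one_sub_le
  rcases h.gamma_nonneg.eq_or_lt with hγ | hγ
  -- For `γ = 0` both powers of `l` equal `1`, and the claim is `1 - e ≤ 1`.
  · refine ⟨1 / 2, by norm_num, by norm_num, fun l hl _ => ?_⟩
    have := h.pos (l * 1) (by linarith)
    simp only [← hγ, zero_div, Real.rpow_zero, inv_one]
    linarith
  · set θ := γ / (8 + 3 * γ) with hθ
    -- The left side is at most `A l ^ (γ - θ (γ + 1)) = A l ^ s * l ^ θ`. The surplus `s` is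
    -- positive for any `θ < γ / (γ + 2)`, so the exponent in the statement leaves room.
    set s := γ - θ * (γ + 2) with hs
    have hs0 : 0 < s := by
      have : s = γ * (6 + 2 * γ) / (8 + 3 * γ) := by rw [hs, hθ]; field_simp; ring
      rw [this]; positivity
    -- Below this threshold `A l ^ s ≤ 1`: the constant `A`, which depends on `e`, disappears from
    -- the estimate.
    refine ⟨(A + 1)⁻¹ ^ s⁻¹, by positivity, Real.rpow_lt_one (by positivity)
      (inv_lt_one_of_one_lt₀ (by linarith)) (by positivity), fun l hl hl0 => ?_⟩
    have h1 : A * l ^ s ≤ 1 := by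
      have h2 : l ^ s ≤ (A + 1)⁻¹ := by
        have := Real.rpow_le_rpow hl.le hl0.le hs0.le
        rwa [← Real.rpow_mul (by positivity), inv_mul_cancel₀ hs0.ne', Real.rpow_one] at this
      calc A * l ^ s ≤ A * (A + 1)⁻¹ := by gcongr
        _ ≤ 1 := by rw [← div_eq_mul_inv, div_le_one (by linarith)]; linarith
    have hlθ : 0 < l ^ θ := Real.rpow_pos_of_pos hl θ
    have h3 := hA (l * (l ^ θ)⁻¹) (by positivity)
    have h4 : (l ^ θ)⁻¹ * (A * (l * (l ^ θ)⁻¹) ^ γ) = A * l ^ s * l ^ θ := by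
      rw [← Real.rpow_neg hl.le, ← Real.rpow_one_add' hl.le, ← Real.rpow_mul hl.le, mul_assoc,
        mul_left_comm, ← Real.rpow_add hl, ← Real.rpow_add hl]
      · congr 2; rw [hs]; ring
      · have : θ < 1 := by rw [hθ, div_lt_one (by positivity)]; linarith
        linarith
    calc _ ≤ (l ^ θ)⁻¹ * (A * (l * (l ^ θ)⁻¹) ^ γ) := by gcongr
      _ = A * l ^ s * l ^ θ := h4
      _ ≤ 1 * l ^ θ := by gcongr
      _ = _ := one_mul _

end

end Granular

open Granular in
theorem theorem3p11 (γ : ℝ) (hγ : 0 ≤ γ) :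
    ∃ C : ℝ → ℝ, (∀ a, 0 < a → 0 < C a) ∧
      ∀ (e : ℝ → ℝ) (α : ℝ), IsRestitution e α γ →
        (∃ l₀ : ℝ, 0 < l₀ ∧ l₀ < 1 ∧
          ∀ a : ℝ, 0 < a → ∀ l : ℝ, 0 < l → l < l₀ → ∀ f g : V → ℝ,
            (MemL1 1 a f → MemW11 1 a g →
              GainDifferenceBound e l a f g
                (C a * l ^ (γ / (8 + 3 * γ)) * normL1 1 a f * normW11 1 a g)) ∧
            (MemL1 1 a g → MemW11 1 a f →
              GainDifferenceBound e l a f g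
                (C a * l ^ (γ / (8 + 3 * γ)) * normL1 1 a g * normW11 1 a f))) ∧
        (∃ l₀ : ℝ, 0 < l₀ ∧ l₀ < 1 ∧
          ∀ a : ℝ, 0 ≤ a → ∃ K : ℝ, 0 < K ∧
            ∀ l : ℝ, 0 < l → l < l₀ → ∀ f g : V → ℝ,
            (MemL1 (γ + 10 / 3) a f → MemW11 (γ + 10 / 3) a g →
              GainDifferenceBound e l a f g
                (K * l ^ γ * normL1 (γ + 10 / 3) a f * normW11 (γ + 10 / 3) a g)) ∧
            (MemL1 (γ + 10 / 3) a g → MemW11 (γ + 10 / 3) a f →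
              GainDifferenceBound e l a f g
                (K * l ^ γ * normL1 (γ + 10 / 3) a g * normW11 (γ + 10 / 3) a f))) := by
  -- With `R⁻¹ = l ^ θ`, the near part contributes `4 R (1 - e (l R)) ≤ 4 l ^ θ` and the far part
  -- `(256 / a) l ^ θ`.
  refine ⟨fun a => 4 + 256 / a, fun a ha => by positivity, fun e α he => ⟨?_, ?_⟩⟩
  · obtain ⟨l₀, h0, h1, h⟩ := exists_cutoff_defect_le he
    refine ⟨l₀, h0, h1, fun a ha l hl hl0 f g => ?_⟩
    have hθ : 0 ≤ γ / (8 + 3 * γ) := by positivity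
    have hlθ : 0 < l ^ (γ / (8 + 3 * γ)) := Real.rpow_pos_of_pos hl _
    refine gainDifferenceBound_of_cutoff he.isCoeff ha hl (R := (l ^ (γ / (8 + 3 * γ)))⁻¹)
      ((one_le_inv₀ hlθ).2 (Real.rpow_le_one hl.le (by linarith) hθ)) ?_ f g
    have := h l hl hl0
    rw [inv_inv]
    linarith
  · obtain ⟨A, hA0, hA⟩ := he.exists_one_sub_le
    -- Any threshold would do, as the bound on `1 - e` is global; the constant depends on `e`
    -- through `A` and not on `a`.
    exact ⟨1 / 2, by norm_num, by norm_num, fun a ha => ⟨2 * (A * 2 ^ (γ + 2)) + 8, by positivity,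
      fun l hl _ f g => gainDifferenceBound_of_rpow_le he.isCoeff hγ hA0 hA (by linarith) ha hl f g⟩⟩
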